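/- Work on $\mathbb R^n$ with coordinates $x_1,\dots,x_n$ and $\partial^i=\partial/\partial x_i$. For $p\ge 1$, a pair consisting of a smooth $2p$-vector field $\Lambda$ and a smooth $(2p-1)$-vector field $E$ is a *generalized Jacobi structure* if the bracket $$\{f_1,\dots,f_{2p}\}=\Lambda(df_1,\dots,df_{2p})-\sum_{j=1}^{2p}(-1)^jf_j\,E(df_1,\dots,\widehat{df_j},\dots,df_{2p})$$ satisfies $\epsilon^{j_1\dots j_{4p-1}}_{1\dots 4p-1}\{f_{j_1},\dots,f_{j_{2p-1}},\{f_{j_{2p}},\dots,f_{j_{4p-1}}\}\}=0$ for all smooth $f_1,\dots,f_{4p-1}$. Let $[\cdot,\cdot]$ be the Schouten–Nijenhuis bracket, $$[P,Q]^{K}=\tfrac{1}{(a-1)!\,b!}\epsilon^{i_1\dots i_{a-1}j_1\dots j_b}_{K}P^{\nu i_1\dots i_{a-1}}\partial_\nu Q^{j_1\dots j_b}+\tfrac{(-1)^a}{a!\,(b-1)!}\epsilon^{i_1\dots i_aj_1\dots j_{b-1}}_{K}Q^{\nu j_1\dots j_{b-1}}\partial_\nu P^{i_1\dots i_a}$$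 for an $a$-vector field $P$ and a $b$-vector field $Q$. Let $A=x_i\partial^i$. A *linear generalized Poisson structure* is a $2p$-vector field $\Omega=\frac1{(2p)!}\omega^k_{i_1\dots i_{2p}}x_k\,\partial^{i_1}\wedge\dots\wedge\partial^{i_{2p}}$ with $[\Omega,\Omega]=0$; put $\partial_\Omega P=[\Omega,P]$. 1. Let $\Omega$ be a linear generalized Poisson structure. For every smooth $(2p-1)$-vector field $E$, the conditions $[E,\Omega+E\wedge A]=0$ and $[E,\Omega]=-E\wedge[E,A]$ are equivalent, and if they hold then $(\Omega+E\wedge A,\,E)$ is a generalized Jacobi structure. If $E=\frac1{(2p-1)!}\xi_{i_1\dots i_{2p-1}}\partial^{i_1}\wedge\dots\wedge\partial^{i_{2p-1}}$ is constant, the condition is equivalent to $$\epsilon^{i_1\dots i_{2p-2}j_1\dots j_{2p}}_{k_1\dots k_{4p-2}}\,\xi_{\nu i_1\dots i_{2p-2}}\,\omega^{\nu}_{j_1\dots j_{2p}}=0,$$ and also to $\partial_\Omega E=0$. 2. Let $\mathcal G$ be a finite-dimensional real simple Lie algebra with a basis and structure constants $C_{ij}^k$. Every invariant skew-symmetric form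 on $\mathcal G$ is a cocycle of the Lie algebra cohomology with trivial coefficients, and every invariant symmetric polynomial $k$ of order $m\ge1$ defines an invariant cocycle $\epsilon^{j_1\dots j_{2m-1}}_{i_1\dots i_{2m-1}}C^{\mu_1}_{j_1j_2}\cdots C^{\mu_{m-1}}_{j_{2m-3}j_{2m-2}}k_{\mu_1\dots\mu_{m-1}j_{2m-1}}$ of order $2m-1$. If $\alpha$ is an invariant cocycle of order $2p+1$ and $\omega^\sigma_{i_1\dots i_{2p}}$ is obtained from $\alpha_{i_1\dots i_{2p}\sigma}$ by raising the last index with the Killing form, then $\Omega=\frac1{(2p)!}\omega^\sigma_{i_1\dots i_{2p}}x_\sigma\partial^{i_1}\wedge\dots\wedge\partial^{i_{2p}}$ is a linear generalized Poisson structure, and every invariant cocycle $\beta$ of any positive order, regarded as a constant multivector field, satisfies $\partial_\Omega\beta=0$. In particular, for every invariant cocycle $\beta$ of order $2p-1$, with $E$ the constant multivector field of components $\beta_{i_1\dots i_{2p-1}}$, the pair $(\Omega+E\wedge A,E)$ is a generalized Jacobi structure. In contrast, for $p=1$ and $\Omega=\frac12x_kC_{ij}^k\partial^i\wedge\partial^j$,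 if $E$ is a constant vector such that $(\Omega+E\wedge A,E)$ is a generalized Jacobi structure, then $E=0$. 3. Let $\mathcal G=su(l+1)$ with $l\ge2$. For $m=2,\dots,l+1$ the symmetrized trace polynomial of order $m$, $(X_1,\dots,X_m)\mapsto\frac1{m!}\sum_{\sigma\in S_m}\operatorname{tr}(H_{\sigma(1)}\cdots H_{\sigma(m)})$ with $X_j=iH_j$, is symmetric and invariant, and its cocycle (as in 2) is invariant and is not a coboundary; this gives $l$ nontrivial cocycles of orders $3,5,\dots,2l+1$. For every $p$ with $2\le p\le l$, let $\Omega$ (as in 2) come from the one of order $2p+1$ and $E$ from the one of order $2p-1$. Then $\Omega\ne0$ is a linear generalized Poisson structure, $E\neq0$, $\partial_\Omega E=0$, and $(\Omega+E\wedge A,E)$ is a generalized Jacobi structure. 4. Let $\lambda_1,\dots,\lambda_8$ be the Gell-Mann matrices, $C_{ijk}=\frac1{4i}\operatorname{tr}([\lambda_i,\lambda_j]\lambda_k)$ and $d_{ijk}=\frac14\operatorname{tr}(\{\lambda_i,\lambda_j\}\lambda_k)$. Then the $C_{ijk}$ are the structure constants of $su(3)$ in the basis $-\frac i2\lambda_k$,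 $\{\lambda_i,\lambda_j\}=\frac43\delta_{ij}1_3+2\sum_kd_{ijk}\lambda_k$, and on $\mathbb R^8$ (indices raised and lowered with $\delta_{ij}$) $$\Omega=\tfrac1{4!}\,\epsilon^{j_2j_3j_4}_{i_2i_3i_4}\,d^\sigma_{k_1k_2}C^{k_1}_{i_1j_2}C^{k_2}_{j_3j_4}\,x_\sigma\,\partial^{i_1}\wedge\partial^{i_2}\wedge\partial^{i_3}\wedge\partial^{i_4}\neq0,\qquad E=\tfrac1{3!}C_{i_1i_2i_3}\,\partial^{i_1}\wedge\partial^{i_2}\wedge\partial^{i_3}\neq0$$ satisfy $[\Omega,\Omega]=0$ and $\partial_\Omega E=0$; $E$ has the components $C_{i_1i_2i_3}$; and $(\Omega+E\wedge A,E)$ is a generalized Jacobi structure. -/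

import Mathlib

open scoped Matrix

attribute [local instance] LieRing.ofAssociativeRing

noncomputable section

namespace GenJacobi

/-! ### Tensors and multivector fields on `ℝⁿ` in the global coordinates `x₁, …, xₙ` -/

/-- Components `T^{i₁ … i_k}` of a tensor of order `k`, with indices in `Fin n`. -/
abbrev Tensor (n k : ℕ) := (Fin k → Fin n) → ℝ

/-- Components `P^{i₁ … i_k}(x)` of a tensor field of order `k` on `ℝⁿ`. -/
abbrev TensorField (n k : ℕ) := (Fin n → ℝ) → Tensor n k

/-- Contraction with the generalized Kronecker symbol:
`K ↦ ε^{l₁ … l_k}_{K₁ … K_k} T_{l₁ … l_k}` (sum over all `l`). -/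
def antisym {n k : ℕ} (T : Tensor n k) : Tensor n k := fun K =>
  ∑ σ : Equiv.Perm (Fin k), ((Equiv.Perm.sign σ : ℤ) : ℝ) * T (K ∘ σ)

/-- `T` is totally skew-symmetric. -/
def IsSkew {n k : ℕ} (T : Tensor n k) : Prop :=
  ∀ (σ : Equiv.Perm (Fin k)) (K : Fin k → Fin n),
    T (K ∘ σ) = ((Equiv.Perm.sign σ : ℤ) : ℝ) * T K

/-- `T` is totally symmetric. -/
def IsSymm {n k : ℕ} (T : Tensor n k) : Prop :=
  ∀ (σ : Equiv.Perm (Fin k)) (K : Fin k → Fin n), T (K ∘ σ) = T K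

/-- `P` is the family of components of a smooth `k`-vector field
`(1 / k!) P^{i₁ … i_k}(x) ∂_{i₁} ∧ … ∧ ∂_{i_k}` on `ℝⁿ`. -/
structure IsMultivectorField {n k : ℕ} (P : TensorField n k) : Prop where
  skew : ∀ x, IsSkew (P x)
  smooth : ∀ K, ContDiff ℝ ((⊤ : ℕ∞) : WithTop ℕ∞) (fun x => P x K)

/-- The partial derivative `∂ f / ∂ x_ν`. -/
def pderiv {n : ℕ} (ν : Fin n) (f : (Fin n → ℝ) → ℝ) (x : Fin n → ℝ) : ℝ :=
  fderiv ℝ f x (Pi.single ν 1)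

/-- Components of the exterior product `P ∧ Q` of an `a`-vector and a `b`-vector field:
`(1 / (a! b!)) ε^{i₁ … i_a j₁ … j_b}_{K} P^{i₁ … i_a} Q^{j₁ … j_b}`. -/
def wedge {n a b : ℕ} (P : TensorField n a) (Q : TensorField n b) : TensorField n (a + b) :=
  fun x => (1 / ((a.factorial : ℝ) * b.factorial)) •
    antisym (fun K => P x (fun i => K (Fin.castAdd b i)) * Q x (fun j => K (Fin.natAdd a j)))

/-- Components of the Schouten-Nijenhuis bracket `[P, Q]` of a `p`-vector field and a `q`-vector
field (here `p = a + 1`, `q = b + 1`), which is a `(p + q - 1)`-vector field: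
`[P, Q]^K = (1 / ((p-1)! q!)) ε^{i₁ … i_{p-1} j₁ … j_q}_K P^{ν i₁ … i_{p-1}} ∂_ν Q^{j₁ … j_q}
  + ((-1)^p / (p! (q-1)!)) ε^{i₁ … i_p j₁ … j_{q-1}}_K Q^{ν j₁ … j_{q-1}} ∂_ν P^{i₁ … i_p}`. -/
def schouten {n a b : ℕ} (P : TensorField n (a + 1)) (Q : TensorField n (b + 1)) :
    TensorField n (a + b + 1) := fun x =>
  (1 / ((a.factorial : ℝ) * (b + 1).factorial)) •
      antisym (fun K => ∑ ν : Fin n,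
        P x (Fin.cons ν (fun i : Fin a => K ⟨i, by omega⟩)) *
          pderiv ν (fun y => Q y (fun j : Fin (b + 1) => K ⟨a + j, by omega⟩)) x) +
    ((-1) ^ (a + 1) / (((a + 1).factorial : ℝ) * b.factorial)) •
      antisym (fun K => ∑ ν : Fin n,
        Q x (Fin.cons ν (fun j : Fin b => K ⟨a + 1 + j, by omega⟩)) *
          pderiv ν (fun y => P y (fun i : Fin (a + 1) => K ⟨i, by omega⟩)) x)

/-- The dilatation vector field `A = x_i ∂^i`. -/
def dilatation (n : ℕ) : TensorField n 1 := fun x K => x (K 0)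

/-- The constant tensor field with components `T`. -/
def constField {n k : ℕ} (T : Tensor n k) : TensorField n k := fun _ => T

/-- The tensor field with components `ω_I^k x_k`, linear in the coordinates. -/
def linearField {n m : ℕ} (ω : (Fin m → Fin n) → Fin n → ℝ) : TensorField n m :=
  fun x I => ∑ k : Fin n, ω I k * x k

/-! ### Generalized Poisson and generalized Jacobi structures; throughout `p = r + 1` -/

/-- A generalized Poisson structure: a `2p`-vector field `Ω` with `[Ω, Ω] = 0`. -/
def IsGenPoisson {n r : ℕ} (Ω : TensorField n (2 * r + 2)) : Prop :=
  IsMultivectorField Ω ∧ schouten Ω Ω = 0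

/-- The operator `∂_Ω : P ↦ [Ω, P]` of generalized Poisson cohomology. -/
def poissonCoboundary {n r b : ℕ} (Ω : TensorField n (2 * r + 2)) (P : TensorField n (b + 1)) :
    TensorField n (2 * r + 1 + b + 1) := schouten Ω P

/-- The value `P(df₁, …, df_k)` of a `k`-vector field on differentials of functions. -/
def evalD {n k : ℕ} (P : TensorField n k) (f : Fin k → (Fin n → ℝ) → ℝ) (x : Fin n → ℝ) : ℝ :=
  ∑ I : Fin k → Fin n, P x I * ∏ j, pderiv (I j) (f j) x

/-- The bracket `{f₁, …, f_{2p}} = Λ(df₁, …, df_{2p})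
- ∑_{j=1}^{2p} (-1)^j f_j E(df₁, …, omit df_j, …, df_{2p})` (the index `j` below starts at `0`). -/
def jacobiBracket {n r : ℕ} (Λ : TensorField n (2 * r + 2)) (E : TensorField n (2 * r + 1))
    (f : Fin (2 * r + 2) → (Fin n → ℝ) → ℝ) (x : Fin n → ℝ) : ℝ :=
  evalD Λ f x + ∑ j : Fin (2 * r + 2), (-1) ^ (j : ℕ) * f j x *
    evalD E (fun i : Fin (2 * r + 1) => f (j.succAbove i)) x

/-- `(Λ, E)` is a generalized Jacobi structure: a `2p`-vector field and a `(2p-1)`-vector field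
whose bracket satisfies the generalized Jacobi identity
`ε^{j₁ … j_{4p-1}}_{1 … 4p-1} {f_{j₁}, …, f_{j_{2p-1}}, {f_{j_{2p}}, …, f_{j_{4p-1}}}} = 0`. -/
structure IsGenJacobi {n r : ℕ} (Λ : TensorField n (2 * r + 2)) (E : TensorField n (2 * r + 1)) :
    Prop where
  multivector_left : IsMultivectorField Λ
  multivector_right : IsMultivectorField E
  jacobi : ∀ f : Fin ((2 * r + 1) + (2 * r + 2)) → (Fin n → ℝ) → ℝ,
    (∀ i, ContDiff ℝ ((⊤ : ℕ∞) : WithTop ℕ∞) (f i)) → ∀ x : Fin n → ℝ,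
      ∑ σ : Equiv.Perm (Fin ((2 * r + 1) + (2 * r + 2))), ((Equiv.Perm.sign σ : ℤ) : ℝ) *
        jacobiBracket Λ E
          (Fin.snoc (fun i : Fin (2 * r + 1) => f (σ (Fin.castAdd (2 * r + 2) i)))
            (jacobiBracket Λ E
              (fun j : Fin (2 * r + 2) => f (σ (Fin.natAdd (2 * r + 1) j))))) x = 0

/-! ### Lie algebras: invariant tensors, cocycles, invariant polynomials -/

/-- The structure constants `C_{ij}^k` of a Lie algebra in a basis `b`. -/
def structConst {𝒢 : Type*} [LieRing 𝒢] [LieAlgebra ℝ 𝒢] {n : ℕ}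
    (b : Module.Basis (Fin n) ℝ 𝒢) (i j k : Fin n) : ℝ := b.repr ⁅b i, b j⁆ k

/-- The matrix `κ(b_i, b_j)` of the Killing form. -/
def killingMatrix {𝒢 : Type*} [LieRing 𝒢] [LieAlgebra ℝ 𝒢] {n : ℕ}
    (b : Module.Basis (Fin n) ℝ 𝒢) : Matrix (Fin n) (Fin n) ℝ :=
  Matrix.of fun i j => killingForm ℝ 𝒢 (b i) (b j)

/-- `T`, the components of a multilinear form on the Lie algebra with structure constants `C`, is
invariant: `∑_s C_{a i_s}^ν T_{i₁ … ν … i_k} = 0` (`ν` in position `s`). -/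
def IsInvariant {n k : ℕ} (C : Fin n → Fin n → Fin n → ℝ) (T : Tensor n k) : Prop :=
  ∀ (a : Fin n) (I : Fin k → Fin n),
    ∑ s : Fin k, ∑ ν : Fin n, C a (I s) ν * T (Function.update I s ν) = 0

/-- The Chevalley-Eilenberg differential with trivial coefficients,
`(dη)(x₀, …, x_q) = ∑_{i<j} (-1)^{i+j} η([x_i, x_j], x₀, …, omit x_i, …, omit x_j, …, x_q)`.
The bracket stands in the place of the second of the two arguments, and every pair is counted
twice, whence the factor `-1/2`. -/
def ceDiff {n q : ℕ} (C : Fin n → Fin n → Fin n → ℝ) (η : Tensor n q) : Tensor n (q + 1) :=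
  fun K => -(1 / 2) * ∑ i : Fin (q + 1), (-1) ^ (i : ℕ) * ∑ j : Fin q, ∑ ν : Fin n,
    C (K i) (K (i.succAbove j)) ν *
      η (Function.update (fun l : Fin q => K (i.succAbove l)) j ν)

/-- `α` is a cocycle of the Lie algebra cohomology with trivial coefficients. -/
def IsCocycle {n q : ℕ} (C : Fin n → Fin n → Fin n → ℝ) (α : Tensor n q) : Prop :=
  IsSkew α ∧ ceDiff C α = 0

/-- `α` is a coboundary of the Lie algebra cohomology with trivial coefficients. -/
def IsCoboundary {n q : ℕ} (C : Fin n → Fin n → Fin n → ℝ) (α : Tensor n (q + 1)) : Prop :=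
  ∃ η : Tensor n q, IsSkew η ∧ ceDiff C η = α

/-- The `(2s+1)`-cochain defined by a polynomial `k` of order `s + 1`:
`ε^{j₁ … j_{2s+1}}_K C_{j₁ j₂}^{μ₁} ⋯ C_{j_{2s-1} j_{2s}}^{μ_s} k_{μ₁ … μ_s j_{2s+1}}`. -/
def polyCochain {n s : ℕ} (C : Fin n → Fin n → Fin n → ℝ) (k : Tensor n (s + 1)) :
    Tensor n (2 * s + 1) :=
  antisym fun J => ∑ μ : Fin s → Fin n,
    (∏ a : Fin s, C (J ⟨2 * a, by omega⟩) (J ⟨2 * a + 1, by omega⟩) (μ a)) *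
      k (Fin.snoc μ (J (Fin.last (2 * s))))

/-- The coefficients `ω_{i₁ … i_m}^σ` obtained from `α_{i₁ … i_m σ}` by raising the last index with
the Killing form. -/
def raiseLast {𝒢 : Type*} [LieRing 𝒢] [LieAlgebra ℝ 𝒢] {n m : ℕ}
    (b : Module.Basis (Fin n) ℝ 𝒢) (α : Tensor n (m + 1)) : (Fin m → Fin n) → Fin n → ℝ :=
  fun I σ => ∑ τ : Fin n, α (Fin.snoc I τ) * (killingMatrix b)⁻¹ τ σ

/-! ### The algebras `su(N)` and the Gell-Mann matrices -/

/-- The real Lie algebra `su(N)` of traceless anti-Hermitian complex matrices. -/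
def su (N : ℕ) : LieSubalgebra ℝ (Matrix (Fin N) (Fin N) ℂ) where
  carrier := {X | Xᴴ = -X ∧ X.trace = 0}
  add_mem' := by
    rintro X Y ⟨hX, hX'⟩ ⟨hY, hY'⟩
    refine ⟨?_, ?_⟩
    · rw [Matrix.conjTranspose_add, hX, hY, neg_add]
    · rw [Matrix.trace_add, hX', hY', add_zero]
  zero_mem' := by simp
  smul_mem' := by
    rintro c X ⟨hX, hX'⟩
    refine ⟨?_, ?_⟩
    · rw [Matrix.conjTranspose_smul, hX, star_trivial, smul_neg]
    · rw [Matrix.trace_smul, hX', smul_zero]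
  lie_mem' := by
    rintro X Y ⟨hX, -⟩ ⟨hY, -⟩
    refine ⟨?_, ?_⟩
    · rw [Ring.lie_def, Matrix.conjTranspose_sub, Matrix.conjTranspose_mul,
        Matrix.conjTranspose_mul, hX, hY]
      noncomm_ring
    · rw [Ring.lie_def, Matrix.trace_sub, Matrix.trace_mul_comm, sub_self]

/-- The symmetrized trace polynomial of order `m` on `su(N)`,
`X₁, …, X_m ↦ (1 / m!) ∑_σ tr (H_{σ 1} ⋯ H_{σ m})` where `X_j = i H_j` with `H_j` Hermitian (the sum
is a real number). -/
def tracePoly {N n : ℕ} (b : Module.Basis (Fin n) ℝ (su N)) (m : ℕ) : Tensor n m := fun K =>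
  ((1 / (m.factorial : ℂ)) * ∑ σ : Equiv.Perm (Fin m),
    ((List.ofFn fun j : Fin m =>
      (-Complex.I) • (b (K (σ j)) : Matrix (Fin N) (Fin N) ℂ)).prod).trace).re

/-- The Gell-Mann matrices `λ₁, …, λ₈`. -/
def gellMann : Fin 8 → Matrix (Fin 3) (Fin 3) ℂ :=
  ![!![0, 1, 0; 1, 0, 0; 0, 0, 0],
    !![0, -Complex.I, 0; Complex.I, 0, 0; 0, 0, 0],
    !![1, 0, 0; 0, -1, 0; 0, 0, 0],
    !![0, 0, 1; 0, 0, 0; 1, 0, 0],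
    !![0, 0, -Complex.I; 0, 0, 0; Complex.I, 0, 0],
    !![0, 0, 0; 0, 0, 1; 0, 1, 0],
    !![0, 0, 0; 0, 0, -Complex.I; 0, Complex.I, 0],
    ((1 / Real.sqrt 3 : ℝ) : ℂ) • !![1, 0, 0; 0, 1, 0; 0, 0, -2]]

/-- The structure constants `C_{ijk} = tr ([λ_i, λ_j] λ_k) / (4 i)` of `su(3)`. -/
def su3C (i j k : Fin 8) : ℝ :=
  (((gellMann i * gellMann j - gellMann j * gellMann i) * gellMann k).trace /
    (4 * Complex.I)).re

/-- The constants `d_{ijk} = tr ({λ_i, λ_j} λ_k) / 4`. -/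
def su3d (i j k : Fin 8) : ℝ :=
  (((gellMann i * gellMann j + gellMann j * gellMann i) * gellMann k).trace / 4).re

/-- The coefficients
`W_{i₁ i₂ i₃ i₄}^σ = ε^{j₂ j₃ j₄}_{i₂ i₃ i₄} d^σ_{k₁ k₂} C^{k₁}_{i₁ j₂} C^{k₂}_{j₃ j₄}`. -/
def su3Coeff (I : Fin 4 → Fin 8) (σ : Fin 8) : ℝ :=
  antisym (fun J : Fin 3 → Fin 8 => ∑ k₁ : Fin 8, ∑ k₂ : Fin 8,
    su3d σ k₁ k₂ * su3C (I 0) (J 0) k₁ * su3C (J 1) (J 2) k₂) ![I 1, I 2, I 3]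

/-- The `4`-vector field `Ω = (1 / 4!) W_{i₁ i₂ i₃ i₄}^σ x_σ ∂^{i₁} ∧ ∂^{i₂} ∧ ∂^{i₃} ∧ ∂^{i₄}`. -/
def su3Omega : TensorField 8 4 :=
  linearField fun I σ => (1 / (Nat.factorial 4 : ℝ)) * antisym (fun J => su3Coeff J σ) I

/-- The `3`-vector `E = (1 / 3!) C_{i₁ i₂ i₃} ∂^{i₁} ∧ ∂^{i₂} ∧ ∂^{i₃}`. -/
def su3E : TensorField 8 3 :=
  constField ((1 / (Nat.factorial 3 : ℝ)) • antisym (fun J => su3C (J 0) (J 1) (J 2)))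

end GenJacobi

end

/-! All computations take place in the exterior algebra. A skew tensor `T` of order `k` becomes `nel
T`, the sum of `T_I e_I` divided by `k!`. This is injective on skew tensors (`Skew.eq_of_nel`),
turns the wedge into the product, and turns fixing the first index into the contraction `con`. The
Schouten bracket becomes `∑ (i_ν P) ∂_ν Q ± ∑ ∂_ν P (i_ν Q)` (`nel_schouten`), so each bracket
condition is an identity between even (central) and odd (anticommuting) elements.

Jacobi identity: the bracket sees `f` only through its jet `(f, df)`, which is the differential at
`t = 1` of `t f` on a space with one more coordinate. There it is the bracket of the homogeneous
multivector `t^(1-2p) Λ + t^(2-2p) ∂_t ∧ E`. Second derivatives cancel, since exchanging two blocks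
of `2p - 1` functions is an odd permutation while Hessians are symmetric
(`sum_second_derivatives_eq_zero`). The rest is the vanishing self-bracket of that multivector,
which splits into `[Λ, Λ] = 2 (2p-1) E ∧ Λ` and `[E, Λ] = 0` (`isGenJacobi_of_conditions`). For `Λ =
Ω + E ∧ A` with `Ω` linear, the first condition follows from the second and `[Ω, Ω] = 0` by Euler's
formula (`sum_con_mul_dilatation`). For constant `E` the second one reads `∑ (i_ν E) ω^ν = 0`, which
is also `∂_Ω E = 0`.

Invariant forms: all the brackets needed vanish because `∑ G^{kν} i_k x · i_ν y = 0` for invariant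
`x`, `y` (`CasimirData.sum_con_mul_con`). Up to a nonzero Casimir eigenvalue this sum is the image
under the Chevalley-Eilenberg operator `ceD` of an invariant element, and `ceD` kills invariant
elements. The eigenvalue is `1` for the inverse Killing form and `-3` for the Gell-Mann
normalization of `su(3)`. For `p = 1`, testing the identity on `1, x_i, x_j` shows that `E`
annihilates all brackets, hence the whole simple algebra.

Nontriviality for `su(l + 1)`: contracting the cocycle of a polynomial gives `2s + 1` times the
polynomial with its other arguments replaced by curvature 2-forms (`con_polyForm`). For trace
polynomials this is a multiple of `tr (b_σ X^{2s})` with `X` a generic odd matrix, and a staircase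
choice of `X` exhibits a nonzero monomial (`exists_polyRest_ne_zero`). The definite form `-Re tr (X
Y)` makes invariant forms orthogonal to coboundaries (`not_isCoboundary`) and forces the Killing
form to be nondegenerate (`killing_det_ne_zero`). The explicit `su(3)` fields are the case `p = 2`
up to normalization. -/

noncomputable section

namespace GenJacobi

/-! ### The exterior algebra on the coordinate directions -/

section Exterior

variable {𝕜 : Type*} [Field 𝕜] {n : ℕ}

/-- The exterior algebra of `𝕜ⁿ`. -/
abbrev Ext (𝕜 : Type*) [Field 𝕜] (n : ℕ) := ExteriorAlgebra 𝕜 (Fin n → 𝕜)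

/-- The `i`-th generator. -/
def th (i : Fin n) : Ext 𝕜 n := ExteriorAlgebra.ι 𝕜 (Pi.single i 1)

/-- Contraction with the `i`-th coordinate form. -/
def con (i : Fin n) : Ext 𝕜 n →ₗ[𝕜] Ext 𝕜 n :=
  CliffordAlgebra.contractLeft (Q := (0 : QuadraticForm 𝕜 (Fin n → 𝕜)))
    (LinearMap.proj i : (Fin n → 𝕜) →ₗ[𝕜] 𝕜)

/-- The grade involution. -/
def inv : Ext 𝕜 n →ₐ[𝕜] Ext 𝕜 n :=
  CliffordAlgebra.involute (Q := (0 : QuadraticForm 𝕜 (Fin n → 𝕜)))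

lemma ι_eq_sum (v : Fin n → 𝕜) : (ExteriorAlgebra.ι 𝕜 v : Ext 𝕜 n) = ∑ i, v i • th i := by
  conv_lhs => rw [pi_eq_sum_univ' v]
  simp [th, map_sum]

/-- Generators multiplied from the left span the algebra; all sign rules for `con` and `inv` are
checked along this induction. -/
lemma ext_induction {p : Ext 𝕜 n → Prop} (h1 : ∀ r, p (algebraMap 𝕜 _ r))
    (hmul : ∀ i x, p x → p (th i * x)) (hadd : ∀ x y, p x → p y → p (x + y))
    (hsmul : ∀ (c : 𝕜) x, p x → p (c • x)) (x : Ext 𝕜 n) : p x := by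
  induction x using CliffordAlgebra.left_induction with
  | algebraMap r => exact h1 r
  | add x y hx hy => exact hadd x y hx hy
  | ι_mul x m hx =>
    have : CliffordAlgebra.ι (0 : QuadraticForm 𝕜 (Fin n → 𝕜)) m * x = ∑ i, m i • (th i * x) := by
      change ExteriorAlgebra.ι 𝕜 m * x = _
      rw [ι_eq_sum, Finset.sum_mul]
      simp
    rw [this]
    refine Finset.sum_induction _ p hadd ?_ fun i _ => hsmul _ _ (hmul i x hx)
    simpa using h1 0

@[simp] lemma con_algebraMap (i : Fin n) (r : 𝕜) : con i (algebraMap 𝕜 (Ext 𝕜 n) r) = 0 :=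
  CliffordAlgebra.contractLeft_algebraMap _ _ _

@[simp] lemma con_one (i : Fin n) : con i (1 : Ext 𝕜 n) = 0 :=
  CliffordAlgebra.contractLeft_one _ _

lemma con_th_mul (i j : Fin n) (x : Ext 𝕜 n) :
    con i (th j * x) = (if i = j then x else 0) - th j * con i x := by
  have := CliffordAlgebra.contractLeft_ι_mul (Q := (0 : QuadraticForm 𝕜 (Fin n → 𝕜)))
    (LinearMap.proj i : (Fin n → 𝕜) →ₗ[𝕜] 𝕜) (Pi.single j 1) x
  refine this.trans ?_
  congr 1
  simp [Pi.single_apply]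

@[simp] lemma con_th (i j : Fin n) : con i (th j : Ext 𝕜 n) = if i = j then 1 else 0 := by
  have := con_th_mul (𝕜 := 𝕜) i j 1
  simpa using this

lemma con_con (i j : Fin n) (x : Ext 𝕜 n) : con i (con j x) = -con j (con i x) :=
  CliffordAlgebra.contractLeft_comm _ _ _

@[simp] lemma inv_th (i : Fin n) : inv (th i : Ext 𝕜 n) = -th i :=
  CliffordAlgebra.involute_ι _

lemma inv_inv (x : Ext 𝕜 n) : inv (inv x) = x := CliffordAlgebra.involute_involute x

lemma th_mul_th (i j : Fin n) : (th i * th j : Ext 𝕜 n) = -(th j * th i) :=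
  eq_neg_of_add_eq_zero_left (ExteriorAlgebra.ι_add_mul_swap _ _)

@[simp] lemma th_mul_self (i : Fin n) : (th i * th i : Ext 𝕜 n) = 0 :=
  ExteriorAlgebra.ι_sq_zero _

/-- Graded Leibniz rule: the contraction is an odd derivation. -/
lemma con_mul (i : Fin n) (x y : Ext 𝕜 n) : con i (x * y) = con i x * y + inv x * con i y := by
  induction x using ext_induction with
  | h1 r => simp [← Algebra.smul_def]
  | hmul j x hx => 
    rw [mul_assoc, con_th_mul, hx, con_th_mul, map_mul, inv_th]
    split_ifs <;> noncomm_ring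
  | hadd x z hx hz => simp only [add_mul, map_add, hx, hz]; abel
  | hsmul c x hx => simp [hx]

lemma inv_con (i : Fin n) (x : Ext 𝕜 n) : inv (con i x) = -con i (inv x) := by
  induction x using ext_induction with
  | h1 r => simp
  | hmul j x hx => 
    rw [con_th_mul, map_mul, inv_th, neg_mul, map_neg, con_th_mul, map_sub, map_mul, hx, inv_th]
    split_ifs <;> simp
  | hadd x z hx hz => simp only [map_add, hx, hz]; abel
  | hsmul c x hx => simp [hx]

lemma th_mul (i : Fin n) (x : Ext 𝕜 n) : th i * x = inv x * th i := by
  induction x using ext_induction with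
  | h1 r => simp [Algebra.commutes]
  | hmul j x hx => rw [← mul_assoc, th_mul_th, neg_mul, mul_assoc, hx, map_mul, inv_th]; noncomm_ring
  | hadd x z hx hz => simp only [mul_add, map_add, add_mul, hx, hz]
  | hsmul c x hx => simp [hx]

/-- Elements of even degree. -/
def Ev (x : Ext 𝕜 n) : Prop := inv x = x

/-- Elements of odd degree. -/
def Od (x : Ext 𝕜 n) : Prop := inv x = -x

lemma Ev.comm {x : Ext 𝕜 n} (hx : Ev x) (y : Ext 𝕜 n) : x * y = y * x := by
  induction y using ext_induction with
  | h1 r => simp [Algebra.commutes]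
  | hmul j y hy => rw [mul_assoc, ← hy, ← mul_assoc, ← mul_assoc, th_mul, hx]
  | hadd y z hy hz => simp only [mul_add, add_mul, hy, hz]
  | hsmul c y hy => simp [hy]

lemma Od.mul_left {y : Ext 𝕜 n} (hy : Od y) (x : Ext 𝕜 n) : x * y = y * inv x := by
  induction x using ext_induction with
  | h1 r => simp [Algebra.commutes]
  | hmul j x hx =>
    rw [mul_assoc, hx, ← mul_assoc, th_mul, hy, map_mul, inv_th]; noncomm_ring
  | hadd x z hx hz => simp only [mul_add, add_mul, hx, hz, map_add]
  | hsmul c x hx => simp [hx]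

lemma Od.anticomm {x y : Ext 𝕜 n} (hx : Od x) (hy : Od y) : x * y = -(y * x) := by
  rw [hy.mul_left, hx, mul_neg]

lemma Od.mul_self [CharZero 𝕜] {x : Ext 𝕜 n} (hx : Od x) : x * x = 0 := by
  have h := hx.anticomm hx
  have h2 : (2 : 𝕜) • (x * x) = 0 := by rw [two_smul]; nth_rw 1 [h]; simp
  simpa using h2

lemma od_th (i : Fin n) : Od (th i : Ext 𝕜 n) := inv_th i
lemma Ev.smul {x : Ext 𝕜 n} (c : 𝕜) (hx : Ev x) : Ev (c • x) := by
  simp only [Ev, map_smul] at *; rw [hx]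
lemma Od.smul {x : Ext 𝕜 n} (c : 𝕜) (hx : Od x) : Od (c • x) := by
  simp only [Od, map_smul] at *; rw [hx, smul_neg]
lemma Ev.sum {ι : Type*} {s : Finset ι} {f : ι → Ext 𝕜 n} (h : ∀ i, Ev (f i)) :
    Ev (∑ i ∈ s, f i) := by
  simp only [Ev, map_sum] at *; simp [h]
lemma Od.sum {ι : Type*} {s : Finset ι} {f : ι → Ext 𝕜 n} (h : ∀ i, Od (f i)) :
    Od (∑ i ∈ s, f i) := by
  simp only [Od, map_sum] at *; simp [h]
lemma Od.mul {x y : Ext 𝕜 n} (hx : Od x) (hy : Od y) : Ev (x * y) := by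
  simp only [Od, Ev, map_mul] at *; rw [hx, hy, neg_mul_neg]
lemma Ev.con {x : Ext 𝕜 n} (hx : Ev x) (i : Fin n) : Od (con i x) := by
  simp only [Od, Ev] at *; rw [inv_con, hx]
lemma Od.con {x : Ext 𝕜 n} (hx : Od x) (i : Fin n) : Ev (GenJacobi.con i x) := by
  simp only [Od, Ev] at *; rw [inv_con, hx, map_neg, neg_neg]

/-- The element `∑ T_I e_{I₁} ⋯ e_{I_k}` of the exterior algebra. -/
def el {k : ℕ} (T : (Fin k → Fin n) → 𝕜) : Ext 𝕜 n :=
  ∑ I, T I • ExteriorAlgebra.ιMulti 𝕜 k (fun j => (Pi.single (I j) 1 : Fin n → 𝕜))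

/-- The total skew-symmetrization over a field. -/
def alt {k : ℕ} (T : (Fin k → Fin n) → 𝕜) (K : Fin k → Fin n) : 𝕜 :=
  ∑ σ : Equiv.Perm (Fin k), ((Equiv.Perm.sign σ : ℤ) : 𝕜) * T (K ∘ σ)

/-- Total skew-symmetry over a field. -/
def Skew {k : ℕ} (T : (Fin k → Fin n) → 𝕜) : Prop :=
  ∀ (σ : Equiv.Perm (Fin k)) (K : Fin k → Fin n),
    T (K ∘ σ) = ((Equiv.Perm.sign σ : ℤ) : 𝕜) * T K

lemma el_add {k : ℕ} (T S : (Fin k → Fin n) → 𝕜) : el (T + S) = el T + el S := by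
  simp [el, add_smul, Finset.sum_add_distrib]

lemma el_smul {k : ℕ} (c : 𝕜) (T : (Fin k → Fin n) → 𝕜) : el (c • T) = c • el T := by
  simp [el, mul_smul, Finset.smul_sum]

@[simp] lemma el_zero {k : ℕ} : el (0 : (Fin k → Fin n) → 𝕜) = 0 := by simp [el]

lemma el_sum {ι : Type*} {k : ℕ} (s : Finset ι) (T : ι → (Fin k → Fin n) → 𝕜) :
    el (∑ i ∈ s, T i) = ∑ i ∈ s, el (T i) := by
  classical
  induction s using Finset.induction_on with
  | empty => simp
  | insert i s hi h => rw [Finset.sum_insert hi, Finset.sum_insert hi, el_add, h]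

lemma el_succ {k : ℕ} (T : (Fin (k + 1) → Fin n) → 𝕜) :
    el T = ∑ i, th i * el (fun I => T (Fin.cons i I)) := by
  unfold el
  rw [← (Fin.consEquiv fun _ => Fin n).sum_comp, Fintype.sum_prod_type]
  refine Finset.sum_congr rfl fun i _ => ?_
  rw [Finset.mul_sum]
  refine Finset.sum_congr rfl fun I _ => ?_
  rw [ExteriorAlgebra.ιMulti_succ_apply, mul_smul_comm]
  rfl

lemma el_fin_zero (T : (Fin 0 → Fin n) → 𝕜) : el T = algebraMap 𝕜 _ (T Fin.elim0) := by
  have h : ∀ I : Fin 0 → Fin n, T I = T Fin.elim0 := fun I => congrArg T (Subsingleton.elim _ _)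
  rw [el, Fintype.sum_unique, h, ExteriorAlgebra.ιMulti_zero_apply, Algebra.algebraMap_eq_smul_one]

/-- The two blocks are prescribed only by the values of their embeddings, so that the lemma fits
both `Fin.castAdd`/`Fin.natAdd` and the explicit indices in `schouten` and `polyCochain`. -/
lemma el_mul {a b m : ℕ} (h : a + b = m) (T : (Fin a → Fin n) → 𝕜) (S : (Fin b → Fin n) → 𝕜)
    (e₁ : Fin a → Fin m) (e₂ : Fin b → Fin m) (h₁ : ∀ i, (e₁ i : ℕ) = i)
    (h₂ : ∀ i, (e₂ i : ℕ) = a + i) :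
    el (fun K : Fin m → Fin n => T (K ∘ e₁) * S (K ∘ e₂)) = el T * el S := by
  subst h
  obtain rfl : e₁ = Fin.castAdd b := funext fun i => Fin.ext (by simp [h₁])
  obtain rfl : e₂ = Fin.natAdd a := funext fun i => Fin.ext (by simp [h₂])
  unfold el
  rw [Finset.sum_mul_sum, ← Fintype.sum_prod_type', ← (Fin.appendEquiv a b).sum_comp]
  refine Finset.sum_congr rfl fun p _ => ?_
  rw [smul_mul_smul_comm, ExteriorAlgebra.ιMulti_mul_ιMulti]
  congr 2
  · have h3 : Fin.appendEquiv a b p ∘ Fin.castAdd b = p.1 := by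
      funext i; simp [Fin.appendEquiv]
    have h4 : Fin.appendEquiv a b p ∘ Fin.natAdd a = p.2 := by
      funext i; simp [Fin.appendEquiv]
    simp only [h3, h4]
  · funext j
    refine Fin.addCases (fun i => ?_) (fun i => ?_) j <;> simp [Fin.appendEquiv]

/-- Permuting the indices of `T` permutes the alternating product of generators, which costs the
sign. -/
lemma el_comp_perm {k : ℕ} (σ : Equiv.Perm (Fin k)) (T : (Fin k → Fin n) → 𝕜) :
    el (fun K => T (K ∘ σ)) = ((Equiv.Perm.sign σ : ℤ) : 𝕜) • el T := by
  unfold el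
  rw [Finset.smul_sum, ← (Equiv.arrowCongr σ (Equiv.refl (Fin n))).sum_comp]
  refine Finset.sum_congr rfl fun K _ => ?_
  have h1 : (Equiv.arrowCongr σ (Equiv.refl (Fin n)) K) ∘ σ = K := by ext; simp
  beta_reduce
  rw [h1]
  have h2 := (ExteriorAlgebra.ιMulti 𝕜 k).map_perm
    (fun j => (Pi.single (K j) 1 : Fin n → 𝕜)) σ.symm
  have h3 : (fun j => (Pi.single (Equiv.arrowCongr σ (Equiv.refl (Fin n)) K j) 1 : Fin n → 𝕜))
     = (fun j => (Pi.single (K j) 1 : Fin n → 𝕜)) ∘ σ.symm := rfl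
  rw [h3, h2, Equiv.Perm.sign_symm, smul_comm]
  congr 1

lemma sign_mul_self {k : ℕ} (σ : Equiv.Perm (Fin k)) :
    ((Equiv.Perm.sign σ : ℤ) : 𝕜) * ((Equiv.Perm.sign σ : ℤ) : 𝕜) = 1 := by
  rcases Int.units_eq_one_or (Equiv.Perm.sign σ) with h | h <;> simp [h]

lemma el_alt {k : ℕ} (T : (Fin k → Fin n) → 𝕜) : el (alt T) = (k.factorial : 𝕜) • el T := by
  have : alt T = ∑ σ : Equiv.Perm (Fin k),
      ((Equiv.Perm.sign σ : ℤ) : 𝕜) • fun K => T (K ∘ σ) := by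
    ext K; simp [alt, Finset.sum_apply]
  rw [this, el_sum]
  simp only [el_smul, el_comp_perm, smul_smul, sign_mul_self, one_smul]
  rw [Finset.sum_const, Finset.card_univ, Fintype.card_perm, Fintype.card_fin,
    Nat.cast_smul_eq_nsmul]

lemma skew_alt {k : ℕ} (T : (Fin k → Fin n) → 𝕜) : Skew (alt T) := by
  intro τ K
  unfold alt
  rw [Finset.mul_sum, ← Equiv.sum_comp (Equiv.mulLeft τ⁻¹)]
  refine Finset.sum_congr rfl fun σ _ => ?_
  have h : (K ∘ τ) ∘ (Equiv.mulLeft τ⁻¹ σ : Equiv.Perm _) = K ∘ σ := by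
    ext j; simp
  rw [h, ← mul_assoc]
  congr 1
  simp

lemma Skew.alt_eq {k : ℕ} {T : (Fin k → Fin n) → 𝕜} (h : Skew T) :
    alt T = (k.factorial : 𝕜) • T := by
  ext K
  simp only [alt, h _ K, ← mul_assoc, sign_mul_self]
  simp [Fintype.card_perm]

/-- For fixed `K`, the minor of the coordinates `K` is an alternating map, hence a functional on the
exterior algebra. Its value on `el T` is `alt T K`, because the determinant of Kronecker deltas
picks out the permutations `σ` with `I = K ∘ σ`. -/
lemma alt_eq_zero_of_el {k : ℕ} {T : (Fin k → Fin n) → 𝕜} (h : el T = 0) : alt T = 0 := by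
  ext K
  let φ : (Fin n → 𝕜) [⋀^Fin k]→ₗ[𝕜] 𝕜 :=
    Matrix.detRowAlternating.compLinearMap (LinearMap.funLeft 𝕜 𝕜 K)
  let Φ : ∀ i, (Fin n → 𝕜) [⋀^Fin i]→ₗ[𝕜] 𝕜 := Pi.single k φ
  have h1 : ExteriorAlgebra.liftAlternating Φ (el T) = 0 := by rw [h, map_zero]
  rw [el, map_sum] at h1
  simp only [map_smul, ExteriorAlgebra.liftAlternating_apply_ιMulti, Φ, Pi.single_eq_same] at h1
  rw [Pi.zero_apply, ← h1, alt]
  have h2 : ∀ I : Fin k → Fin n, φ (fun j => (Pi.single (I j) 1 : Fin n → 𝕜)) =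
      ∑ σ : Equiv.Perm (Fin k), ((Equiv.Perm.sign σ : ℤ) : 𝕜) * if I = K ∘ σ then 1 else 0 := by
    intro I
    change Matrix.det (Matrix.of fun j i => (Pi.single (I j) 1 : Fin n → 𝕜) (K i)) = _
    rw [← Matrix.det_transpose, Matrix.det_apply']
    refine Finset.sum_congr rfl fun σ _ => ?_
    congr 1
    simp only [Matrix.transpose_apply, Matrix.of_apply, Pi.single_apply, funext_iff, Function.comp]
    rw [Finset.prod_ite_zero]
    simp [eq_comm]
  simp only [h2, smul_eq_mul, Finset.mul_sum]
  rw [Finset.sum_comm]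
  refine Finset.sum_congr rfl fun σ _ => ?_
  simp [mul_comm]

lemma alt_eq_zero_iff [CharZero 𝕜] {k : ℕ} {T : (Fin k → Fin n) → 𝕜} : alt T = 0 ↔ el T = 0 := by
  refine ⟨fun h => ?_, alt_eq_zero_of_el⟩
  have := el_alt T
  rw [h, el_zero] at this
  exact (smul_eq_zero.1 this.symm).resolve_left (by exact_mod_cast k.factorial_ne_zero)

lemma Skew.eq_zero [CharZero 𝕜] {k : ℕ} {T : (Fin k → Fin n) → 𝕜} (h : Skew T) (h0 : el T = 0) :
    T = 0 := by
  have := alt_eq_zero_of_el h0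
  rw [h.alt_eq] at this
  exact (smul_eq_zero.1 this).resolve_left (by exact_mod_cast k.factorial_ne_zero)

/-- A permutation of the tail extends to a permutation fixing `0`, with the same sign. -/
lemma Skew.cons {k : ℕ} {T : (Fin (k + 1) → Fin n) → 𝕜} (h : Skew T) (a : Fin n) :
    Skew fun I => T (Fin.cons a I) := by
  intro σ K
  have := h (Equiv.Perm.decomposeFin.symm (0, σ)) (Fin.cons a K)
  rw [Equiv.Perm.decomposeFin.symm_sign, if_pos rfl, one_mul] at this
  refine Eq.trans (congrArg T ?_) this
  funext j
  refine Fin.cases ?_ (fun i => ?_) j <;> simp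

lemma Skew.cons_cons {k : ℕ} {T : (Fin (k + 2) → Fin n) → 𝕜} (h : Skew T) (a b : Fin n)
    (I : Fin k → Fin n) :
    T (Fin.cons a (Fin.cons b I : Fin (k + 1) → Fin n)) =
      -T (Fin.cons b (Fin.cons a I : Fin (k + 1) → Fin n)) := by
  have := h (Equiv.swap 0 1) (Fin.cons b (Fin.cons a I : Fin (k + 1) → Fin n))
  rw [Equiv.Perm.sign_swap (by simp)] at this
  simp only [Units.val_neg, Units.val_one, Int.cast_neg, Int.cast_one, neg_one_mul] at this
  rw [← this]
  congr 1
  funext j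
  refine Fin.cases ?_ (fun i => ?_) j
  · simp
  · refine Fin.cases ?_ (fun i => ?_) i
    · simp
    · rw [Function.comp_apply, Equiv.swap_apply_of_ne_of_ne (by simp) (by simp [Fin.ext_iff])]
      rfl

/-- The contraction meets each of the `k + 1` indices in turn; skew-symmetry makes all these terms
equal. -/
lemma con_el {k : ℕ} {T : (Fin (k + 1) → Fin n) → 𝕜} (h : Skew T) (a : Fin n) :
    con a (el T) = ((k : 𝕜) + 1) • el (fun I => T (Fin.cons a I)) := by
  induction k with
  | zero =>
    rw [el_succ]
    simp only [el_fin_zero, map_sum, con_th_mul, con_algebraMap]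
    simp
  | succ k ih =>
    rw [el_succ]
    simp only [map_sum, con_th_mul, ih (h.cons _)]
    have h1 : ∀ i, el (fun I : Fin k → Fin n =>
        T (Fin.cons i (Fin.cons a I : Fin (k + 1) → Fin n))) = 
        - el (fun I : Fin k → Fin n => T (Fin.cons a (Fin.cons i I : Fin (k + 1) → Fin n))) := by
      intro i
      rw [← neg_one_smul 𝕜, ← el_smul]
      congr 1
      ext I
      simp [h.cons_cons i a]
    simp only [h1, Finset.sum_sub_distrib, smul_neg, mul_neg, mul_smul_comm, ← Finset.smul_sum,
      Finset.sum_neg_distrib]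
    rw [← el_succ (fun I => T (Fin.cons a I))]
    simp
    module

lemma inv_el {k : ℕ} (T : (Fin k → Fin n) → 𝕜) : inv (el T) = (-1 : 𝕜) ^ k • el T := by
  induction k with
  | zero => simp [el_fin_zero]
  | succ k ih =>
    rw [el_succ]
    simp [ih, Finset.smul_sum, pow_succ]

lemma ev_el {k : ℕ} (hk : Even k) (T : (Fin k → Fin n) → 𝕜) : Ev (el T) := by
  simp [Ev, inv_el, hk.neg_one_pow]

lemma od_el {k : ℕ} (hk : Odd k) (T : (Fin k → Fin n) → 𝕜) : Od (el T) := by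
  simp [Od, inv_el, hk.neg_one_pow]

/-- The element of the exterior algebra with skew-symmetric components `T`. -/
def nel {k : ℕ} (T : (Fin k → Fin n) → 𝕜) : Ext 𝕜 n := (1 / (k.factorial : 𝕜)) • el T

lemma nel_alt [CharZero 𝕜] {k : ℕ} (T : (Fin k → Fin n) → 𝕜) : nel (alt T) = el T := by
  rw [nel, el_alt, smul_smul, one_div, inv_mul_cancel₀ (by exact_mod_cast k.factorial_ne_zero),
    one_smul]

/-- The factorial in `nel` absorbs the factor `k + 1` of `con_el`. -/
lemma con_nel [CharZero 𝕜] {k : ℕ} {T : (Fin (k + 1) → Fin n) → 𝕜} (h : Skew T) (a : Fin n) :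
    con a (nel T) = nel fun I => T (Fin.cons a I) := by
  have h1 : ((k.factorial : ℕ) : 𝕜) ≠ 0 := by exact_mod_cast k.factorial_ne_zero
  have h2 : ((k : 𝕜) + 1) ≠ 0 := by exact_mod_cast k.succ_ne_zero
  rw [nel, map_smul, con_el h, smul_smul, nel, Nat.factorial_succ]
  congr 1
  push_cast
  field_simp

lemma ev_nel {k : ℕ} (hk : Even k) (T : (Fin k → Fin n) → 𝕜) : Ev (nel T) := (ev_el hk T).smul _

lemma od_nel {k : ℕ} (hk : Odd k) (T : (Fin k → Fin n) → 𝕜) : Od (nel T) := (od_el hk T).smul _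

lemma euler_nel [CharZero 𝕜] {k : ℕ} {T : (Fin (k + 1) → Fin n) → 𝕜} (h : Skew T) :
    ∑ a, th a * con a (nel T) = ((k : 𝕜) + 1) • nel T := by
  simp only [nel, map_smul, con_el h, mul_smul_comm]
  rw [← Finset.smul_sum, ← Finset.smul_sum, ← el_succ, smul_comm]

lemma nel_add {k : ℕ} (T S : (Fin k → Fin n) → 𝕜) : nel (T + S) = nel T + nel S := by
  simp [nel, el_add]

lemma nel_smul {k : ℕ} (c : 𝕜) (T : (Fin k → Fin n) → 𝕜) : nel (c • T) = c • nel T := by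
  rw [nel, el_smul, smul_comm, nel]

lemma nel_sum {ι : Type*} {k : ℕ} (s : Finset ι) (T : ι → (Fin k → Fin n) → 𝕜) :
    nel (∑ i ∈ s, T i) = ∑ i ∈ s, nel (T i) := by
  simp [nel, el_sum, Finset.smul_sum]

lemma Skew.eq_zero_of_nel [CharZero 𝕜] {k : ℕ} {T : (Fin k → Fin n) → 𝕜} (h : Skew T)
    (h0 : nel T = 0) : T = 0 :=
  h.eq_zero ((smul_eq_zero.1 h0).resolve_left
    (one_div_ne_zero (by exact_mod_cast k.factorial_ne_zero)))

lemma Skew.add {k : ℕ} {T S : (Fin k → Fin n) → 𝕜} (hT : Skew T) (hS : Skew S) :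
    Skew (T + S) := by
  intro σ K
  simp [hT σ K, hS σ K, mul_add]

lemma Skew.smul {k : ℕ} {T : (Fin k → Fin n) → 𝕜} (hT : Skew T) (c : 𝕜) : Skew (c • T) := by
  intro σ K
  simp only [Pi.smul_apply, hT σ K, smul_eq_mul]
  ring

lemma Skew.eq_of_nel [CharZero 𝕜] {k : ℕ} {T S : (Fin k → Fin n) → 𝕜} (hT : Skew T)
    (hS : Skew S) (h0 : nel T = nel S) : T = S := by
  have := (hT.add (hS.smul (-1))).eq_zero_of_nel (by rw [nel_add, nel_smul, h0]; simp)
  rw [neg_one_smul, ← sub_eq_add_neg] at this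
  exact sub_eq_zero.1 this

lemma nel_cast {k m : ℕ} (h : k = m) (T : (Fin k → Fin n) → 𝕜) :
    nel (fun K : Fin m → Fin n => T (fun i => K (Fin.cast h i))) = nel T := by
  subst h
  rfl

lemma Skew.cast {k m : ℕ} (h : k = m) {T : (Fin k → Fin n) → 𝕜} (hT : Skew T) :
    Skew (fun K : Fin m → Fin n => T (fun i => K (Fin.cast h i))) := by
  subst h
  exact hT

end Exterior

/-! ### The Schouten-Nijenhuis bracket and the wedge product in the exterior algebra -/

section Fields

variable {n : ℕ}

/-- The partial derivative of the components of a tensor field. -/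
def dfield {k : ℕ} (ν : Fin n) (P : TensorField n k) : TensorField n k :=
  fun x K => pderiv ν (fun y => P y K) x

lemma pderiv_const_mul {ν : Fin n} {f : (Fin n → ℝ) → ℝ} {x : Fin n → ℝ} (c : ℝ)
    (hf : DifferentiableAt ℝ f x) : pderiv ν (fun y => c * f y) x = c * pderiv ν f x := by
  simp [pderiv, fderiv_const_mul hf]

lemma pderiv_add {ν : Fin n} {f g : (Fin n → ℝ) → ℝ} {x : Fin n → ℝ}
    (hf : DifferentiableAt ℝ f x) (hg : DifferentiableAt ℝ g x) :
    pderiv ν (fun y => f y + g y) x = pderiv ν f x + pderiv ν g x := by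
  simp [pderiv, fderiv_fun_add hf hg]

lemma pderiv_mul {ν : Fin n} {f g : (Fin n → ℝ) → ℝ} {x : Fin n → ℝ}
    (hf : DifferentiableAt ℝ f x) (hg : DifferentiableAt ℝ g x) :
    pderiv ν (fun y => f y * g y) x = pderiv ν f x * g x + f x * pderiv ν g x := by
  simp [pderiv, fderiv_fun_mul hf hg]
  ring

lemma pderiv_sum {ι : Type*} {s : Finset ι} {ν : Fin n} {f : ι → (Fin n → ℝ) → ℝ}
    {x : Fin n → ℝ} (hf : ∀ i ∈ s, DifferentiableAt ℝ (f i) x) :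
    pderiv ν (fun y => ∑ i ∈ s, f i y) x = ∑ i ∈ s, pderiv ν (f i) x := by
  simp [pderiv, fderiv_fun_sum hf]

lemma pderiv_prod {ι : Type*} [DecidableEq ι] {s : Finset ι} {ν : Fin n}
    {f : ι → (Fin n → ℝ) → ℝ} {x : Fin n → ℝ} (hf : ∀ i ∈ s, DifferentiableAt ℝ (f i) x) :
    pderiv ν (fun y => ∏ i ∈ s, f i y) x =
      ∑ i ∈ s, (∏ j ∈ s.erase i, f j x) * pderiv ν (f i) x := by
  simp [pderiv, fderiv_finsetProd hf]

@[simp] lemma pderiv_const {ν : Fin n} (c : ℝ) (x : Fin n → ℝ) :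
    pderiv ν (fun _ => c) x = 0 := by simp [pderiv]

lemma pderiv_coord (ν i : Fin n) (x : Fin n → ℝ) :
    pderiv ν (fun y => y i) x = if i = ν then 1 else 0 := by
  have : (fun y : Fin n → ℝ => y i) = (ContinuousLinearMap.proj i : (Fin n → ℝ) →L[ℝ] ℝ) := rfl
  rw [pderiv, this, ContinuousLinearMap.fderiv]
  simp [Pi.single_apply]

lemma IsMultivectorField.diff {k : ℕ} {P : TensorField n k} (h : IsMultivectorField P)
    (K : Fin k → Fin n) (x : Fin n → ℝ) : DifferentiableAt ℝ (fun y => P y K) x :=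
  (h.smooth K).differentiable (by simp) x

lemma IsMultivectorField.skew_dfield {k : ℕ} {P : TensorField n k} (h : IsMultivectorField P)
    (ν : Fin n) (x : Fin n → ℝ) : Skew (dfield ν P x) := by
  intro σ K
  have : (fun y => P y (K ∘ σ)) = fun y => ((Equiv.Perm.sign σ : ℤ) : ℝ) * P y K :=
    funext fun y => h.skew y σ K
  rw [dfield, this, pderiv_const_mul _ (h.diff K x)]
  rfl

lemma antisym_eq_alt {k : ℕ} (T : Tensor n k) : antisym T = alt T := rfl

lemma skew_antisym {k : ℕ} (T : Tensor n k) : Skew (𝕜 := ℝ) (antisym T) := skew_alt (𝕜 := ℝ) T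

lemma skew_schouten {a b : ℕ} (P : TensorField n (a + 1)) (Q : TensorField n (b + 1))
    (x : Fin n → ℝ) : Skew (schouten P Q x) := by
  unfold schouten
  exact ((skew_antisym _).smul _).add ((skew_antisym _).smul _)

lemma skew_wedge {a b : ℕ} (P : TensorField n a) (Q : TensorField n b) (x : Fin n → ℝ) :
    Skew (wedge P Q x) := by
  unfold wedge
  exact (skew_antisym _).smul _

/-- The coefficient `1 / (a! b!)` of the wedge is the product of the two normalizations in `nel`. -/
lemma nel_wedge {a b : ℕ} (P : TensorField n a) (Q : TensorField n b) (x : Fin n → ℝ) :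
    nel (wedge P Q x) = nel (P x) * nel (Q x) := by
  rw [wedge, nel_smul, antisym_eq_alt, nel_alt]
  have := el_mul rfl (P x) (Q x) (Fin.castAdd b) (Fin.natAdd a) (by simp) (by simp)
  simp only [nel, smul_mul_smul_comm, ← this]
  congr 1
  field_simp

/-- The working form of the bracket. The coefficients `1/(a! (b+1)!)` and `1/((a+1)! b!)` become the
normalizations of a contracted factor and a differentiated factor. -/
lemma nel_schouten {a b : ℕ} {P : TensorField n (a + 1)} {Q : TensorField n (b + 1)}
    (x : Fin n → ℝ) (hP : Skew (P x)) (hQ : Skew (Q x)) :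
    nel (schouten P Q x) = ∑ ν, con ν (nel (P x)) * nel (dfield ν Q x) +
      (-1 : ℝ) ^ (a + 1) • ∑ ν, nel (dfield ν P x) * con ν (nel (Q x)) := by
  rw [schouten, nel_add, nel_smul, nel_smul, antisym_eq_alt, nel_alt, antisym_eq_alt, nel_alt]
  have h1 : ∀ f : Fin n → Tensor n (a + b + 1), (fun K => ∑ ν, f ν K) = ∑ ν, f ν := by
    intro f; ext K; simp
  rw [h1, el_sum, h1, el_sum]
  simp only [con_nel hP, con_nel hQ, Finset.smul_sum]
  congr 1
  · refine Finset.sum_congr rfl fun ν _ => ?_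
    have := el_mul (m := a + b + 1) (by omega) (fun I => P x (Fin.cons ν I)) (dfield ν Q x)
      (fun i => ⟨i, by omega⟩) (fun j => ⟨a + j, by omega⟩) (by simp) (by simp)
    simp only [nel, smul_mul_smul_comm, ← this]
    congr 1
    field_simp
  · refine Finset.sum_congr rfl fun ν _ => ?_
    have := el_mul (m := a + b + 1) (by omega) (dfield ν P x) (fun I => Q x (Fin.cons ν I))
      (fun i => ⟨i, by omega⟩) (fun j => ⟨a + 1 + j, by omega⟩) (by simp) (by simp)
    simp only [nel, smul_mul_smul_comm, ← this, smul_smul]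
    have h2 : ∀ K : Fin (a + b + 1) → Fin n, 
       Q x (Fin.cons ν (fun j : Fin b => K ⟨a + 1 + j, by omega⟩)) *
          pderiv ν (fun y => P y (fun i : Fin (a + 1) => K ⟨i, by omega⟩)) x =
       dfield ν P x (K ∘ fun i => ⟨i, by omega⟩) * Q x (Fin.cons ν (K ∘ fun j : Fin b => ⟨a + 1 + j, by omega⟩)) := by
      intro K
      rw [mul_comm]; rfl
    simp only [h2]
    congr 1
    field_simp

lemma schouten_eq_zero_iff {a b : ℕ} {P : TensorField n (a + 1)} {Q : TensorField n (b + 1)} :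
    schouten P Q = 0 ↔ ∀ x, nel (schouten P Q x) = 0 := by
  refine ⟨fun h x => by rw [h]; simp [nel], fun h => funext fun x => ?_⟩
  exact (skew_schouten P Q x).eq_zero_of_nel (h x)

lemma IsMultivectorField.add {k : ℕ} {P Q : TensorField n k} (hP : IsMultivectorField P)
    (hQ : IsMultivectorField Q) : IsMultivectorField (P + Q) :=
  ⟨fun x => Skew.add (hP.skew x) (hQ.skew x), fun K => (hP.smooth K).add (hQ.smooth K)⟩

lemma IsMultivectorField.wedge {a b : ℕ} {P : TensorField n a} {Q : TensorField n b}
    (hP : IsMultivectorField P) (hQ : IsMultivectorField Q) :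
    IsMultivectorField (wedge P Q) := by
  refine ⟨skew_wedge P Q, fun K => ?_⟩
  simp only [GenJacobi.wedge, antisym, Pi.smul_apply, smul_eq_mul]
  refine contDiff_const.mul (ContDiff.sum fun σ _ => contDiff_const.mul ?_)
  exact (hP.smooth _).mul (hQ.smooth _)

lemma isMultivectorField_constField {k : ℕ} {T : Tensor n k} (h : IsSkew T) :
    IsMultivectorField (constField T) := ⟨fun _ => h, fun _ => contDiff_const⟩

lemma isMultivectorField_dilatation : IsMultivectorField (dilatation n) := by
  refine ⟨fun x σ K => ?_, fun K => contDiff_apply _ _ _⟩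
  rw [Subsingleton.elim σ 1]
  simp

lemma isMultivectorField_linearField {m : ℕ} {ω : (Fin m → Fin n) → Fin n → ℝ}
    (h : ∀ k, IsSkew fun I => ω I k) : IsMultivectorField (linearField ω) := by
  refine ⟨fun x σ K => ?_, fun K => ?_⟩
  · simp only [linearField, Finset.mul_sum, ← mul_assoc]
    exact Finset.sum_congr rfl fun k _ => congrArg (· * x k) (h k σ K)
  · exact ContDiff.sum fun k _ => contDiff_const.mul (contDiff_apply _ _ _)

lemma dfield_add {k : ℕ} {P Q : TensorField n k} (hP : IsMultivectorField P)
    (hQ : IsMultivectorField Q) (ν : Fin n) (x : Fin n → ℝ) :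
    dfield ν (P + Q) x = dfield ν P x + dfield ν Q x := by
  ext K
  exact pderiv_add (hP.diff K x) (hQ.diff K x)

lemma nel_dfield_wedge {a b : ℕ} {P : TensorField n a} {Q : TensorField n b}
    (hP : IsMultivectorField P) (hQ : IsMultivectorField Q) (ν : Fin n) (x : Fin n → ℝ) :
    nel (dfield ν (wedge P Q) x) =
      nel (dfield ν P x) * nel (Q x) + nel (P x) * nel (dfield ν Q x) := by
  have h1 := nel_wedge (dfield ν P) Q x
  have h2 := nel_wedge P (dfield ν Q) x
  rw [← h1, ← h2, ← nel_add]
  congr 1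
  ext K
  simp only [dfield, GenJacobi.wedge, antisym, Pi.smul_apply, Pi.add_apply, smul_eq_mul]
  have hd : ∀ L : Fin (a + b) → Fin n, DifferentiableAt ℝ (fun y : Fin n → ℝ => P y (fun i => L (Fin.castAdd b i)) * 
     Q y (fun j => L (Fin.natAdd a j))) x := fun L => (hP.diff _ x).mul (hQ.diff _ x)
  rw [pderiv_const_mul _ (DifferentiableAt.fun_sum fun σ _ => (hd _).const_mul _),
    pderiv_sum fun σ _ => (hd _).const_mul _]
  simp only [pderiv_const_mul _ (hd _), pderiv_mul (hP.diff _ x) (hQ.diff _ x), mul_add,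
    Finset.sum_add_distrib]

lemma dfield_linearField {m : ℕ} (ω : (Fin m → Fin n) → Fin n → ℝ) (ν : Fin n)
    (x : Fin n → ℝ) : dfield ν (linearField ω) x = fun I => ω I ν := by
  ext K
  simp only [dfield, linearField]
  rw [pderiv_sum fun k _ => (by fun_prop)]
  simp only [pderiv_const_mul _ (differentiableAt_apply _ _), pderiv_coord]
  simp

/-- Euler's formula for components of degree one in `x`. -/
lemma linearField_eq {m : ℕ} (ω : (Fin m → Fin n) → Fin n → ℝ) (x : Fin n → ℝ) :
    linearField ω x = ∑ ν, x ν • dfield ν (linearField ω) x := by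
  ext K
  simp [dfield_linearField, linearField, mul_comm]

@[simp] lemma dfield_constField {k : ℕ} (T : Tensor n k) (ν : Fin n) (x : Fin n → ℝ) :
    dfield ν (constField T) x = 0 := by
  ext K
  simp [dfield, constField]

lemma nel_dilatation (x : Fin n → ℝ) : nel (dilatation n x) = ∑ i, x i • th i := by
  rw [nel, el_succ]
  simp [el_fin_zero, dilatation, Algebra.algebraMap_eq_smul_one]

lemma nel_dfield_dilatation (ν : Fin n) (x : Fin n → ℝ) :
    nel (dfield ν (dilatation n) x) = th ν := by
  rw [nel, el_succ]
  simp [el_fin_zero, dilatation, dfield, pderiv_coord]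

@[simp] lemma nel_zero {k : ℕ} : nel (0 : Tensor n k) = 0 := by simp [nel]

end Fields

/-! ### The dilatation field and the bracket of `E` with `Ω + E ∧ A`. -/

section Dilatation

variable {n : ℕ}

lemma con_sum_th (x : Fin n → ℝ) (i : Fin n) :
    con i (∑ j, x j • th j : Ext ℝ n) = algebraMap ℝ _ (x i) := by
  simp [map_sum, Algebra.algebraMap_eq_smul_one]

lemma od_sum_th (x : Fin n → ℝ) : Od (∑ j, x j • th j : Ext ℝ n) :=
  Od.sum fun j => (od_th j).smul _

lemma con_add_mul_dilatation {e w : Ext ℝ n} (he : Od e) (x : Fin n → ℝ) (i : Fin n) :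
    con i (w + e * ∑ j, x j • th j) = con i w + con i e * (∑ j, x j • th j) - x i • e := by
  rw [map_add, con_mul, con_sum_th, he, ← Algebra.commutes, ← Algebra.smul_def]
  module

/-- The algebraic identity behind the generalized Jacobi identity for `Ω + E ∧ A`. -/
lemma sum_con_mul_dilatation {e w : Ext ℝ n} {e' w' : Fin n → Ext ℝ n} {x : Fin n → ℝ} {c : ℝ}
    (he : Od e) (he' : ∀ i, Od (e' i)) (hw : Ev w) (hw' : ∀ i, Ev (w' i))
    (hx : ∑ i, x i • w' i = w) (h1 : ∑ i, th i * con i w = (c + 1) • w)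
    (h2 : ∑ i, th i * con i e = c • e) (h3 : ∑ i, con i w * w' i = 0)
    (h4 : ∑ i, (con i e * w' i - e' i * con i w + e * (con i e * th i - x i • e' i)) = 0) :
    ∑ i, con i (w + e * ∑ j, x j • th j) * (w' i + (e' i * (∑ j, x j • th j) + e * th i)) =
      c • (e * (w + e * ∑ j, x j • th j)) := by
  set A : Ext ℝ n := ∑ j, x j • th j with hA
  have hAo : Od A := od_sum_th x
  have hee : e * e = 0 := he.mul_self
  have hAA : A * A = 0 := hAo.mul_self
  have key : ∀ i, con i (w + e * A) * (w' i + (e' i * A + e * th i)) =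
      con i w * w' i +
      (con i e * w' i - e' i * con i w + e * (con i e * th i - x i • e' i)) * A
      - e * (th i * con i e) * A + e * (th i * con i w) - e * (x i • w' i)
      + A * e * (th i * con i e) := by
    intro i
    rw [hA, con_add_mul_dilatation he, ← hA]
    have a1 : con i w * (e * th i) = e * th i * con i w :=
      ((he.mul (od_th i)).comm _).symm
    have a2 : con i w * e' i = - (e' i * con i w) := (hw.con i).anticomm (he' i)
    have a3 : con i e * th i = th i * con i e := (he.con i).comm _
    have a4 : A * w' i = w' i * A := ((hw' i).comm A).symm
    have a5 : A * (e' i * A) = 0 := by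
      rw [← mul_assoc, hAo.anticomm (he' i), neg_mul, mul_assoc, hAA, mul_zero, neg_zero]
    have a6 : con i e * (A * (e * th i)) = A * e * (th i * con i e) := by
      rw [(he.con i).comm]; simp only [mul_assoc]
    have a7 : e * (e * th i) = 0 := by rw [← mul_assoc, hee, zero_mul]
    calc _ = con i w * w' i + con i w * e' i * A + con i w * (e * th i)
          + con i e * (A * w' i) + con i e * (A * (e' i * A)) + con i e * (A * (e * th i))
          - x i • (e * w' i) - x i • (e * e' i * A) - x i • (e * (e * th i)) := by
            simp only [mul_add, add_mul, sub_mul, smul_mul_assoc, mul_assoc]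
            abel
      _ = _ := by
        rw [a1, a2, a4, a5, a6, a7, a3]
        simp only [add_mul, sub_mul, mul_sub, smul_mul_assoc, mul_smul_comm, mul_assoc, neg_mul,
          mul_zero, smul_zero]
        abel
  -- By Euler's formula, `e * ∑ θ_i i_i w` gives `c + 1` copies of `e * w`, and `e * ∑ x_i w'_i`
  -- removes one, which leaves the factor `c`. Every term containing `e` twice vanishes.
  simp only [key, Finset.sum_add_distrib, Finset.sum_sub_distrib, ← Finset.sum_mul,
    ← Finset.mul_sum, h1, h2, h3, hx]
  have h4' := h4
  simp only [Finset.sum_add_distrib, Finset.sum_sub_distrib, ← Finset.mul_sum] at h4'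
  rw [h4']
  simp only [mul_smul_comm, smul_mul_assoc, mul_add, ← mul_assoc, hee]
  rw [mul_assoc A, hee]
  simp
  module

lemma nel_schouten_dilatation {r : ℕ} {E : TensorField n (2 * r + 1)} (hE : IsMultivectorField E)
    (x : Fin n → ℝ) :
    nel (schouten E (dilatation n) x) =
      ∑ i, (con i (nel (E x)) * th i - x i • nel (dfield i E x)) := by
  rw [nel_schouten (b := 0) x (hE.skew x) (isMultivectorField_dilatation.skew x)]
  rw [Finset.sum_sub_distrib]
  simp only [nel_dfield_dilatation, nel_dilatation, con_sum_th,
    Odd.neg_one_pow (odd_two_mul_add_one r), neg_one_smul, ← Algebra.commutes, ← Algebra.smul_def,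
    sub_eq_add_neg]

/-- The contraction `i_ν E` is even, hence central, so the two terms with `(i_ν E) (∂_ν E) A`
cancel; every remaining term contains the factor `E`. -/
lemma nel_schouten_wedge_dilatation {r : ℕ} {E : TensorField n (2 * r + 1)}
    (hE : IsMultivectorField E) (x : Fin n → ℝ) :
    nel (schouten E (wedge E (dilatation n)) x) =
      nel (E x) * nel (schouten E (dilatation n) x) := by
  have hA := isMultivectorField_dilatation (n := n)
  have he : Od (nel (E x)) := od_nel (odd_two_mul_add_one r) _
  rw [nel_schouten x (hE.skew x) (skew_wedge _ _ x), nel_schouten_dilatation hE,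
    Odd.neg_one_pow (odd_two_mul_add_one r), neg_one_smul, Finset.mul_sum, ← sub_eq_add_neg,
    ← Finset.sum_sub_distrib]
  refine Finset.sum_congr rfl fun i _ => ?_
  have he' : Od (nel (dfield i E x)) := od_nel (odd_two_mul_add_one r) _
  rw [nel_dfield_wedge hE hA, nel_wedge, nel_dfield_dilatation, nel_dilatation]
  have := con_add_mul_dilatation (w := 0) he x i
  rw [zero_add, map_zero, zero_add] at this
  rw [this]
  set A : Ext ℝ n := ∑ j, x j • th j
  have a1 : nel (dfield i E x) * (con i (nel (E x)) * A) =
      con i (nel (E x)) * (nel (dfield i E x) * A) := by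
    rw [← mul_assoc, ← (he.con i).comm, mul_assoc]
  have a2 : con i (nel (E x)) * (nel (E x) * th i) = nel (E x) * (con i (nel (E x)) * th i) := by
    rw [← mul_assoc, (he.con i).comm, mul_assoc]
  have a3 := he'.anticomm he
  rw [mul_add, mul_sub, mul_sub, a1, a2, mul_smul_comm, mul_smul_comm, a3]
  module

variable {r : ℕ}

lemma schouten_add_right {a b : ℕ} {P : TensorField n (a + 1)} {Q R : TensorField n (b + 1)}
    (hP : IsMultivectorField P) (hQ : IsMultivectorField Q) (hR : IsMultivectorField R)
    (x : Fin n → ℝ) :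
    nel (schouten P (Q + R) x) = nel (schouten P Q x) + nel (schouten P R x) := by
  rw [nel_schouten x (hP.skew x) (hQ.skew x), nel_schouten x (hP.skew x) (hR.skew x),
    nel_schouten x (hP.skew x) ((hQ.add hR).skew x)]
  simp only [dfield_add hQ hR, Pi.add_apply, nel_add, map_add, mul_add, Finset.sum_add_distrib,
    smul_add]
  abel

variable {Ω : TensorField n (2 * r + 2)} {E : TensorField n (2 * r + 1)}

lemma nel_schouten_add_wedge (hΩ : IsMultivectorField Ω) (hE : IsMultivectorField E)
    (x : Fin n → ℝ) :
    nel (schouten E (Ω + wedge E (dilatation n)) x) =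
      nel (schouten E Ω x) + nel (E x) * nel (schouten E (dilatation n) x) := by
  rw [schouten_add_right hE hΩ (hE.wedge isMultivectorField_dilatation),
    nel_schouten_wedge_dilatation hE]

/-- `[E, E ∧ A] = E ∧ [E, A]`, so the two conditions differ only by moving a term across. The index
cast reconciles the two expressions for the degree `4p - 2`. -/
lemma schouten_add_wedge_eq_zero_iff
    (hr : 2 * r + 1 + (2 * r + 0 + 1) = 2 * r + (2 * r + 1) + 1)
    (hΩ : IsMultivectorField Ω) (hE : IsMultivectorField E) :
    schouten E (Ω + wedge E (dilatation n)) = 0 ↔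
      ∀ x K, schouten E Ω x K = -wedge E (schouten E (dilatation n)) x
        (fun i => K (Fin.cast hr i)) := by
  rw [schouten_eq_zero_iff]
  refine forall_congr' fun x => ?_
  rw [nel_schouten_add_wedge hΩ hE, ← nel_wedge,
    ← nel_cast hr]
  have hs := (skew_wedge E (schouten E (dilatation n)) x).cast hr
  rw [← nel_add]
  constructor
  · intro h K
    have := congrFun (((skew_schouten E Ω x).add hs).eq_zero_of_nel h) K
    exact eq_neg_of_add_eq_zero_left this
  · intro h
    rw [show schouten E Ω x + _ = 0 from funext fun K => by
      rw [Pi.add_apply, h K]; exact neg_add_cancel _, nel_zero]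

/-- The two halves of `[Ω, Ω]` coincide because `∂_ν Ω` is even and therefore central. -/
lemma sum_con_mul_eq_zero_of_schouten_self (hΩ : IsMultivectorField Ω) (h : schouten Ω Ω = 0)
    (x : Fin n → ℝ) : ∑ i, con i (nel (Ω x)) * nel (dfield i Ω x) = 0 := by
  have h0 := schouten_eq_zero_iff.1 h x
  rw [nel_schouten x (hΩ.skew x) (hΩ.skew x)] at h0
  have h1 : (-1 : ℝ) ^ (2 * r + 1 + 1) = 1 := by rw [add_assoc, Even.neg_one_pow ⟨r + 1, by ring⟩]
  have h2 : ∀ i, nel (dfield i Ω x) * con i (nel (Ω x)) = con i (nel (Ω x)) * nel (dfield i Ω x) :=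
    fun i => (ev_nel ⟨r + 1, by ring⟩ _).comm _
  rw [h1, one_smul] at h0
  simp only [h2, ← two_smul ℝ] at h0
  exact (smul_eq_zero.1 h0).resolve_left two_ne_zero

lemma nel_schouten_odd_even (hΩ : IsMultivectorField Ω) (hE : IsMultivectorField E)
    (x : Fin n → ℝ) : nel (schouten E Ω x) =
      ∑ i, (con i (nel (E x)) * nel (dfield i Ω x) - nel (dfield i E x) * con i (nel (Ω x))) := by
  rw [nel_schouten x (hE.skew x) (hΩ.skew x), Odd.neg_one_pow (odd_two_mul_add_one r),
    neg_one_smul, Finset.sum_sub_distrib, sub_eq_add_neg]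

end Dilatation

/-! ### The generalized Jacobi identity on jets -/

section Jets

variable {n : ℕ}

/-- Full contraction of a tensor with covectors. -/
def ctr {k : ℕ} (T : Tensor n k) (v : Fin k → Fin n → ℝ) : ℝ := ∑ I, T I * ∏ j, v j (I j)

/-- Permuting the covectors is the same as permuting the indices. This turns the signed sum in the
Jacobi identity into a statement about one antisymmetrized tensor. -/
lemma sum_sign_ctr {k : ℕ} (T : Tensor n k) (v : Fin k → Fin n → ℝ) :
    ∑ σ : Equiv.Perm (Fin k), ((Equiv.Perm.sign σ : ℤ) : ℝ) * ctr T (v ∘ σ) =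
      ctr (antisym T) v := by
  simp only [ctr, antisym, Finset.sum_mul, Finset.mul_sum]
  conv_rhs => rw [Finset.sum_comm]
  refine Finset.sum_congr rfl fun σ _ => ?_
  rw [← (Equiv.arrowCongr σ.symm (Equiv.refl (Fin n))).sum_comp]
  refine Finset.sum_congr rfl fun K _ => ?_
  have h1 : (Equiv.arrowCongr σ.symm (Equiv.refl (Fin n)) K) = K ∘ σ := by ext; simp
  rw [h1, mul_assoc, ← Equiv.prod_comp σ fun j => v j (K j)]
  rfl

/-- The tensor on `n + 1` indices obtained by shifting the indices. -/
def up {k : ℕ} (T : Tensor n k) : Tensor (n + 1) k :=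
  fun I => ∑ K, T K * ∏ j, if I j = (K j).succ then 1 else 0

lemma up_cons_zero {k : ℕ} (T : Tensor n (k + 1)) (I : Fin k → Fin (n + 1)) :
    up T (Fin.cons 0 I) = 0 := by
  refine Finset.sum_eq_zero fun K _ => ?_
  rw [Fin.prod_univ_succ]
  simp [(Fin.succ_ne_zero _).symm]

lemma up_cons_succ {k : ℕ} (T : Tensor n (k + 1)) (i : Fin n) (I : Fin k → Fin (n + 1)) :
    up T (Fin.cons i.succ I) = up (fun K => T (Fin.cons i K)) I := by
  unfold up
  rw [← (Fin.consEquiv fun _ => Fin n).sum_comp, Fintype.sum_prod_type]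
  simp only [Fin.consEquiv_apply, Fin.prod_univ_succ, Fin.cons_zero, Fin.cons_succ, Fin.succ_inj,
    ite_mul, one_mul, zero_mul, mul_ite, mul_zero]
  simp [Fin.consEquiv]

lemma up_eq_zero {k : ℕ} (T : Tensor n k) (I : Fin k → Fin (n + 1)) (s : Fin k) (h : I s = 0) :
    up T I = 0 := by
  refine Finset.sum_eq_zero fun K _ => ?_
  rw [Finset.prod_eq_zero (Finset.mem_univ s) (by simp [h, (Fin.succ_ne_zero _).symm]), mul_zero]

lemma skew_up {k : ℕ} {T : Tensor n k} (h : Skew T) : Skew (up T) := by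
  intro σ K
  unfold up
  rw [Finset.mul_sum, ← (Equiv.arrowCongr σ.symm (Equiv.refl (Fin n))).sum_comp]
  refine Finset.sum_congr rfl fun I _ => ?_
  have h1 : (Equiv.arrowCongr σ.symm (Equiv.refl (Fin n)) I) = I ∘ σ := by ext; simp
  rw [h1, h, mul_assoc]
  congr 2
  exact Equiv.prod_comp σ fun j => if K j = (I j).succ then (1 : ℝ) else 0

lemma ctr_up {k : ℕ} (T : Tensor n k) (v : Fin k → Fin (n + 1) → ℝ) :
    ctr (up T) v = ctr T (fun j i => v j i.succ) := by
  simp only [ctr, up, Finset.sum_mul]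
  rw [Finset.sum_comm]
  refine Finset.sum_congr rfl fun K _ => ?_
  rw [Finset.sum_eq_single fun j => (K j).succ]
  · simp
  · intro I _ hI
    obtain ⟨j, hj⟩ := Function.ne_iff.1 hI
    rw [Finset.prod_eq_zero (Finset.mem_univ j) (by simp [hj]), mul_zero, zero_mul]
  · simp

lemma up_smul {k : ℕ} (c : ℝ) (T : Tensor n k) : up (c • T) = c • up T := by
  ext I; simp [up, Finset.mul_sum, mul_assoc]

/-- The embedding of exterior algebras that shifts the generators. -/
def shift : Ext ℝ n →ₐ[ℝ] Ext ℝ (n + 1) :=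
  ExteriorAlgebra.map (LinearMap.pi fun i : Fin (n + 1) =>
    Fin.cases (motive := fun _ => (Fin n → ℝ) →ₗ[ℝ] ℝ) 0 (fun j => LinearMap.proj j) i)

lemma shift_th (i : Fin n) : shift (th i) = th i.succ := by
  rw [shift, th, ExteriorAlgebra.map_apply_ι, th]
  congr 1
  funext j
  refine Fin.cases ?_ (fun j => ?_) j
  · simp [(Fin.succ_ne_zero _).symm]
  · simp [Pi.single_apply]

lemma el_up {k : ℕ} (T : Tensor n k) : el (up T) = shift (el T) := by
  induction k with
  | zero =>
    rw [el_fin_zero, el_fin_zero, AlgHom.commutes]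
    congr 1
    simp only [up, Finset.univ_eq_empty, Finset.prod_empty, mul_one, Fintype.sum_unique]
    exact congrArg T (Subsingleton.elim _ _)
  | succ k ih =>
    rw [el_succ, Fin.sum_univ_succ, el_succ]
    simp only [up_cons_zero, up_cons_succ, map_sum, map_mul, shift_th]
    rw [show (fun _ : Fin k → Fin (n + 1) => (0 : ℝ)) = 0 from rfl, el_zero, mul_zero, zero_add]
    exact Finset.sum_congr rfl fun i _ => by rw [← ih]

lemma nel_up {k : ℕ} (T : Tensor n k) : nel (up T) = shift (nel T) := by
  rw [nel, nel, map_smul, el_up]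

lemma con_zero_shift (x : Ext ℝ n) : con 0 (shift x) = 0 := by
  induction x using ext_induction with
  | h1 r => simp
  | hmul j x hx => simp [map_mul, shift_th, con_th_mul, hx, (Fin.succ_ne_zero _).symm]
  | hadd x z hx hz => simp [hx, hz]
  | hsmul c x hx => simp [hx]

lemma con_succ_shift (i : Fin n) (x : Ext ℝ n) : con i.succ (shift x) = shift (con i x) := by
  induction x using ext_induction with
  | h1 r => simp
  | hmul j x hx =>
    rw [map_mul, shift_th, con_th_mul, con_th_mul, map_sub, map_mul, hx, shift_th]
    simp only [Fin.succ_inj]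
    split_ifs <;> simp
  | hadd x z hx hz => simp [hx, hz]
  | hsmul c x hx => simp [hx]

lemma inv_shift (x : Ext ℝ n) : inv (shift x) = shift (inv x) := by
  induction x using ext_induction with
  | h1 r => simp
  | hmul j x hx => rw [map_mul, map_mul, map_mul, map_mul, hx, shift_th, inv_th, inv_th, map_neg, shift_th]
  | hadd x z hx hz => simp [hx, hz]
  | hsmul c x hx => simp [hx]

lemma Ev.shift {x : Ext ℝ n} (h : Ev x) : Ev (shift x) := by
  unfold Ev at *; rw [inv_shift, h]

lemma Od.shift {x : Ext ℝ n} (h : Od x) : Od (GenJacobi.shift x) := by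
  unfold Od at *; rw [inv_shift, h, map_neg]

/-- If `S` is skew in all but the first index, then its skew-symmetrization is a sum over the
index moved to the first place. -/
lemma alt_of_skew_tail {k : ℕ} {S : Tensor n (k + 1)} (h : ∀ i, Skew fun I => S (Fin.cons i I))
    (K : Fin (k + 1) → Fin n) : alt S K =
      (k.factorial : ℝ) * ∑ p : Fin (k + 1), (-1) ^ (p : ℕ) * S (Fin.cons (K p) (p.removeNth K)) := by
  have h0 : ∀ (τ : Equiv.Perm (Fin k)) (L : Fin (k + 1) → Fin n),
      S (L ∘ Equiv.Perm.decomposeFin.symm (0, τ)) = ((Equiv.Perm.sign τ : ℤ) : ℝ) * S L := by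
    intro τ L
    have := h (L 0) τ (Fin.tail L)
    simp only [Fin.cons_self_tail] at this
    rw [← this]
    congr 1
    funext j
    refine Fin.cases ?_ (fun i => ?_) j <;> simp [Fin.tail]
  have h1 : ∀ p : Fin (k + 1), (((Equiv.Perm.sign (Equiv.swap 0 p) : ℤ) : ℝ)) *
      S (K ∘ Equiv.swap 0 p) = (-1) ^ (p : ℕ) * S (Fin.cons (K p) (p.removeNth K)) := by
    intro p
    -- The transposition of `0` and `p` and the cycle moving `p` to the front differ by a
    -- permutation fixing `0`, and that one acts on the skew tail.
    set ρ : Equiv.Perm (Fin (k + 1)) := p.cycleRange * Equiv.swap 0 p with hρ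
    obtain ⟨⟨q, τ⟩, hτ⟩ := Equiv.Perm.decomposeFin.symm.surjective ρ
    have hq : q = 0 := by
      have := Equiv.Perm.decomposeFin_symm_apply_zero q τ
      rw [← this, hτ, hρ]
      simp
    subst hq
    have hs : Equiv.Perm.sign ρ = Equiv.Perm.sign τ := by
      rw [← hτ, Equiv.Perm.decomposeFin.symm_sign, if_pos rfl, one_mul]
    have h2 : K ∘ Equiv.swap 0 p = (K ∘ p.cycleRange.symm) ∘ ρ := by
      funext j; simp [hρ]
    rw [h2, ← hτ, h0, ← hs, ← Fin.cons_removeNth_eq_comp_cycleRange_symm, hρ, map_mul,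
      Fin.sign_cycleRange, ← mul_assoc]
    congr 1
    push_cast
    have := sign_mul_self (𝕜 := ℝ) (Equiv.swap 0 p)
    rw [mul_left_comm, this, mul_one]
  unfold alt
  rw [← Equiv.Perm.decomposeFin.symm.sum_comp, Fintype.sum_prod_type, Finset.mul_sum]
  refine Finset.sum_congr rfl fun p _ => ?_
  rw [← h1]
  have h3 : ∀ τ : Equiv.Perm (Fin k), Equiv.Perm.decomposeFin.symm (p, τ) =
      Equiv.swap 0 p * Equiv.Perm.decomposeFin.symm (0, τ) := by
    intro τ
    ext j
    refine Fin.cases ?_ (fun i => ?_) j <;> simp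
  simp only [h3, map_mul, Equiv.Perm.coe_mul, ← Function.comp_assoc, h0]
  simp only [Equiv.Perm.decomposeFin.symm_sign, if_pos, one_mul]
  rw [Finset.sum_congr rfl (g := fun _ => ((Equiv.Perm.sign (Equiv.swap 0 p) : ℤ) : ℝ) *
      S (K ∘ Equiv.swap 0 p))]
  · simp [Fintype.card_perm]
  · intro τ _
    push_cast
    linear_combination ((Equiv.Perm.sign (Equiv.swap 0 p) : ℤ) : ℝ) *
      S (K ∘ Equiv.swap 0 p) * sign_mul_self (𝕜 := ℝ) τ

/-- The components of `θ⁰ ∧ E` for a skew tensor `E` on the other indices. -/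
def upZero {k : ℕ} (E : Tensor n k) : Tensor (n + 1) (k + 1) := fun I =>
  ∑ p : Fin (k + 1), (-1) ^ (p : ℕ) * ((if I p = 0 then 1 else 0) * up E (p.removeNth I))

lemma upZero_eq {k : ℕ} {E : Tensor n k} (h : Skew E) : upZero E =
    (1 / (k.factorial : ℝ)) • alt fun I : Fin (k + 1) → Fin (n + 1) =>
      (if I 0 = 0 then 1 else 0) * up E (Fin.tail I) := by
  ext K
  rw [Pi.smul_apply, alt_of_skew_tail, smul_eq_mul, ← mul_assoc, one_div,
    inv_mul_cancel₀ (by exact_mod_cast k.factorial_ne_zero), one_mul]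
  · simp [upZero]
  · intro i
    simp only [Fin.cons_zero, Fin.tail_cons]
    exact (skew_up h).smul (if i = 0 then 1 else 0)

lemma skew_upZero {k : ℕ} {E : Tensor n k} (h : Skew E) : Skew (upZero E) := by
  rw [upZero_eq h]
  exact (skew_alt _).smul _

/-- Only the terms with first index `0` survive in the tensor before skew-symmetrization, which
leaves the generator `th 0` in front. -/
lemma nel_upZero {k : ℕ} {E : Tensor n k} (h : Skew E) :
    nel (upZero E) = th 0 * shift (nel E) := by
  rw [upZero_eq h, nel_smul, nel_alt, el_succ, Fin.sum_univ_succ]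
  have : ∀ i : Fin n, el (fun I : Fin k → Fin (n + 1) =>
      (if (Fin.cons i.succ I : Fin (k + 1) → Fin (n + 1)) 0 = 0 then (1 : ℝ) else 0) *
        up E (Fin.tail (Fin.cons i.succ I : Fin (k + 1) → Fin (n + 1)))) = 0 := by
    intro i
    simp only [Fin.cons_zero, Fin.succ_ne_zero, if_false, zero_mul]
    exact el_zero
  simp only [this, mul_zero, Finset.sum_const_zero, add_zero]
  simp only [Fin.cons_zero, if_true, one_mul, Fin.tail_cons]
  rw [show (fun I => up E I) = up E from rfl, el_up, nel, map_smul, mul_smul_comm]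

/-- The expansion along the position of the index `0` is exactly the sum over the omitted function
in the definition of the bracket. -/
lemma ctr_upZero {k : ℕ} (E : Tensor n k) (v : Fin (k + 1) → Fin (n + 1) → ℝ) :
    ctr (upZero E) v = ∑ p : Fin (k + 1), (-1) ^ (p : ℕ) * v p 0 *
      ctr E (fun j i => v (p.succAbove j) i.succ) := by
  simp only [ctr, upZero, Finset.sum_mul]
  rw [Finset.sum_comm]
  refine Finset.sum_congr rfl fun p _ => ?_
  have := ctr_up E (fun j => v (p.succAbove j))
  rw [ctr, ctr] at this
  rw [← this, ← (Fin.insertNthEquiv (fun _ => Fin (n + 1)) p).sum_comp, Fintype.sum_prod_type,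
    Finset.sum_eq_single 0]
  · rw [Finset.mul_sum]
    refine Finset.sum_congr rfl fun I _ => ?_
    simp [Fin.prod_univ_succAbove _ p, Fin.insertNthEquiv]
    ring
  · intro i _ hi
    refine Finset.sum_eq_zero fun I _ => ?_
    simp [Fin.insertNthEquiv, hi]
  · simp

end Jets

/-! ### The bracket as a tensor on first jets. -/

section JacobiIdentity

variable {n : ℕ}

/-- The value of a function together with its differential. -/
def jet (f : (Fin n → ℝ) → ℝ) (x : Fin n → ℝ) : Fin (n + 1) → ℝ :=
  Fin.cons (f x) fun i => pderiv i f x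

/-- The Hessian at `(x, 1)` of the function `t f(x)` of `n + 1` variables. -/
def hess (f : (Fin n → ℝ) → ℝ) (x : Fin n → ℝ) (ν : Fin (n + 1)) : Fin (n + 1) → ℝ :=
  Fin.cases (motive := fun _ => Fin (n + 1) → ℝ) (Fin.cons 0 fun j => pderiv j f x)
    (fun i => Fin.cons (pderiv i f x) fun j => pderiv i (pderiv j f) x) ν

@[simp] lemma hess_zero_zero (f : (Fin n → ℝ) → ℝ) (x : Fin n → ℝ) : hess f x 0 0 = 0 := rfl
@[simp] lemma hess_zero_succ (f : (Fin n → ℝ) → ℝ) (x : Fin n → ℝ) (j : Fin n) :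
    hess f x 0 j.succ = pderiv j f x := rfl
@[simp] lemma hess_succ_zero (f : (Fin n → ℝ) → ℝ) (x : Fin n → ℝ) (i : Fin n) :
    hess f x i.succ 0 = pderiv i f x := rfl
@[simp] lemma hess_succ_succ (f : (Fin n → ℝ) → ℝ) (x : Fin n → ℝ) (i j : Fin n) :
    hess f x i.succ j.succ = pderiv i (pderiv j f) x := rfl
@[simp] lemma jet_zero (f : (Fin n → ℝ) → ℝ) (x : Fin n → ℝ) : jet f x 0 = f x := rfl
@[simp] lemma jet_succ (f : (Fin n → ℝ) → ℝ) (x : Fin n → ℝ) (i : Fin n) :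
    jet f x i.succ = pderiv i f x := rfl

lemma contDiff_pderiv {f : (Fin n → ℝ) → ℝ} (hf : ContDiff ℝ ((⊤ : ℕ∞) : WithTop ℕ∞) f)
    (i : Fin n) : ContDiff ℝ ((⊤ : ℕ∞) : WithTop ℕ∞) (pderiv i f) :=
  (hf.fderiv_right (m := ((⊤ : ℕ∞) : WithTop ℕ∞)) (by simp)).clm_apply contDiff_const

lemma pderiv_comm {f : (Fin n → ℝ) → ℝ} (hf : ContDiff ℝ ((⊤ : ℕ∞) : WithTop ℕ∞) f)
    (i j : Fin n) (x : Fin n → ℝ) : pderiv i (pderiv j f) x = pderiv j (pderiv i f) x := by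
  have h1 : ∀ i j : Fin n, pderiv i (pderiv j f) x =
      fderiv ℝ (fderiv ℝ f) x (Pi.single i 1) (Pi.single j 1) := by
    intro i j
    have hd : DifferentiableAt ℝ (fderiv ℝ f) x :=
      (hf.fderiv_right (m := ((⊤ : ℕ∞) : WithTop ℕ∞)) (by simp)).differentiable (by simp) x
    have : pderiv j f = fun y => fderiv ℝ f y (Pi.single j 1) := rfl
    rw [this, pderiv, fderiv_clm_apply hd (differentiableAt_const _)]
    simp
  rw [h1, h1]
  exact (hf.contDiffAt.isSymmSndFDerivAt (by simp; exact WithTop.coe_le_coe.2 (le_top (a := (2 : ℕ∞))))) _ _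

lemma hess_symm {f : (Fin n → ℝ) → ℝ} (hf : ContDiff ℝ ((⊤ : ℕ∞) : WithTop ℕ∞) f)
    (x : Fin n → ℝ) (ν μ : Fin (n + 1)) : hess f x ν μ = hess f x μ ν := by
  refine Fin.cases ?_ (fun i => ?_) ν <;> refine Fin.cases ?_ (fun j => ?_) μ <;>
    simp [pderiv_comm hf]

lemma contDiff_jet {f : (Fin n → ℝ) → ℝ} (hf : ContDiff ℝ ((⊤ : ℕ∞) : WithTop ℕ∞) f)
    (ν : Fin (n + 1)) : ContDiff ℝ ((⊤ : ℕ∞) : WithTop ℕ∞) (fun x => jet f x ν) := by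
  refine Fin.cases ?_ (fun i => ?_) ν
  · exact hf
  · exact contDiff_pderiv hf i

lemma pderiv_jet (f : (Fin n → ℝ) → ℝ) (x : Fin n → ℝ) (i : Fin n) (ν : Fin (n + 1)) :
    pderiv i (fun y => jet f y ν) x = hess f x i.succ ν := by
  refine Fin.cases ?_ (fun i => ?_) ν <;> rfl

/-- The tensor on jets which computes the bracket. -/
def brT {k : ℕ} (L : Tensor n (k + 1)) (E : Tensor n k) : Tensor (n + 1) (k + 1) :=
  up L + upZero E

lemma jacobiBracket_eq {r : ℕ} (Λ : TensorField n (2 * r + 2)) (E : TensorField n (2 * r + 1))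
    (f : Fin (2 * r + 2) → (Fin n → ℝ) → ℝ) (x : Fin n → ℝ) :
    jacobiBracket Λ E f x = ctr (brT (Λ x) (E x)) fun j => jet (f j) x := by
  rw [brT, jacobiBracket]
  have : ∀ (T S : Tensor (n + 1) (2 * r + 2)) v, ctr (T + S) v = ctr T v + ctr S v := by
    intro T S v; simp [ctr, add_mul, Finset.sum_add_distrib]
  rw [this, ctr_up, ctr_upZero]
  rfl

lemma skew_brT {k : ℕ} {L : Tensor n (k + 1)} {E : Tensor n k} (hL : Skew L) (hE : Skew E) :
    Skew (brT L E) := (skew_up hL).add (skew_upZero hE)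

lemma nel_brT {k : ℕ} (L : Tensor n (k + 1)) {E : Tensor n k} (hE : Skew E) :
    nel (brT L E) = shift (nel L) + th 0 * shift (nel E) := by
  rw [brT, nel_add, nel_up, nel_upZero hE]

lemma contDiff_brT {k : ℕ} {Λ : TensorField n (k + 1)} {E : TensorField n k}
    (hΛ : IsMultivectorField Λ) (hE : IsMultivectorField E) (I : Fin (k + 1) → Fin (n + 1)) :
    ContDiff ℝ ((⊤ : ℕ∞) : WithTop ℕ∞) (fun x => brT (Λ x) (E x) I) := by
  simp only [brT, Pi.add_apply, up, upZero]
  refine (ContDiff.sum fun K _ => (hΛ.smooth K).mul contDiff_const).add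
    (ContDiff.sum fun p _ => contDiff_const.mul (contDiff_const.mul
      (ContDiff.sum fun K _ => (hE.smooth K).mul contDiff_const)))

lemma pderiv_brT {k : ℕ} {Λ : TensorField n (k + 1)} {E : TensorField n k}
    (hΛ : IsMultivectorField Λ) (hE : IsMultivectorField E) (I : Fin (k + 1) → Fin (n + 1))
    (i : Fin n) (x : Fin n → ℝ) :
    pderiv i (fun x => brT (Λ x) (E x) I) x = brT (dfield i Λ x) (dfield i E x) I := by
  simp only [brT, Pi.add_apply, upZero]
  have key : ∀ {m : ℕ} {P : TensorField n m} (_ : IsMultivectorField P) (J : Fin m → Fin (n + 1)),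
      DifferentiableAt ℝ (fun x => up (P x) J) x ∧
      pderiv i (fun x => up (P x) J) x = up (dfield i P x) J := by
    intro m P hP J
    have hd : ∀ K ∈ Finset.univ, DifferentiableAt ℝ (fun y : Fin n → ℝ =>
        (∏ j, if J j = (K j).succ then (1 : ℝ) else 0) * P y K) x :=
      fun K _ => (hP.diff K x).const_mul _
    simp only [up, mul_comm (P _ _), mul_comm (dfield i P x _)]
    refine ⟨DifferentiableAt.fun_sum hd, ?_⟩
    rw [pderiv_sum hd]
    exact Finset.sum_congr rfl fun K _ => pderiv_const_mul _ (hP.diff K x)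
  simp only [← mul_assoc]
  have hd2 : ∀ p ∈ (Finset.univ : Finset (Fin (k + 1))), DifferentiableAt ℝ (fun y : Fin n → ℝ =>
      ((-1) ^ (p : ℕ) * (if I p = 0 then 1 else 0)) * up (E y) (p.removeNth I)) x :=
    fun p _ => (key hE _).1.const_mul _
  rw [pderiv_add (key hΛ I).1 (DifferentiableAt.fun_sum hd2), (key hΛ I).2, pderiv_sum hd2]
  congr 1
  exact Finset.sum_congr rfl fun p _ => by rw [pderiv_const_mul _ (key hE _).1, (key hE _).2]

/-- The derivative of the bracket tensor along the directions of jet space. -/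
def dbrT {r : ℕ} (Λ : TensorField n (2 * r + 2)) (E : TensorField n (2 * r + 1)) (x : Fin n → ℝ)
    (ν : Fin (n + 1)) : Tensor (n + 1) (2 * r + 2) :=
  Fin.cases (motive := fun _ => Tensor (n + 1) (2 * r + 2))
    (brT (-(2 * r + 1 : ℝ) • Λ x) (-(2 * r : ℝ) • E x))
    (fun i => brT (dfield i Λ x) (dfield i E x)) ν

lemma upZero_smul {k : ℕ} (c : ℝ) (E : Tensor n k) : upZero (c • E) = c • upZero E := by
  ext I
  simp only [upZero, up_smul, Pi.smul_apply, smul_eq_mul, Finset.mul_sum]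
  exact Finset.sum_congr rfl fun p _ => by ring

/-- Homogeneity count: `up L` is supported on multi-indices that avoid `0`, so every one of the `k`
positions is counted. -/
lemma up_mul_card {k : ℕ} (L : Tensor n k) (I : Fin k → Fin (n + 1)) :
    up L I * ∑ s, (if I s = 0 then (0 : ℝ) else 1) = k * up L I := by
  by_cases h : ∃ s, I s = 0
  · obtain ⟨s, hs⟩ := h
    rw [up_eq_zero L I s hs]; simp
  · push Not at h
    simp [h, mul_comm]

lemma upZero_mul_card {k : ℕ} (E : Tensor n k) (I : Fin (k + 1) → Fin (n + 1)) :
    upZero E I * ∑ s, (if I s = 0 then (0 : ℝ) else 1) = k * upZero E I := by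
  rw [upZero, Finset.sum_mul, Finset.mul_sum]
  refine Finset.sum_congr rfl fun p _ => ?_
  have := up_mul_card E (p.removeNth I)
  rw [Fin.sum_univ_succAbove _ p]
  by_cases h : I p = 0
  · simp only [h, if_true, zero_add, one_mul]
    simp only [Fin.removeNth_apply] at this
    rw [mul_assoc]
    exact (congrArg ((-1) ^ (p : ℕ) * ·) this).trans (by ring)
  · simp [h]

lemma ctr_update {k : ℕ} (T : Tensor n k) (v : Fin k → Fin n → ℝ) (s : Fin k) (u : Fin n → ℝ) :
    ctr T (Function.update v s u) = ∑ I, T I * ((∏ j ∈ Finset.univ.erase s, v j (I j)) * u (I s)) := by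
  refine Finset.sum_congr rfl fun I _ => ?_
  rw [← Finset.prod_erase_mul _ _ (Finset.mem_univ s), Function.update_self]
  congr 2
  refine Finset.prod_congr rfl fun j hj => ?_
  rw [Function.update_of_ne (Finset.ne_of_mem_erase hj)]

/-- The product rule for the homogenized bracket. In the direction `0` it is Euler's count: the
Hessian terms give `2r + 2` copies of the `Λ` part and `2r + 1` of the `E` part, and the weights
`-(2r+1)` and `-2r` in `dbrT` reduce both to one. These weights are the derivatives at `t = 1` of
`t^(1-2p)` and `t^(2-2p)` for `p = r + 1`. -/
lemma jet_jacobiBracket {r : ℕ} {Λ : TensorField n (2 * r + 2)} {E : TensorField n (2 * r + 1)}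
    (hΛ : IsMultivectorField Λ) (hE : IsMultivectorField E)
    {g : Fin (2 * r + 2) → (Fin n → ℝ) → ℝ}
    (hg : ∀ i, ContDiff ℝ ((⊤ : ℕ∞) : WithTop ℕ∞) (g i)) (x : Fin n → ℝ) (ν : Fin (n + 1)) :
    jet (jacobiBracket Λ E g) x ν = ctr (dbrT Λ E x ν) (fun j => jet (g j) x) +
      ∑ s, ctr (brT (Λ x) (E x))
        (Function.update (fun j => jet (g j) x) s (hess (g s) x ν)) := by
  have hJ : jacobiBracket Λ E g = fun x => ctr (brT (Λ x) (E x)) fun j => jet (g j) x :=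
    funext fun x => jacobiBracket_eq Λ E g x
  simp only [ctr_update]
  rw [Finset.sum_comm, hJ, ctr, ← Finset.sum_add_distrib]
  refine Fin.cases ?_ (fun i => ?_) ν
  · rw [jet_zero, ctr]
    refine Finset.sum_congr rfl fun I _ => ?_
    have h1 : ∀ s, hess (g s) x 0 (I s) = (if I s = 0 then 0 else 1) * jet (g s) x (I s) := by
      intro s
      generalize I s = μ
      refine Fin.cases ?_ (fun j => ?_) μ <;> simp [Fin.succ_ne_zero]
    have h2 : ∀ s, (∏ j ∈ Finset.univ.erase s, jet (g j) x (I j)) * hess (g s) x 0 (I s) =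
        (if I s = 0 then 0 else 1) * ∏ j, jet (g j) x (I j) := by
      intro s
      rw [h1, ← Finset.prod_erase_mul _ _ (Finset.mem_univ s)]
      ring
    have h3 := up_mul_card (Λ x) I
    have h4 := upZero_mul_card (E x) I
    simp only [h2, ← Finset.mul_sum, ← Finset.sum_mul]
    simp only [dbrT, Fin.cases_zero, brT, Pi.add_apply, up_smul, upZero_smul, Pi.smul_apply,
      smul_eq_mul]
    push_cast at h3 h4
    linear_combination (-(∏ j, jet (g j) x (I j))) * (h3 + h4)
  · rw [jet_succ]
    have hB : ∀ I, DifferentiableAt ℝ (fun y => brT (Λ y) (E y) I) x :=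
      fun I => (contDiff_brT hΛ hE I).differentiable (by simp) x
    have hj : ∀ j ν, DifferentiableAt ℝ (fun y => jet (g j) y ν) x :=
      fun j ν => (contDiff_jet (hg j) ν).differentiable (by simp) x
    have hp : ∀ I : Fin (2 * r + 2) → Fin (n + 1),
        DifferentiableAt ℝ (fun y => ∏ j, jet (g j) y (I j)) x :=
      fun I => by fun_prop (disch := exact hj _ _)
    simp only [ctr]
    rw [pderiv_sum fun I _ => (hB I).fun_mul (hp I)]
    refine Finset.sum_congr rfl fun I _ => ?_
    rw [pderiv_mul (hB I) (hp I), pderiv_brT hΛ hE, pderiv_prod fun j _ => hj j _]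
    simp only [pderiv_jet, Finset.mul_sum]
    rfl

end JacobiIdentity

/-! ### Cancellation of second derivatives and reduction to two bracket conditions. -/

section JacobiIdentity

variable {n : ℕ}

/-- Moving the entry at position `p` to the front is a cycle of sign `(-1)^p`. -/
lemma Skew.insertNth {k : ℕ} {T : Tensor n (k + 1)} (h : Skew T) (p : Fin (k + 1)) (a : Fin n)
    (I : Fin k → Fin n) :
    T (p.insertNth (α := fun _ => Fin n) a I) = (-1) ^ (p : ℕ) * T (Fin.cons a I) := by
  have h1 := h p.cycleRange.symm (p.insertNth (α := fun _ => Fin n) a I)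
  have h2 := Fin.insertNth_comp_cycleRange_symm p a I
  rw [h2, Equiv.Perm.sign_symm, Fin.sign_cycleRange] at h1
  rw [h1, ← mul_assoc]
  push_cast
  rw [← pow_add, Even.neg_one_pow ⟨_, rfl⟩, one_mul]

lemma Skew.snoc {k : ℕ} {T : Tensor n (k + 1)} (h : Skew T) (a : Fin n) (I : Fin k → Fin n) :
    T (Fin.snoc (α := fun _ => Fin n) I a) = (-1) ^ k * T (Fin.cons a I) := by
  rw [← Fin.insertNth_last', h.insertNth]
  simp

/-- The transposition of two blocks of `k` indices, where the second block omits the index `s`. -/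
lemma exists_blockSwap (k : ℕ) (s : Fin (k + 1)) : ∃ τ : Equiv.Perm (Fin (k + (k + 1))),
    Equiv.Perm.sign τ = (-1) ^ k ∧ τ (Fin.natAdd k s) = Fin.natAdd k s ∧
    (∀ i, τ (Fin.castAdd (k + 1) i) = Fin.natAdd k (s.succAbove i)) ∧
    ∀ i, τ (Fin.natAdd k (s.succAbove i)) = Fin.castAdd (k + 1) i := by
  let φ : Option (Fin k × Bool) → Fin (k + (k + 1)) := fun o => match o with
    | none => Fin.natAdd k s
    | some (i, false) => Fin.castAdd (k + 1) i
    | some (i, true) => Fin.natAdd k (s.succAbove i)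
  have hφ : Function.Bijective φ := by
    rw [Fintype.bijective_iff_injective_and_card]
    refine ⟨?_, by simp; ring⟩
    have h0 : ∀ (i : Fin k) (j : Fin (k + 1)), Fin.castAdd (k + 1) i ≠ Fin.natAdd k j := by
      intro i j h
      have := congrArg Fin.val h
      simp at this
      omega
    rintro (_ | ⟨i, _ | _⟩) (_ | ⟨j, _ | _⟩) h
    · rfl
    · exact absurd h.symm (h0 _ _)
    · exact absurd (Fin.natAdd_injective _ _ h) (Fin.ne_succAbove _ _)
    · exact absurd h (h0 _ _)
    · rw [Fin.castAdd_injective _ _ h]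
    · exact absurd h (h0 _ _)
    · exact absurd (Fin.natAdd_injective _ _ h) (Fin.succAbove_ne _ _)
    · exact absurd h.symm (h0 _ _)
    · rw [Fin.succAbove_right_injective (Fin.natAdd_injective _ _ h)]
  let e := Equiv.ofBijective φ hφ
  let ρ : Equiv.Perm (Fin k × Bool) := Equiv.prodCongrRight fun _ => Equiv.swap false true
  refine ⟨e.permCongr (Equiv.optionCongr ρ), ?_, ?_, fun i => ?_, fun i => ?_⟩
  · rw [Equiv.Perm.sign_permCongr, Equiv.optionCongr_sign, Equiv.Perm.sign_prodCongrRight]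
    simp
  · have : Fin.natAdd k s = e none := rfl
    rw [Equiv.permCongr_apply, this]; simp
  · have h1 : Fin.castAdd (k + 1) i = e (some (i, false)) := rfl
    have h2 : Fin.natAdd k (s.succAbove i) = e (some (i, true)) := rfl
    rw [Equiv.permCongr_apply, h1, h2]; simp [ρ]
  · have h1 : Fin.castAdd (k + 1) i = e (some (i, false)) := rfl
    have h2 : Fin.natAdd k (s.succAbove i) = e (some (i, true)) := rfl
    rw [Equiv.permCongr_apply, h1, h2]; simp [ρ]

/-- The terms with second derivatives cancel in the generalized Jacobi identity. -/
lemma sum_second_derivatives_eq_zero {k : ℕ} (hk : Odd k) {B : Tensor n (k + 1)} (hB : Skew B)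
    (v : Fin (k + (k + 1)) → Fin n → ℝ) (H : Fin (k + (k + 1)) → Fin n → Fin n → ℝ)
    (hH : ∀ i ν μ, H i ν μ = H i μ ν) (s : Fin (k + 1)) :
    ∑ σ : Equiv.Perm (Fin (k + (k + 1))), ((Equiv.Perm.sign σ : ℤ) : ℝ) *
      ∑ ν, ctr (fun I => B (Fin.cons ν I)) (fun i => v (σ (Fin.castAdd (k + 1) i))) *
        ctr B (Function.update (fun j => v (σ (Fin.natAdd k j))) s (H (σ (Fin.natAdd k s)) ν)) = 0 := by
  have h1 : ∀ (w : Fin (k + 1) → Fin n → ℝ) (u : Fin n → ℝ), ctr B (Function.update w s u) =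
      (-1) ^ (s : ℕ) * ∑ μ, u μ * ctr (fun I => B (Fin.cons μ I)) (fun i => w (s.succAbove i)) := by
    intro w u
    rw [ctr, ← (Fin.insertNthEquiv (fun _ => Fin n) s).sum_comp, Fintype.sum_prod_type,
      Finset.mul_sum]
    refine Finset.sum_congr rfl fun μ _ => ?_
    rw [ctr, Finset.mul_sum, Finset.mul_sum]
    refine Finset.sum_congr rfl fun I _ => ?_
    have hI : B (Fin.insertNthEquiv (fun _ => Fin n) s (μ, I)) = _ := hB.insertNth s μ I
    rw [hI]
    simp only [Fin.insertNthEquiv_apply, Fin.prod_univ_succAbove _ s,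
      Function.update_self, Fin.insertNth_apply_same, Fin.insertNth_apply_succAbove]
    simp only [ne_eq, Fin.succAbove_ne, not_false_eq_true, Function.update_of_ne]
    ring
  set c : Fin n → (Fin k → Fin n → ℝ) → ℝ := fun ν w => ctr (fun I => B (Fin.cons ν I)) w
  set Q : Equiv.Perm (Fin (k + (k + 1))) → ℝ := fun σ =>
    ∑ ν, c ν (fun i => v (σ (Fin.castAdd (k + 1) i))) *
      ∑ μ, H (σ (Fin.natAdd k s)) ν μ * c μ (fun i => v (σ (Fin.natAdd k (s.succAbove i)))) with hQ
  have h2 : ∀ σ : Equiv.Perm (Fin (k + (k + 1))),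
      ∑ ν, ctr (fun I => B (Fin.cons ν I)) (fun i => v (σ (Fin.castAdd (k + 1) i))) *
        ctr B (Function.update (fun j => v (σ (Fin.natAdd k j))) s (H (σ (Fin.natAdd k s)) ν)) =
      (-1) ^ (s : ℕ) * Q σ := by
    intro σ
    rw [hQ, Finset.mul_sum]
    refine Finset.sum_congr rfl fun ν _ => ?_
    rw [h1]
    ring
  obtain ⟨τ, hs, ht1, ht2, ht3⟩ := exists_blockSwap k s
  have h3 : ∀ σ : Equiv.Perm (Fin (k + (k + 1))), Q (σ * τ) = Q σ := by
    intro σ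
    simp only [hQ, Equiv.Perm.mul_apply, ht1, ht2, ht3, Finset.mul_sum]
    rw [Finset.sum_comm]
    refine Finset.sum_congr rfl fun ν _ => Finset.sum_congr rfl fun μ _ => ?_
    rw [hH _ μ ν]
    ring
  -- The block exchange has sign `(-1)^k = -1`, while by symmetry of the Hessian it fixes `Q`; the
  -- signed sum therefore equals its own negative.
  have h4 : ∑ σ : Equiv.Perm (Fin (k + (k + 1))), ((Equiv.Perm.sign σ : ℤ) : ℝ) * Q σ =
      -∑ σ : Equiv.Perm (Fin (k + (k + 1))), ((Equiv.Perm.sign σ : ℤ) : ℝ) * Q σ := by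
    conv_lhs => rw [← Equiv.sum_comp (Equiv.mulRight τ)]
    rw [← Finset.sum_neg_distrib]
    refine Finset.sum_congr rfl fun σ _ => ?_
    rw [Equiv.coe_mulRight, h3, map_mul, hs, hk.neg_one_pow]
    simp
  simp only [h2, mul_left_comm _ ((-1 : ℝ) ^ (s : ℕ)), ← Finset.mul_sum]
  rw [show ∑ σ : Equiv.Perm (Fin (k + (k + 1))), ((Equiv.Perm.sign σ : ℤ) : ℝ) * Q σ = 0 by
    linarith, mul_zero]

lemma ctr_sum {ι : Type*} {k : ℕ} (s : Finset ι) (T : ι → Tensor n k) (v : Fin k → Fin n → ℝ) :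
    ctr (∑ i ∈ s, T i) v = ∑ i ∈ s, ctr (T i) v := by
  simp only [ctr, Finset.sum_apply, Finset.sum_mul]
  exact Finset.sum_comm

lemma ctr_mul {a b : ℕ} (T : Tensor n a) (S : Tensor n b) (v : Fin (a + b) → Fin n → ℝ) :
    ctr (fun K : Fin (a + b) → Fin n => T (K ∘ Fin.castAdd b) * S (K ∘ Fin.natAdd a)) v =
      ctr T (fun i => v (Fin.castAdd b i)) * ctr S (fun j => v (Fin.natAdd a j)) := by
  simp only [ctr]
  rw [Finset.sum_mul_sum, ← Fintype.sum_prod_type', ← (Fin.appendEquiv a b).sum_comp]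
  refine Finset.sum_congr rfl fun p _ => ?_
  have h3 : Fin.appendEquiv a b p ∘ Fin.castAdd b = p.1 := by
    funext i; simp [Fin.appendEquiv]
  have h4 : Fin.appendEquiv a b p ∘ Fin.natAdd a = p.2 := by
    funext i; simp [Fin.appendEquiv]
  simp only [h3, h4]
  rw [Fin.prod_univ_add, ← h3, ← h4]
  simp only [Function.comp]
  ring

/-- The last slot passes an odd number `k` of slots on its way to the front, whence the minus sign.
-/
lemma ctr_brT_snoc {k : ℕ} (hk : Odd k) {B : Tensor n (k + 1)} (hB : Skew B)
    (v : Fin k → Fin n → ℝ) (u : Fin n → ℝ) :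
    ctr B (Fin.snoc (α := fun _ => Fin n → ℝ) v u) =
      -∑ ν, u ν * ctr (fun I => B (Fin.cons ν I)) v := by
  rw [ctr, ← (Fin.snocEquiv (fun _ => Fin n)).sum_comp, Fintype.sum_prod_type,
    ← Finset.sum_neg_distrib]
  refine Finset.sum_congr rfl fun μ _ => ?_
  rw [ctr, Finset.mul_sum, ← Finset.sum_neg_distrib]
  refine Finset.sum_congr rfl fun I _ => ?_
  have hI : B (Fin.snocEquiv (fun _ => Fin n) (μ, I)) = _ := hB.snoc μ I
  rw [hI, hk.neg_one_pow]
  simp only [Fin.snocEquiv_apply, Fin.prod_univ_castSucc, Fin.snoc_castSucc, Fin.snoc_last]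
  ring

/-- Two conditions on the components which imply the generalized Jacobi identity. -/
theorem isGenJacobi_of_conditions {r : ℕ} {Λ : TensorField n (2 * r + 2)}
    {E : TensorField n (2 * r + 1)} (hΛ : IsMultivectorField Λ) (hE : IsMultivectorField E)
    (h1 : ∀ x, ∑ i, con i (nel (Λ x)) * nel (dfield i Λ x) =
      (2 * r + 1 : ℝ) • (nel (E x) * nel (Λ x)))
    (h2 : ∀ x, nel (schouten E Λ x) = 0) : IsGenJacobi Λ E := by
  refine ⟨hΛ, hE, fun f hf x => ?_⟩
  have hk : Odd (2 * r + 1) := odd_two_mul_add_one r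
  set B := brT (Λ x) (E x) with hBdef
  have hB : Skew B := skew_brT (hΛ.skew x) (hE.skew x)
  set v : Fin (2 * r + 1 + (2 * r + 1 + 1)) → Fin (n + 1) → ℝ := fun i => jet (f i) x with hv
  set H : Fin (2 * r + 1 + (2 * r + 1 + 1)) → Fin (n + 1) → Fin (n + 1) → ℝ :=
    fun i => hess (f i) x with hH
  set T : Tensor (n + 1) (2 * r + 1 + (2 * r + 1 + 1)) := ∑ ν, fun K =>
    B (Fin.cons ν (K ∘ Fin.castAdd (2 * r + 1 + 1))) *
      dbrT Λ E x ν (K ∘ Fin.natAdd (2 * r + 1)) with hT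
  -- `T` collects the terms without second derivatives. Its skew-symmetrization is, up to a factor,
  -- the self-bracket of the homogenized multivector at `t = 1`.
  have hTz : antisym T = 0 := by
    refine alt_eq_zero_of_el ?_
    have h3 : ∀ ν, el (fun K : Fin (2 * r + 1 + (2 * r + 1 + 1)) → Fin (n + 1) =>
        B (Fin.cons ν (K ∘ Fin.castAdd (2 * r + 1 + 1))) *
          dbrT Λ E x ν (K ∘ Fin.natAdd (2 * r + 1))) =
        el (fun I => B (Fin.cons ν I)) * el (dbrT Λ E x ν) :=
      fun ν => el_mul rfl (fun I => B (Fin.cons ν I)) (dbrT Λ E x ν) _ _ (by simp) (by simp)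
    rw [hT, el_sum]
    simp only [h3]
    suffices h : ∑ ν, con ν (nel B) * nel (dbrT Λ E x ν) = 0 by
      simp only [con_nel hB] at h
      simp only [nel, smul_mul_smul_comm, ← Finset.smul_sum] at h
      refine (smul_eq_zero.1 h).resolve_left (mul_ne_zero ?_ ?_) <;>
        exact one_div_ne_zero (by exact_mod_cast Nat.factorial_ne_zero _)
    have he : Od (nel (E x)) := od_nel hk _
    have hw : Ev (nel (Λ x)) := ev_nel ⟨r + 1, by ring⟩ _
    have heo : Od (shift (nel (E x))) := he.shift
    have ht : ((th 0 * th 0 : Ext ℝ (n + 1))) = 0 := th_mul_self 0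
    rw [Fin.sum_univ_succ, hBdef, nel_brT _ (hE.skew x)]
    have h0 : con 0 (shift (nel (Λ x)) + th 0 * shift (nel (E x))) = shift (nel (E x)) := by
      rw [map_add, con_zero_shift, con_th_mul, con_zero_shift]; simp
    have hs : ∀ i : Fin n, con i.succ (shift (nel (Λ x)) + th 0 * shift (nel (E x))) =
        shift (con i (nel (Λ x))) - th 0 * shift (con i (nel (E x))) := by
      intro i
      rw [map_add, con_succ_shift, con_th_mul, con_succ_shift]
      simp [Fin.succ_ne_zero, sub_eq_add_neg]
    have hd0 : nel (dbrT Λ E x 0) = (-(2 * r + 1 : ℝ)) • shift (nel (Λ x)) +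
        (-(2 * r : ℝ)) • (th 0 * shift (nel (E x))) := by
      rw [dbrT, Fin.cases_zero, nel_brT _ (Skew.smul (hE.skew x) _), nel_smul, nel_smul, map_smul,
        map_smul, mul_smul_comm]
    have hds : ∀ i : Fin n, nel (dbrT Λ E x i.succ) =
        shift (nel (dfield i Λ x)) + th 0 * shift (nel (dfield i E x)) := by
      intro i
      rw [dbrT, Fin.cases_succ, nel_brT _ (hE.skew_dfield i x)]
    -- The part without `th 0` is the sum for `[Λ, Λ]`, governed by `h1`; the part with `th 0` is
    -- the integrand of `[E, Λ]`, governed by `h2`. The direction `0` contributes `-(2r+1) E ∧ Λ`,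
    -- which cancels the right-hand side of `h1`.
    have key : ∀ i : Fin n,
        (shift (con i (nel (Λ x))) - th 0 * shift (con i (nel (E x)))) *
          (shift (nel (dfield i Λ x)) + th 0 * shift (nel (dfield i E x))) =
        shift (con i (nel (Λ x)) * nel (dfield i Λ x)) - th 0 * shift
          (con i (nel (E x)) * nel (dfield i Λ x) - nel (dfield i E x) * con i (nel (Λ x))) := by
      intro i
      have a1 : shift (con i (nel (Λ x))) * (th 0 * shift (nel (dfield i E x))) =
          th 0 * shift (nel (dfield i E x) * con i (nel (Λ x))) := by
        have o1 : Od (shift (con i (nel (Λ x)))) := (hw.con i).shift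
        have o2 : Od (shift (nel (dfield i E x))) := (od_nel hk _).shift
        rw [((od_th 0).mul o2).comm _ |>.symm, map_mul, mul_assoc]
      have a2 : th 0 * shift (con i (nel (E x))) * (th 0 * shift (nel (dfield i E x))) = 0 := by
        rw [mul_assoc, ((he.con i).shift).comm, ← mul_assoc, ← mul_assoc, ht, zero_mul, zero_mul]
      rw [sub_mul, mul_add, mul_add, a1, a2, mul_assoc, ← map_mul, ← map_mul, map_sub, mul_sub]
      abel
    have h2' := h2 x
    rw [nel_schouten_odd_even hΛ hE] at h2'
    simp only [h0, hs, hd0, hds, key]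
    rw [Finset.sum_sub_distrib, ← Finset.mul_sum, ← map_sum, ← map_sum, h2', h1, map_zero,
      mul_zero, sub_zero, map_smul, map_mul, mul_add, mul_smul_comm, mul_smul_comm, ← mul_assoc,
      heo.anticomm (od_th 0), neg_mul, mul_assoc, heo.mul_self]
    simp only [mul_zero, neg_zero, smul_zero, add_zero]
    module
  have hbr : ∀ σ : Equiv.Perm (Fin (2 * r + 1 + (2 * r + 2))),
      jacobiBracket Λ E (Fin.snoc (fun i : Fin (2 * r + 1) => f (σ (Fin.castAdd (2 * r + 2) i)))
        (jacobiBracket Λ E (fun j : Fin (2 * r + 2) => f (σ (Fin.natAdd (2 * r + 1) j))))) x =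
      -(ctr T (v ∘ σ) + ∑ s, ∑ ν, ctr (fun I => B (Fin.cons ν I))
        (fun i => v (σ (Fin.castAdd (2 * r + 1 + 1) i))) *
        ctr B (Function.update (fun j => v (σ (Fin.natAdd (2 * r + 1) j))) s
          (H (σ (Fin.natAdd (2 * r + 1) s)) ν))) := by
    intro σ
    rw [jacobiBracket_eq]
    have hsn : (fun j => jet ((Fin.snoc (α := fun _ => (Fin n → ℝ) → ℝ)
        (fun i : Fin (2 * r + 1) => f (σ (Fin.castAdd (2 * r + 2) i)))
        (jacobiBracket Λ E (fun j : Fin (2 * r + 2) => f (σ (Fin.natAdd (2 * r + 1) j)))) :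
          Fin (2 * r + 1 + 1) → _) j) x) =
        Fin.snoc (α := fun _ => Fin (n + 1) → ℝ) (fun i => v (σ (Fin.castAdd (2 * r + 1 + 1) i)))
          (jet (jacobiBracket Λ E (fun j : Fin (2 * r + 2) => f (σ (Fin.natAdd (2 * r + 1) j)))) x) := by
      funext j
      refine Fin.lastCases ?_ (fun i => ?_) j
      · simp
      · simp [hv]
    rw [hsn, ctr_brT_snoc hk hB]
    simp only [jet_jacobiBracket hΛ hE (fun j => hf _)]
    congr 1
    rw [hT, ctr_sum, Finset.sum_comm, ← Finset.sum_add_distrib]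
    refine Finset.sum_congr rfl fun ν _ => ?_
    rw [ctr_mul (fun I => B (Fin.cons ν I)) (dbrT Λ E x ν), ← Finset.mul_sum]
    exact (mul_comm _ _).trans (mul_add _ _ _)
  simp only [hbr, mul_neg, mul_add, Finset.sum_neg_distrib, Finset.sum_add_distrib]
  have hfirst := sum_sign_ctr T v
  rw [hTz, show ctr (0 : Tensor (n + 1) (2 * r + 1 + (2 * r + 1 + 1))) v = 0 by simp [ctr]] at hfirst
  have hsecond : ∑ σ : Equiv.Perm (Fin (2 * r + 1 + (2 * r + 1 + 1))),
      ((Equiv.Perm.sign σ : ℤ) : ℝ) * ∑ s, ∑ ν, ctr (fun I => B (Fin.cons ν I))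
        (fun i => v (σ (Fin.castAdd (2 * r + 1 + 1) i))) *
        ctr B (Function.update (fun j => v (σ (Fin.natAdd (2 * r + 1) j))) s
          (H (σ (Fin.natAdd (2 * r + 1) s)) ν)) = 0 := by
    simp only [Finset.mul_sum _ _ ((Equiv.Perm.sign _ : ℤ) : ℝ)]
    rw [Finset.sum_comm]
    refine Finset.sum_eq_zero fun s _ => ?_
    have := sum_second_derivatives_eq_zero hk hB v H (fun i ν μ => hess_symm (hf i) x ν μ) s
    simpa only [Finset.mul_sum _ _ ((Equiv.Perm.sign _ : ℤ) : ℝ)] using this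
  rw [neg_eq_zero]
  exact (congrArg₂ (· + ·) hfirst hsecond).trans (add_zero 0)

end JacobiIdentity

/-! ### Linear generalized Jacobi structures -/

section Linear

variable {n r : ℕ} {ω : (Fin (2 * r + 2) → Fin n) → Fin n → ℝ}

/-- Of the two conditions in `isGenJacobi_of_conditions`, one is the hypothesis. The other is
`sum_con_mul_dilatation`, where linearity of `Ω` enters as `∑ x_i ∂_i Ω = Ω`. -/
theorem isGenJacobi_of_schouten_eq_zero (hΩ : IsGenPoisson (linearField ω))
    {E : TensorField n (2 * r + 1)} (hE : IsMultivectorField E)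
    (h : schouten E (linearField ω + wedge E (dilatation n)) = 0) :
    IsGenJacobi (linearField ω + wedge E (dilatation n)) E := by
  obtain ⟨hω, hs⟩ := hΩ
  have hA := isMultivectorField_dilatation (n := n)
  have hW := hE.wedge hA
  refine isGenJacobi_of_conditions (hω.add hW) hE (fun x => ?_) (schouten_eq_zero_iff.1 h)
  have h0 := schouten_eq_zero_iff.1 h x
  rw [nel_schouten_add_wedge hω hE, nel_schouten_odd_even hω hE, nel_schouten_dilatation hE,
    Finset.mul_sum, ← Finset.sum_add_distrib] at h0
  have hd : ∀ i, nel (dfield i (linearField ω + wedge E (dilatation n)) x) =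
      nel (dfield i (linearField ω) x) +
        (nel (dfield i E x) * (∑ j, x j • th j) + nel (E x) * th i) := by
    intro i
    rw [dfield_add hω hW, nel_add, nel_dfield_wedge hE hA, nel_dilatation, nel_dfield_dilatation]
  have hn : nel ((linearField ω + wedge E (dilatation n)) x) =
      nel (linearField ω x) + nel (E x) * ∑ j, x j • th j := by
    rw [Pi.add_apply, nel_add, nel_wedge, nel_dilatation]
  simp only [hd, hn]
  refine sum_con_mul_dilatation (od_nel (odd_two_mul_add_one r) _)
    (fun i => od_nel (odd_two_mul_add_one r) _) (ev_nel ⟨r + 1, by ring⟩ _)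
    (fun i => ev_nel ⟨r + 1, by ring⟩ _) ?_ ?_ ?_
    (sum_con_mul_eq_zero_of_schouten_self hω hs x) h0
  · conv_rhs => rw [linearField_eq, nel_sum]
    simp only [nel_smul]
  · rw [euler_nel (hω.skew x)]
    push_cast
    rfl
  · rw [euler_nel (hE.skew x)]
    push_cast
    rfl

variable {ξ : Tensor n (2 * r + 1)}

/-- For constant `E`, Euler's formula gives `[E, A] = (2p - 1) E`, so `E ∧ [E, A]` is a multiple of
the square of an odd element and disappears. -/
lemma nel_schouten_constField_add_wedge (hω : IsMultivectorField (linearField ω)) (hξ : Skew ξ)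
    (x : Fin n → ℝ) : nel (schouten (constField ξ)
      (linearField ω + wedge (constField ξ) (dilatation n)) x) =
      ∑ i, con i (nel ξ) * nel fun I => ω I i := by
  have hE := isMultivectorField_constField hξ
  have he : Od (nel ξ) := od_nel (odd_two_mul_add_one r) _
  rw [nel_schouten_add_wedge hω hE, nel_schouten_dilatation hE, nel_schouten_odd_even hω hE]
  simp only [dfield_constField, nel_zero, smul_zero, sub_zero, zero_mul, dfield_linearField]
  have h1 : ∑ i, con i (nel ξ) * th i = ((2 * r : ℕ) + 1 : ℝ) • nel ξ := by
    rw [← euler_nel hξ]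
    exact Finset.sum_congr rfl fun i _ => (he.con i).comm _
  simp only [constField]
  rw [h1, mul_smul_comm, he.mul_self, smul_zero, add_zero]

lemma schouten_constField_iff_antisym (hω : IsMultivectorField (linearField ω)) (hξ : Skew ξ) :
    schouten (constField ξ) (linearField ω + wedge (constField ξ) (dilatation n)) = 0 ↔
      antisym (fun J : Fin (2 * r + (2 * r + 2)) → Fin n => ∑ ν : Fin n,
        ξ (Fin.cons ν (fun i : Fin (2 * r) => J (Fin.castAdd (2 * r + 2) i))) *
          ω (fun j => J (Fin.natAdd (2 * r) j)) ν) = 0 := by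
  rw [schouten_eq_zero_iff]
  simp only [nel_schouten_constField_add_wedge hω hξ, forall_const]
  rw [antisym_eq_alt, alt_eq_zero_iff]
  have h1 : (fun J : Fin (2 * r + (2 * r + 2)) → Fin n => ∑ ν : Fin n,
        ξ (Fin.cons ν (fun i : Fin (2 * r) => J (Fin.castAdd (2 * r + 2) i))) *
          ω (fun j => J (Fin.natAdd (2 * r) j)) ν) =
      ∑ ν, fun J => ξ (Fin.cons ν (J ∘ Fin.castAdd (2 * r + 2))) *
        ω (J ∘ Fin.natAdd (2 * r)) ν := by
    ext J
    simp only [Finset.sum_apply]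
    rfl
  have h2 : ∀ ν, el (fun J : Fin (2 * r + (2 * r + 2)) → Fin n =>
      ξ (Fin.cons ν (J ∘ Fin.castAdd (2 * r + 2))) * ω (J ∘ Fin.natAdd (2 * r)) ν) =
      el (fun I => ξ (Fin.cons ν I)) * el (fun I => ω I ν) :=
    fun ν => el_mul rfl (fun I => ξ (Fin.cons ν I)) (fun I => ω I ν) _ _ (by simp) (by simp)
  rw [h1, el_sum]
  simp only [con_nel hξ, h2]
  simp only [nel, smul_mul_smul_comm, ← Finset.smul_sum]
  refine ⟨fun h => (smul_eq_zero.1 h).resolve_left (mul_ne_zero ?_ ?_), fun h => by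
    rw [h, smul_zero]⟩ <;> exact one_div_ne_zero (by exact_mod_cast Nat.factorial_ne_zero _)

/-- The half of the bracket that differentiates the constant field drops out; the other half has
sign `+1` because `Ω` has even degree. The result is the expression found for `[E, Ω + E ∧ A]`. -/
lemma nel_poissonCoboundary_constField {q : ℕ} {ξ : Tensor n (q + 1)}
    (hω : IsMultivectorField (linearField ω)) (hξ : Skew ξ) (x : Fin n → ℝ) :
    nel (poissonCoboundary (linearField ω) (constField ξ) x) =
      ∑ i, con i (nel ξ) * nel fun I => ω I i := by
  have hE := isMultivectorField_constField hξ
  rw [poissonCoboundary, nel_schouten x (hω.skew x) (hE.skew x)]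
  have h1 : (-1 : ℝ) ^ (2 * r + 1 + 1) = 1 := by rw [add_assoc, Even.neg_one_pow ⟨r + 1, by ring⟩]
  simp only [dfield_constField, nel_zero, mul_zero, Finset.sum_const_zero, zero_add, h1, one_smul,
    dfield_linearField, constField]
  exact Finset.sum_congr rfl fun i _ => (ev_nel ⟨r + 1, by ring⟩ _).comm _

lemma poissonCoboundary_constField_eq_zero_iff {q : ℕ} {ξ : Tensor n (q + 1)}
    (hω : IsMultivectorField (linearField ω)) (hξ : Skew ξ) :
    poissonCoboundary (linearField ω) (constField ξ) = 0 ↔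
      ∑ i, con i (nel ξ) * nel (fun I => ω I i) = 0 := by
  have h := schouten_eq_zero_iff (P := linearField ω) (Q := constField ξ)
  rw [poissonCoboundary, h]
  have h2 := nel_poissonCoboundary_constField hω hξ
  unfold poissonCoboundary at h2
  simp only [h2, forall_const]

lemma schouten_constField_iff_poissonCoboundary (hω : IsMultivectorField (linearField ω))
    (hξ : Skew ξ) :
    schouten (constField ξ) (linearField ω + wedge (constField ξ) (dilatation n)) = 0 ↔
      poissonCoboundary (linearField ω) (constField ξ) = 0 := by
  rw [poissonCoboundary_constField_eq_zero_iff hω hξ, schouten_eq_zero_iff]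
  simp only [nel_schouten_constField_add_wedge hω hξ, forall_const]

theorem isGenJacobi_of_poissonCoboundary (hΩ : IsGenPoisson (linearField ω)) (hξ : Skew ξ)
    (h : poissonCoboundary (linearField ω) (constField ξ) = 0) :
    IsGenJacobi (linearField ω + wedge (constField ξ) (dilatation n)) (constField ξ) :=
  isGenJacobi_of_schouten_eq_zero hΩ (isMultivectorField_constField hξ)
    ((schouten_constField_iff_poissonCoboundary hΩ.1 hξ).2 h)

theorem linear_structures (n r : ℕ)
    (hr : 2 * r + 1 + (2 * r + 0 + 1) = 2 * r + (2 * r + 1) + 1)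
    (ω : (Fin (2 * r + 2) → Fin n) → Fin n → ℝ)
    (hΩ : IsGenPoisson (linearField ω)) :
      (∀ E : TensorField n (2 * r + 1), IsMultivectorField E →
        (schouten E (linearField ω + wedge E (dilatation n)) = 0 ↔
          ∀ x K, schouten E (linearField ω) x K = -wedge E (schouten E (dilatation n)) x
              (fun i => K (Fin.cast hr i))) ∧
        (schouten E (linearField ω + wedge E (dilatation n)) = 0 →
          IsGenJacobi (linearField ω + wedge E (dilatation n)) E)) ∧
      (∀ ξ : Tensor n (2 * r + 1), IsSkew ξ →
        (schouten (constField ξ) (linearField ω + wedge (constField ξ) (dilatation n)) = 0 ↔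
          antisym (fun J : Fin (2 * r + (2 * r + 2)) → Fin n => ∑ ν : Fin n,
            ξ (Fin.cons ν (fun i : Fin (2 * r) => J (Fin.castAdd (2 * r + 2) i))) *
              ω (fun j => J (Fin.natAdd (2 * r) j)) ν) = 0) ∧
        (schouten (constField ξ) (linearField ω + wedge (constField ξ) (dilatation n)) = 0 ↔
          poissonCoboundary (linearField ω) (constField ξ) = 0)) :=
  ⟨fun _ hE => ⟨schouten_add_wedge_eq_zero_iff hr hΩ.1 hE, isGenJacobi_of_schouten_eq_zero hΩ hE⟩,
    fun _ hξ => ⟨schouten_constField_iff_antisym hΩ.1 hξ,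
      schouten_constField_iff_poissonCoboundary hΩ.1 hξ⟩⟩

end Linear

/-! ### Invariant forms: the Lie derivative and the Chevalley-Eilenberg differential -/

section Sums

variable {ι M : Type*} [Fintype ι] [AddCommMonoid M]

lemma sum_cycle₃ (f : ι → ι → ι → M) :
    ∑ a, ∑ b, ∑ c, f a b c = ∑ c, ∑ a, ∑ b, f a b c := by
  rw [Finset.sum_comm (f := fun c a => ∑ b, f a b c)]
  exact Finset.sum_congr rfl fun a _ => Finset.sum_comm

lemma sum_reverse₃ (f : ι → ι → ι → M) :
    ∑ a, ∑ b, ∑ c, f a b c = ∑ c, ∑ b, ∑ a, f a b c := by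
  rw [sum_cycle₃]
  exact Finset.sum_congr rfl fun a _ => Finset.sum_comm

lemma sum_cycle₄ (f : ι → ι → ι → ι → M) :
    ∑ a, ∑ b, ∑ c, ∑ d, f a b c d = ∑ d, ∑ a, ∑ b, ∑ c, f a b c d := by
  rw [Finset.sum_comm (f := fun d a => ∑ b, ∑ c, f a b c d)]
  exact Finset.sum_congr rfl fun a _ => sum_cycle₃ _

end Sums

/-! ### Coadjoint action, Chevalley-Eilenberg operator and the Casimir argument. -/

section Invariant

variable {n : ℕ} (C : Fin n → Fin n → Fin n → ℝ)

/-- The coadjoint action of the `c`-th basis vector on the exterior algebra. -/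
def lieDer (c : Fin n) : Ext ℝ n →ₗ[ℝ] Ext ℝ n :=
  ∑ j, ∑ k, C c j k • (LinearMap.mulLeft ℝ (th j)).comp (con k)

/-- A multiple of the Chevalley-Eilenberg differential on the exterior algebra. -/
def ceD : Ext ℝ n →ₗ[ℝ] Ext ℝ n := ∑ c, (LinearMap.mulLeft ℝ (th c)).comp (lieDer C c)

lemma lieDer_apply (c : Fin n) (x : Ext ℝ n) :
    lieDer C c x = ∑ j, ∑ k, C c j k • (th j * con k x) := by
  simp [lieDer, LinearMap.sum_apply]

lemma ceD_apply (x : Ext ℝ n) : ceD C x = ∑ c, th c * lieDer C c x := by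
  simp [ceD, LinearMap.sum_apply]

/-- `lieDer` is an even derivation: the sign from `con` is undone when `th j` moves past the first
factor. -/
lemma lieDer_mul (c : Fin n) (x y : Ext ℝ n) :
    lieDer C c (x * y) = lieDer C c x * y + x * lieDer C c y := by
  simp only [lieDer_apply, Finset.sum_mul, Finset.mul_sum, ← Finset.sum_add_distrib]
  refine Finset.sum_congr rfl fun j _ => Finset.sum_congr rfl fun k _ => ?_
  rw [con_mul, mul_add, ← mul_assoc, ← mul_assoc, th_mul j (inv x), inv_inv, smul_add,
    smul_mul_assoc, mul_smul_comm, mul_assoc x]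

lemma ceD_mul (x y : Ext ℝ n) : ceD C (x * y) = ceD C x * y + inv x * ceD C y := by
  simp only [ceD_apply, lieDer_mul, Finset.sum_mul, Finset.mul_sum, ← Finset.sum_add_distrib]
  refine Finset.sum_congr rfl fun c _ => ?_
  rw [mul_add, ← mul_assoc, ← mul_assoc, th_mul c x, mul_assoc (inv x)]

lemma lieDer_con (c b : Fin n) (x : Ext ℝ n) :
    lieDer C c (con b x) = con b (lieDer C c x) - ∑ k, C c b k • con k x := by
  simp only [lieDer_apply, map_sum, map_smul, con_th_mul, smul_sub, Finset.sum_sub_distrib]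
  rw [Finset.sum_comm (f := fun j k => C c j k • if b = j then con k x else 0)]
  simp only [smul_ite, smul_zero, Finset.sum_ite_eq, Finset.mem_univ, if_true]
  rw [sub_sub_cancel_left, ← Finset.sum_neg_distrib]
  refine Finset.sum_congr rfl fun j _ => ?_
  rw [← Finset.sum_neg_distrib]
  refine Finset.sum_congr rfl fun k _ => ?_
  rw [con_con k b, mul_neg, smul_neg]

variable {C}

/-- Cartan's formula. The factor `2` reflects the normalization of `ceD`: one copy of `lieDer` comes
from contracting the leading generator, the other from the commutator of `lieDer` with `con`. -/
lemma con_ceD (hC : ∀ i j k, C i j k = -C j i k) (b : Fin n) (x : Ext ℝ n) :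
    ceD C (con b x) = (2 : ℝ) • lieDer C b x - con b (ceD C x) := by
  have h : ∑ c, th c * ∑ k, C c b k • con k x = - lieDer C b x := by
    rw [lieDer_apply, ← Finset.sum_neg_distrib]
    refine Finset.sum_congr rfl fun j _ => ?_
    rw [Finset.mul_sum, ← Finset.sum_neg_distrib]
    refine Finset.sum_congr rfl fun k _ => ?_
    rw [hC, neg_smul, mul_neg, mul_smul_comm]
  simp only [ceD_apply, lieDer_con, mul_sub, map_sum, con_th_mul, Finset.sum_sub_distrib, h,
    Finset.sum_ite_eq, Finset.mem_univ, if_true]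
  module

/-- Skew forms annihilated by the coadjoint action. -/
def LieInv (C : Fin n → Fin n → Fin n → ℝ) (x : Ext ℝ n) : Prop := ∀ c, lieDer C c x = 0

lemma LieInv.ceD {x : Ext ℝ n} (h : LieInv C x) : ceD C x = 0 := by
  rw [ceD_apply]
  exact Finset.sum_eq_zero fun c _ => by rw [h c, mul_zero]

/-- The action on each slot gives the same exterior element, because the slots of a skew tensor are
interchangeable. Their sum is `q + 1` times the action on the first slot, which `lieDer` computes.
-/
lemma IsInvariant.lieInv {q : ℕ} {T : Tensor n (q + 1)} (hs : Skew T) (h : IsInvariant C T) :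
    LieInv C (nel T) := by
  intro c
  let V : Fin (q + 1) → Tensor n (q + 1) := fun s I => ∑ k, C c (I s) k * T (Function.update I s k)
  have hV : ∀ s, V s = fun I => ((Equiv.Perm.sign (Equiv.swap 0 s) : ℤ) : ℝ) *
      V 0 (I ∘ Equiv.swap 0 s) := by
    intro s
    ext I
    simp only [V, Finset.mul_sum, Function.comp_apply, Equiv.swap_apply_left]
    refine Finset.sum_congr rfl fun k _ => ?_
    have h1 : Function.update (I ∘ Equiv.swap 0 s) 0 k =
        Function.update I s k ∘ Equiv.swap 0 s := by
      rw [Function.update_comp_equiv]; simp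
    rw [h1, hs, mul_left_comm, ← mul_assoc _ _ (T _), sign_mul_self, one_mul]
  have hel : ∀ s, el (V s) = el (V 0) := by
    intro s
    rw [hV s]
    have := el_comp_perm (Equiv.swap 0 s) (V 0)
    rw [show (fun I => ((Equiv.Perm.sign (Equiv.swap 0 s) : ℤ) : ℝ) * V 0 (I ∘ Equiv.swap 0 s)) =
      ((Equiv.Perm.sign (Equiv.swap 0 s) : ℤ) : ℝ) • fun I => V 0 (I ∘ Equiv.swap 0 s) from rfl,
      el_smul, this, smul_smul, sign_mul_self, one_smul]
  have h0 : el (V 0) = 0 := by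
    have h2 : ∑ s, V s = 0 := by
      ext I
      rw [Finset.sum_apply]
      exact h c I
    have h3 : el (∑ s, V s) = 0 := by rw [h2, el_zero]
    rw [el_sum] at h3
    simp only [hel, Finset.sum_const, Finset.card_univ, Fintype.card_fin] at h3
    rw [← Nat.cast_smul_eq_nsmul ℝ] at h3
    exact (smul_eq_zero.1 h3).resolve_left (by positivity)
  rw [lieDer_apply]
  simp only [con_nel hs]
  rw [el_succ] at h0
  have h4 : ∀ j, el (fun I => V 0 (Fin.cons j I)) =
      ∑ k, C c j k • el fun I : Fin q → Fin n => T (Fin.cons k I) := by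
    intro j
    simp only [← el_smul]
    rw [← el_sum]
    congr 1
    ext I
    simp [V, Finset.sum_apply]
  simp only [h4, Finset.mul_sum, mul_smul_comm] at h0
  simp only [nel, mul_smul_comm, smul_comm _ (1 / (q.factorial : ℝ)), ← Finset.smul_sum]
  rw [h0, smul_zero]

/-- Structure constants `C` together with an invariant symmetric tensor `G` whose Casimir operator
on the adjoint representation is a nonzero scalar. -/
structure CasimirData (C : Fin n → Fin n → Fin n → ℝ) (G : Fin n → Fin n → ℝ) (lam : ℝ) :
    Prop where
  anti : ∀ i j k, C i j k = -C j i k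
  jacobi : ∀ f c a e, ∑ m, C c a m * C f m e =
    ∑ m, C f c m * C m a e + ∑ m, C f a m * C c m e
  symm : ∀ i j, G i j = G j i
  invariant : ∀ a i j, ∑ ν, C a ν i * G ν j + ∑ ν, G i ν * C a ν j = 0
  ne_zero : lam ≠ 0
  casimir : ∀ a f, ∑ b, ∑ c, ∑ e, G b c * (C c a e * C b e f) = if a = f then lam else 0

variable {G : Fin n → Fin n → ℝ} {lam : ℝ}

/-- The invariant tensor `G^{aν} G^{bc} C_{ca}^e`. -/
def upC (C : Fin n → Fin n → Fin n → ℝ) (G : Fin n → Fin n → ℝ) (b e ν : Fin n) : ℝ :=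
  ∑ a, ∑ c, G a ν * G b c * C c a e

/-- Invariance of `G` moves the action from the two raised indices onto the lower indices of `C`;
what remains is the Jacobi identity. -/
lemma CasimirData.upC_invariant (h : CasimirData C G lam) (f k e ν : Fin n) :
    ∑ b, C f b k * upC C G b e ν + ∑ b, C f b e * upC C G k b ν +
      ∑ b, C f b ν * upC C G k e b = 0 := by
  have t1 : ∑ b, C f b k * upC C G b e ν =
      -∑ a, ∑ c, G a ν * G k c * ∑ m, C f c m * C m a e := by
    have : ∀ c, ∑ b, C f b k * G b c = -∑ b, G k b * C f b c := fun c =>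
      eq_neg_of_add_eq_zero_left (h.invariant f k c)
    calc _ = ∑ a, ∑ c, G a ν * C c a e * ∑ b, C f b k * G b c := by
          simp only [upC, Finset.mul_sum]
          rw [Finset.sum_comm]
          refine Finset.sum_congr rfl fun a _ => ?_
          rw [Finset.sum_comm]
          refine Finset.sum_congr rfl fun c _ => Finset.sum_congr rfl fun b _ => by ring
      _ = _ := by
          rw [← Finset.sum_neg_distrib]
          refine Finset.sum_congr rfl fun a _ => ?_
          simp only [this, Finset.mul_sum, mul_neg, Finset.sum_neg_distrib]
          rw [Finset.sum_comm]
          congr 1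
          refine Finset.sum_congr rfl fun c _ => Finset.sum_congr rfl fun b _ => by ring
  have t2 : ∑ b, C f b e * upC C G k b ν = ∑ a, ∑ c, G a ν * G k c * ∑ m, C c a m * C f m e := by
    simp only [upC, Finset.mul_sum]
    rw [Finset.sum_comm]
    refine Finset.sum_congr rfl fun a _ => ?_
    rw [Finset.sum_comm]
    refine Finset.sum_congr rfl fun c _ => Finset.sum_congr rfl fun b _ => by ring
  have t3 : ∑ b, C f b ν * upC C G k e b =
      -∑ a, ∑ c, G a ν * G k c * ∑ m, C f a m * C c m e := by
    have : ∀ a, ∑ b, C f b ν * G a b = -∑ b, C f b a * G b ν := fun a => by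
      have := h.invariant f a ν
      simp only [mul_comm (G a _)] at this
      exact eq_neg_of_add_eq_zero_right this
    calc _ = ∑ c, ∑ a, G k c * C c a e * ∑ b, C f b ν * G a b := by
          simp only [upC, Finset.mul_sum]
          rw [sum_reverse₃]
          refine Finset.sum_congr rfl fun c _ => Finset.sum_congr rfl fun a _ =>
            Finset.sum_congr rfl fun b _ => by ring
      _ = _ := by
          simp only [this, Finset.mul_sum, mul_neg, Finset.sum_neg_distrib]
          rw [sum_cycle₃]
          congr 1
          refine Finset.sum_congr rfl fun b _ => Finset.sum_congr rfl fun c _ =>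
            Finset.sum_congr rfl fun a _ => by ring
  rw [t1, t2, t3, ← sub_eq_add_neg, neg_add_eq_sub, sub_sub, ← Finset.sum_add_distrib,
    sub_eq_zero]
  refine Finset.sum_congr rfl fun a _ => ?_
  rw [← Finset.sum_add_distrib]
  refine Finset.sum_congr rfl fun c _ => ?_
  rw [← mul_add, h.jacobi]

lemma LieInv.lieDer_con {x : Ext ℝ n} (h : LieInv C x) (c b : Fin n) :
    lieDer C c (con b x) = -∑ k, C c b k • con k x := by
  rw [GenJacobi.lieDer_con, h c, map_zero, zero_sub]

/-- Contracting an invariant tensor `A` with a family that transforms dually gives an invariant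
element: each of the three actions is transferred from the family to the coefficients. -/
lemma map_sum_eq_zero_of_derivation {M : Type*} [AddCommGroup M] [Module ℝ M] (D : M →ₗ[ℝ] M)
    (A : Fin n → Fin n → Fin n → ℝ) (c : Fin n → Fin n → ℝ) (g : Fin n → Fin n → Fin n → M)
    (hA : ∀ k e ν, ∑ b, c b k * A b e ν + ∑ b, c b e * A k b ν + ∑ b, c b ν * A k e b = 0)
    (hg : ∀ b e ν, D (g b e ν) =
      -(∑ k, c b k • g k e ν + ∑ k, c e k • g b k ν + ∑ k, c ν k • g b e k)) :
    D (∑ b, ∑ e, ∑ ν, A b e ν • g b e ν) = 0 := by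
  have e1 : ∑ b, ∑ e, ∑ ν, A b e ν • ∑ k, c b k • g k e ν =
      ∑ k, ∑ e, ∑ ν, (∑ b, c b k * A b e ν) • g k e ν := by
    simp only [Finset.smul_sum, Finset.sum_smul, smul_smul]
    rw [sum_cycle₄]
    refine Finset.sum_congr rfl fun k _ => ?_
    rw [← sum_cycle₃]
    exact Finset.sum_congr rfl fun e _ => Finset.sum_congr rfl fun ν _ =>
      Finset.sum_congr rfl fun b _ => by rw [mul_comm]
  have e2 : ∑ b, ∑ e, ∑ ν, A b e ν • ∑ k, c e k • g b k ν =
      ∑ k, ∑ e, ∑ ν, (∑ b, c b e * A k b ν) • g k e ν := by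
    simp only [Finset.smul_sum, Finset.sum_smul, smul_smul]
    refine Finset.sum_congr rfl fun b _ => ?_
    rw [sum_reverse₃]
    exact Finset.sum_congr rfl fun e _ => Finset.sum_congr rfl fun ν _ =>
      Finset.sum_congr rfl fun b _ => by rw [mul_comm]
  have e3 : ∑ b, ∑ e, ∑ ν, A b e ν • ∑ k, c ν k • g b e k =
      ∑ k, ∑ e, ∑ ν, (∑ b, c b ν * A k e b) • g k e ν := by
    simp only [Finset.smul_sum, Finset.sum_smul, smul_smul]
    refine Finset.sum_congr rfl fun b _ => Finset.sum_congr rfl fun e _ => ?_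
    rw [Finset.sum_comm]
    exact Finset.sum_congr rfl fun ν _ => Finset.sum_congr rfl fun b _ => by rw [mul_comm]
  simp only [map_sum, map_smul, hg, smul_neg, Finset.sum_neg_distrib, smul_add,
    Finset.sum_add_distrib, e1, e2, e3]
  simp only [← Finset.sum_add_distrib] at hA
  simp only [← Finset.sum_add_distrib, ← add_smul, hA, zero_smul, Finset.sum_const_zero, neg_zero]

/-- Contracting the raised structure tensor with `C` closes a loop, which is the Casimir operator of
the adjoint representation. -/
lemma CasimirData.sum_upC_mul (h : CasimirData C G lam) (k ν : Fin n) :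
    ∑ b, ∑ e, upC C G b e ν * C b e k = lam * G k ν := by
  have : ∀ a, G a ν * ∑ b, ∑ c, ∑ e, G b c * (C c a e * C b e k) =
      if a = k then G a ν * lam else 0 := fun a => by rw [h.casimir]; simp
  calc ∑ b, ∑ e, upC C G b e ν * C b e k
      = ∑ b, ∑ e, ∑ a, ∑ c, G a ν * (G b c * (C c a e * C b e k)) := by
        simp only [upC, Finset.sum_mul]
        refine Finset.sum_congr rfl fun b _ => Finset.sum_congr rfl fun e _ =>
          Finset.sum_congr rfl fun a _ => Finset.sum_congr rfl fun c _ => by ring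
    _ = ∑ b, ∑ a, ∑ c, ∑ e, G a ν * (G b c * (C c a e * C b e k)) :=
        Finset.sum_congr rfl fun b _ =>
          (sum_cycle₃ fun a c e => G a ν * (G b c * (C c a e * C b e k))).symm
    _ = ∑ a, G a ν * ∑ b, ∑ c, ∑ e, G b c * (C c a e * C b e k) := by
        rw [Finset.sum_comm]
        simp only [Finset.mul_sum]
    _ = lam * G k ν := by simp only [this]; simp [mul_comm]

lemma LieInv.ceD_con (hC : ∀ i j k, C i j k = -C j i k) {x : Ext ℝ n} (hx : LieInv C x)
    (e : Fin n) : GenJacobi.ceD C (con e x) = 0 := by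
  rw [con_ceD hC, hx e, hx.ceD, smul_zero, map_zero, sub_zero]

/-- Two applications of Cartan's formula; only the action of `b` on the single contraction `i_e x`
survives. -/
lemma LieInv.ceD_con_con (hC : ∀ i j k, C i j k = -C j i k) {x : Ext ℝ n} (hx : LieInv C x)
    (b e : Fin n) : GenJacobi.ceD C (con b (con e x)) = -(2 : ℝ) • ∑ k, C b e k • con k x := by
  rw [con_ceD hC, hx.ceD_con hC, hx.lieDer_con, map_zero, sub_zero, smul_neg, neg_smul]

/-- The candidate primitive: its image under `ceD` is a multiple of the contraction bracket of `x`
and `y`, and it is itself invariant. -/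
lemma CasimirData.lieInv_sum (h : CasimirData C G lam) {x y : Ext ℝ n} (hx : LieInv C x)
    (hy : LieInv C y) :
    LieInv C (∑ b, ∑ e, ∑ ν, upC C G b e ν • (con b (con e x) * con ν y)) := fun f =>
  map_sum_eq_zero_of_derivation (lieDer C f) (upC C G) (C f) _ (h.upC_invariant f)
    fun b e ν => by
      have h1 : lieDer C f (con b (con e x)) =
          -(∑ k, C f b k • con k (con e x)) - ∑ k, C f e k • con b (con k x) := by
        rw [GenJacobi.lieDer_con, hx.lieDer_con, map_neg, map_sum]
        simp only [map_smul]
        abel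
      rw [lieDer_mul, hy.lieDer_con, h1, sub_mul, neg_mul, mul_neg, Finset.sum_mul,
        Finset.sum_mul, Finset.mul_sum]
      simp only [smul_mul_assoc, mul_smul_comm]
      abel

/-- The contraction bracket of two invariant forms vanishes. -/
theorem CasimirData.sum_con_mul_con (h : CasimirData C G lam) {x y : Ext ℝ n} (hx : LieInv C x)
    (hy : LieInv C y) : ∑ k, ∑ ν, G k ν • (con k x * con ν y) = 0 := by
  -- `ceD` annihilates the primitive because it is invariant. Computing the same image by the
  -- Leibniz rule yields `-2 * lam` times the contraction bracket.
  have h3 := (h.lieInv_sum hx hy).ceD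
  have h6 : ∀ b e ν, GenJacobi.ceD C (con b (con e x) * con ν y) =
      ∑ k, (-(2 : ℝ) * C b e k) • (con k x * con ν y) := by
    intro b e ν
    rw [ceD_mul, hy.ceD_con h.anti, mul_zero, add_zero, hx.ceD_con_con h.anti, smul_mul_assoc,
      Finset.sum_mul, Finset.smul_sum]
    simp only [smul_mul_assoc, smul_smul]
  simp only [map_sum, map_smul, h6, Finset.smul_sum, smul_smul] at h3
  rw [sum_cycle₄] at h3
  have h8 : ∀ k, ∑ b, ∑ e, ∑ ν, (upC C G b e ν * (-(2 : ℝ) * C b e k)) • (con k x * con ν y) =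
      ∑ ν, (-(2 * lam)) • (G k ν • (con k x * con ν y)) := by
    intro k
    rw [sum_cycle₃]
    refine Finset.sum_congr rfl fun ν _ => ?_
    simp only [smul_smul, ← Finset.sum_smul]
    congr 1
    rw [neg_mul, mul_assoc, ← h.sum_upC_mul, Finset.mul_sum, ← Finset.sum_neg_distrib]
    refine Finset.sum_congr rfl fun b _ => ?_
    rw [Finset.mul_sum, ← Finset.sum_neg_distrib]
    exact Finset.sum_congr rfl fun e _ => by ring
  simp only [h8, ← Finset.smul_sum] at h3
  exact (smul_eq_zero.1 h3).resolve_left (by simpa using h.ne_zero)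

end Invariant

/-! ### Linear generalized Poisson structures from invariant forms -/

section Raise

variable {n : ℕ} {G : Fin n → Fin n → ℝ}

/-- The last index of `α` raised with `G`. -/
def raise (G : Fin n → Fin n → ℝ) {m : ℕ} (α : Tensor n (m + 1)) (I : Fin m → Fin n)
    (σ : Fin n) : ℝ :=
  ∑ τ : Fin n, α (Fin.snoc I τ) * G τ σ

/-- Moving the last index to the front crosses `2r + 2` places, an even number, so no sign appears.
-/
lemma nel_raise {r : ℕ} {α : Tensor n (2 * r + 3)} (hα : Skew α) (σ : Fin n) :
    nel (fun I => raise G α I σ) = ∑ τ, G τ σ • con τ (nel α) := by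
  have h : (fun I => raise G α I σ) = ∑ τ, G τ σ • fun I => α (Fin.cons τ I) := by
    ext I
    simp only [raise, Finset.sum_apply, Pi.smul_apply, smul_eq_mul]
    refine Finset.sum_congr rfl fun τ _ => ?_
    rw [hα.snoc, Even.neg_one_pow ⟨r + 1, by ring⟩, one_mul, mul_comm]
  rw [h, nel_sum]
  simp only [nel_smul, con_nel hα]

lemma skew_raise {m : ℕ} {α : Tensor n (m + 1)} (hα : Skew α) (σ : Fin n) :
    Skew fun I => raise G α I σ := by
  have h : (fun I => raise G α I σ) = ∑ τ, ((-1) ^ m * G τ σ) • fun I => α (Fin.cons τ I) := by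
    ext I
    simp only [raise, Finset.sum_apply, Pi.smul_apply, smul_eq_mul]
    refine Finset.sum_congr rfl fun τ _ => ?_
    rw [hα.snoc]
    ring
  rw [h]
  exact Finset.sum_induction _ Skew (fun _ _ => Skew.add) (fun σ K => by simp)
    fun τ _ => (hα.cons τ).smul _

lemma isMultivectorField_linearField_raise {m : ℕ} {α : Tensor n (m + 1)} (hα : Skew α) :
    IsMultivectorField (linearField (raise G α)) :=
  isMultivectorField_linearField (skew_raise hα)

/-- Contract the bracket identity once more: the Leibniz rule gives two sums, equal by symmetry of
`G` and centrality of the even factors, so each vanishes. -/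
lemma sum_con_con_mul {a : Ext ℝ n} (ha : Od a) (hG : ∀ i j, G i j = G j i)
    (h : ∑ k, ∑ ν, G k ν • (con k a * con ν a) = 0) (τ : Fin n) :
    ∑ ν, ∑ ρ, G ρ ν • (con ν (con τ a) * con ρ a) = 0 := by
  have h1 := congrArg (con τ) h
  have h2 : ∀ k ν, con τ (con k a * con ν a) =
      con τ (con k a) * con ν a + con τ (con ν a) * con k a := by
    intro k ν
    rw [con_mul, (ha.con k : inv (con k a) = con k a), (ha.con k).comm (con τ (con ν a))]
  simp only [map_sum, map_smul, h2, smul_add, Finset.sum_add_distrib, map_zero] at h1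
  have h3 : ∑ k, ∑ ν, G k ν • (con τ (con k a) * con ν a) =
      ∑ k, ∑ ν, G k ν • (con τ (con ν a) * con k a) := by
    rw [Finset.sum_comm]
    exact Finset.sum_congr rfl fun ν _ => Finset.sum_congr rfl fun k _ => by rw [hG]
  rw [h3, ← two_smul ℝ] at h1
  have h4 := (smul_eq_zero.1 h1).resolve_left two_ne_zero
  rw [Finset.sum_comm] at h4
  rw [← neg_eq_zero, ← Finset.sum_neg_distrib, ← h4]
  refine Finset.sum_congr rfl fun ν _ => ?_
  rw [← Finset.sum_neg_distrib]
  refine Finset.sum_congr rfl fun ρ _ => ?_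
  rw [con_con ν τ, neg_mul, smul_neg, neg_neg]

/-- `Ω` is the combination of the contractions `i_τ α` with coefficients `G^{τμ} x_μ`. Hence the
coefficient of each `x_μ` in `[Ω, Ω]` is assembled from the sums in `sum_con_con_mul`. -/
theorem isGenPoisson_raise {r : ℕ} {α : Tensor n (2 * r + 3)} (hα : Skew α)
    (hG : ∀ i j, G i j = G j i)
    (h : ∑ k, ∑ ν, G k ν • (con k (nel α) * con ν (nel α)) = 0) :
    IsGenPoisson (r := r) (linearField (raise G α)) := by
  have hΩ : IsMultivectorField (n := n) (k := 2 * r + 2) (linearField (raise G α)) :=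
    isMultivectorField_linearField_raise hα
  refine ⟨hΩ, schouten_eq_zero_iff.2 fun x => ?_⟩
  have ha : Od (nel α) := od_nel ⟨r + 1, by ring⟩ _
  have h1 : (-1 : ℝ) ^ (2 * r + 1 + 1) = 1 := by rw [add_assoc, Even.neg_one_pow ⟨r + 1, by ring⟩]
  have h2 : ∀ μ, ∑ ν, con ν (∑ τ, G τ μ • con τ (nel α)) * ∑ ρ, G ρ ν • con ρ (nel α) = 0 := by
    intro μ
    have h5 : ∀ ν, con ν (∑ τ, G τ μ • con τ (nel α)) * ∑ ρ, G ρ ν • con ρ (nel α) =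
        ∑ τ, G τ μ • ∑ ρ, G ρ ν • (con ν (con τ (nel α)) * con ρ (nel α)) := by
      intro ν
      rw [map_sum, Finset.sum_mul]
      refine Finset.sum_congr rfl fun τ _ => ?_
      rw [map_smul, smul_mul_assoc, Finset.mul_sum]
      simp only [mul_smul_comm]
    simp only [h5]
    rw [Finset.sum_comm]
    simp only [← Finset.smul_sum, sum_con_con_mul ha hG h, smul_zero, Finset.sum_const_zero]
  have h3 : ∑ ν, con ν (nel (linearField (raise G α) x)) *
      nel (dfield ν (linearField (raise G α)) x) = 0 := by
    rw [linearField_eq, nel_sum]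
    simp only [nel_smul, dfield_linearField, nel_raise hα, map_sum, map_smul, Finset.sum_mul,
      smul_mul_assoc]
    rw [Finset.sum_comm]
    refine Finset.sum_eq_zero fun μ _ => ?_
    rw [← Finset.smul_sum]
    have := h2 μ
    simp only [map_sum, map_smul, Finset.sum_mul, smul_mul_assoc] at this
    rw [this, smul_zero]
  rw [nel_schouten x (hΩ.skew x) (hΩ.skew x), h1, one_smul, h3, zero_add]
  refine Eq.trans (Finset.sum_congr rfl fun ν _ => ?_) h3
  exact (ev_nel ⟨r + 1, by ring⟩ _).comm _

theorem poissonCoboundary_raise {r q : ℕ} {α : Tensor n (2 * r + 3)} (hα : Skew α)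
    (hG : ∀ i j, G i j = G j i) {β : Tensor n (q + 1)} (hβ : Skew β)
    (h : ∑ k, ∑ ν, G k ν • (con k (nel β) * con ν (nel α)) = 0) :
    poissonCoboundary (r := r) (linearField (raise G α)) (constField β) = 0 := by
  rw [poissonCoboundary_constField_eq_zero_iff (isMultivectorField_linearField_raise hα) hβ, ← h]
  refine Finset.sum_congr rfl fun k _ => ?_
  rw [nel_raise hα, Finset.mul_sum]
  refine Finset.sum_congr rfl fun ν _ => ?_
  rw [mul_smul_comm, hG]

variable {C : Fin n → Fin n → Fin n → ℝ} {lam : ℝ}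

theorem CasimirData.structures (h : CasimirData C G lam) {r : ℕ} {α : Tensor n (2 * r + 3)}
    (hα : Skew α) (hi : IsInvariant C α) :
    IsGenPoisson (r := r) (linearField (raise G α)) ∧
      (∀ (q : ℕ) (β : Tensor n (q + 1)), Skew β → IsInvariant C β →
        poissonCoboundary (r := r) (linearField (raise G α)) (constField β) = 0) ∧
      ∀ β : Tensor n (2 * r + 1), Skew β → IsInvariant C β →
        IsGenJacobi (r := r) (linearField (raise G α) + wedge (constField β) (dilatation n))
          (constField β) := by
  have h1 : IsGenPoisson (r := r) (linearField (raise G α)) :=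
    isGenPoisson_raise hα h.symm (h.sum_con_mul_con (hi.lieInv hα) (hi.lieInv hα))
  have h2 : ∀ (q : ℕ) (β : Tensor n (q + 1)), Skew β → IsInvariant C β →
      poissonCoboundary (r := r) (linearField (raise G α)) (constField β) = 0 :=
    fun q β hβ hβi => poissonCoboundary_raise hα h.symm hβ
      (h.sum_con_mul_con (hβi.lieInv hβ) (hi.lieInv hα))
  exact ⟨h1, h2, fun β hβ hβi => isGenJacobi_of_poissonCoboundary h1 hβ (h2 _ β hβ hβi)⟩

end Raise

/-! ### Cocycles defined by invariant polynomials -/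

section Plug

variable {𝕜 : Type*} [Field 𝕜] {n : ℕ}

/-- Invariance under permutations of the indices. -/
def PermInv {k : ℕ} {M : Type*} (T : (Fin k → Fin n) → M) : Prop :=
  ∀ (σ : Equiv.Perm (Fin k)) (K : Fin k → Fin n), T (K ∘ σ) = T K

lemma PermInv.cons {k : ℕ} {M : Type*} {T : (Fin (k + 1) → Fin n) → M} (h : PermInv T)
    (a : Fin n) : PermInv fun I => T (Fin.cons a I) := by
  intro σ K
  refine Eq.trans (congrArg T ?_) (h (Equiv.Perm.decomposeFin.symm (0, σ)) (Fin.cons a K))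
  funext j
  refine Fin.cases ?_ (fun i => ?_) j <;> simp

lemma PermInv.cons_cons {k : ℕ} {M : Type*} {T : (Fin (k + 2) → Fin n) → M} (h : PermInv T)
    (a b : Fin n) (I : Fin k → Fin n) :
    T (Fin.cons a (Fin.cons b I : Fin (k + 1) → Fin n)) =
      T (Fin.cons b (Fin.cons a I : Fin (k + 1) → Fin n)) := by
  rw [← h (Equiv.swap 0 1) (Fin.cons b (Fin.cons a I : Fin (k + 1) → Fin n))]
  congr 1
  funext j
  refine Fin.cases ?_ (fun i => ?_) j
  · simp
  · refine Fin.cases ?_ (fun i => ?_) i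
    · simp
    · rw [Function.comp_apply, Equiv.swap_apply_of_ne_of_ne (by simp) (by simp [Fin.ext_iff])]
      rfl

lemma PermInv.snoc {k : ℕ} {M : Type*} {T : (Fin (k + 1) → Fin n) → M} (h : PermInv T)
    (a : Fin n) (I : Fin k → Fin n) :
    T (Fin.snoc (α := fun _ => Fin n) I a) = T (Fin.cons a I) := by
  rw [← h (finRotate _) (Fin.cons a I)]
  congr 1
  exact Fin.snoc_eq_cons_rotate _ _

/-- The `2`-form `C_{ij}^μ e_i e_j`. -/
def wform (C : Fin n → Fin n → Fin n → 𝕜) (μ : Fin n) : Ext 𝕜 n :=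
  ∑ i, ∑ j, C i j μ • (th i * th j)

lemma ev_wform (C : Fin n → Fin n → Fin n → 𝕜) (μ : Fin n) : Ev (wform C μ) :=
  Ev.sum fun i => Ev.sum fun j => ((od_th i).mul (od_th j)).smul _

/-- Contraction of all the indices of `T` with the forms `w`. -/
def plug (w : Fin n → Ext 𝕜 n) (s : ℕ) (T : (Fin s → Fin n) → Ext 𝕜 n) : Ext 𝕜 n :=
  ∑ μ : Fin s → Fin n, (List.ofFn fun a => w (μ a)).prod * T μ

variable {w : Fin n → Ext 𝕜 n}

lemma plug_zero (T : (Fin 0 → Fin n) → Ext 𝕜 n) : plug w 0 T = T Fin.elim0 := by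
  rw [plug, Fintype.sum_unique]
  simp only [List.ofFn_zero, List.prod_nil, one_mul]
  exact congrArg T (Subsingleton.elim _ _)

lemma plug_succ {s : ℕ} (T : (Fin (s + 1) → Fin n) → Ext 𝕜 n) :
    plug w (s + 1) T = ∑ ν, w ν * plug w s fun μ => T (Fin.cons ν μ) := by
  unfold plug
  rw [← (Fin.consEquiv fun _ => Fin n).sum_comp, Fintype.sum_prod_type]
  refine Finset.sum_congr rfl fun i _ => ?_
  rw [Finset.mul_sum]
  refine Finset.sum_congr rfl fun I _ => ?_
  simp [Fin.consEquiv, List.ofFn_succ, mul_assoc]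

lemma plug_add {s : ℕ} (T S : (Fin s → Fin n) → Ext 𝕜 n) :
    plug w s (fun μ => T μ + S μ) = plug w s T + plug w s S := by
  simp [plug, mul_add, Finset.sum_add_distrib]

lemma plug_sum {ι : Type*} [Fintype ι] {s : ℕ} (T : ι → (Fin s → Fin n) → Ext 𝕜 n) :
    plug w s (fun μ => ∑ i, T i μ) = ∑ i, plug w s (T i) := by
  simp only [plug, Finset.mul_sum]
  exact Finset.sum_comm

lemma plug_smul {s : ℕ} (c : 𝕜) (T : (Fin s → Fin n) → Ext 𝕜 n) :
    plug w s (fun μ => c • T μ) = c • plug w s T := by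
  simp [plug, Finset.smul_sum]

lemma plug_zero_fun {s : ℕ} : plug w s (fun _ => 0) = 0 := by simp [plug]

lemma mul_plug (hw : ∀ μ, Ev (w μ)) (x : Ext 𝕜 n) {s : ℕ} (T : (Fin s → Fin n) → Ext 𝕜 n) :
    x * plug w s T = plug w s fun μ => x * T μ := by
  induction s with
  | zero => simp [plug_zero]
  | succ s ih =>
    simp only [plug_succ, Finset.mul_sum, ← ih]
    refine Finset.sum_congr rfl fun ν _ => ?_
    rw [← mul_assoc, ← (hw ν).comm, mul_assoc]

/-- The action of the matrix `c` on the indices of `T`. -/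
def idxAct (c : Fin n → Fin n → 𝕜) {s : ℕ} (T : (Fin s → Fin n) → Ext 𝕜 n) :
    (Fin s → Fin n) → Ext 𝕜 n :=
  fun μ => ∑ a, ∑ κ, c (μ a) κ • T (Function.update μ a κ)

lemma idxAct_zero (c : Fin n → Fin n → 𝕜) (T : (Fin 0 → Fin n) → Ext 𝕜 n) (μ : Fin 0 → Fin n) :
    idxAct c T μ = 0 := by simp [idxAct]

lemma idxAct_cons (c : Fin n → Fin n → 𝕜) {s : ℕ} (T : (Fin (s + 1) → Fin n) → Ext 𝕜 n)
    (ν : Fin n) (μ : Fin s → Fin n) :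
    idxAct c T (Fin.cons ν μ) = ∑ κ, c ν κ • T (Fin.cons κ μ) +
      idxAct c (fun μ => T (Fin.cons ν μ)) μ := by
  unfold idxAct
  rw [Fin.sum_univ_succ]
  simp [Fin.cons_update]

lemma plug_idxAct_succ (c : Fin n → Fin n → 𝕜) {s : ℕ} (T : (Fin (s + 1) → Fin n) → Ext 𝕜 n) :
    plug w (s + 1) (idxAct c T) =
      ∑ κ, (∑ ν, c ν κ • w ν) * plug w s (fun μ => T (Fin.cons κ μ)) +
      ∑ ν, w ν * plug w s (idxAct c fun μ => T (Fin.cons ν μ)) := by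
  simp only [plug_succ, idxAct_cons, plug_add, mul_add, Finset.sum_add_distrib, plug_sum,
    plug_smul, Finset.mul_sum, Finset.sum_mul]
  congr 1
  rw [Finset.sum_comm]
  exact Finset.sum_congr rfl fun κ _ => Finset.sum_congr rfl fun ν _ => by
    rw [mul_smul_comm, smul_mul_assoc]

/-- Acting on a contracted index of `T` amounts to acting on the form `w` it is contracted with, and
`hc` says that this action, multiplied by the generators and summed, is zero. For `wform` this is
`sum_th_mul_wform`. -/
lemma sum_mul_plug_idxAct (hw : ∀ μ, Ev (w μ)) (c : Fin n → Fin n → Fin n → 𝕜)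
    (hc : ∀ κ, ∑ i, ∑ ν, c i ν κ • (th i * w ν) = 0) {s : ℕ} (T : (Fin s → Fin n) → Ext 𝕜 n) :
    ∑ i, th i * plug w s (idxAct (c i) T) = 0 := by
  induction s with
  | zero => simp [plug_zero, idxAct_zero]
  | succ s ih =>
    have h1 : ∑ i, ∑ κ, th i * ((∑ ν, c i ν κ • w ν) * plug w s fun μ => T (Fin.cons κ μ)) = 0 := by
      rw [Finset.sum_comm]
      refine Finset.sum_eq_zero fun κ _ => ?_
      simp only [← mul_assoc, ← Finset.sum_mul, Finset.mul_sum, mul_smul_comm, hc, zero_mul]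
    have h2 : ∑ i, ∑ ν, th i * (w ν * plug w s (idxAct (c i) fun μ => T (Fin.cons ν μ))) = 0 := by
      rw [Finset.sum_comm]
      refine Finset.sum_eq_zero fun ν _ => ?_
      simp only [← mul_assoc, ← (hw ν).comm]
      simp only [mul_assoc, ← Finset.mul_sum, ih, mul_zero]
    simp only [plug_idxAct_succ, mul_add, Finset.mul_sum, Finset.sum_add_distrib, h1, h2, add_zero]

/-- Leibniz rule: by symmetry of `T` and centrality of the `w`, the `s + 1` terms in which the
contraction hits a factor `w` are equal. -/
lemma con_plug (hw : ∀ μ, Ev (w μ)) (b : Fin n) {s : ℕ} {T : (Fin (s + 1) → Fin n) → Ext 𝕜 n}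
    (hT : PermInv T) :
    con b (plug w (s + 1) T) = plug w (s + 1) (fun μ => con b (T μ)) +
      ((s + 1 : ℕ) : 𝕜) • ∑ ν, con b (w ν) * plug w s fun μ => T (Fin.cons ν μ) := by
  have hi : ∀ μ, inv (w μ) = w μ := hw
  induction s with
  | zero =>
    simp only [plug_succ, plug_zero, map_sum, con_mul, hi,
      Finset.sum_add_distrib]
    rw [add_comm]
    simp
  | succ s ih =>
    have h1 : ∀ ν, con b (plug w (s + 1) fun μ => T (Fin.cons ν μ)) = _ := fun ν =>
      ih (T := fun μ => T (Fin.cons ν μ)) (hT.cons ν)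
    rw [plug_succ]
    simp only [map_sum, con_mul, hi, h1, mul_add, Finset.sum_add_distrib]
    rw [plug_succ (T := fun μ => con b (T μ))]
    have h2 : ∑ ν, w ν * (((s + 1 : ℕ) : 𝕜) • ∑ κ, con b (w κ) *
        plug w s fun μ => T (Fin.cons ν (Fin.cons κ μ : Fin (s + 1) → Fin n))) =
        ((s + 1 : ℕ) : 𝕜) • ∑ ν, con b (w ν) * plug w (s + 1) fun μ => T (Fin.cons ν μ) := by
      simp only [mul_smul_comm, ← Finset.smul_sum, plug_succ, Finset.mul_sum]
      congr 1
      rw [Finset.sum_comm]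
      refine Finset.sum_congr rfl fun κ _ => Finset.sum_congr rfl fun ν _ => ?_
      rw [← mul_assoc, (hw ν).comm, mul_assoc]
      simp only [hT.cons_cons ν κ]
    rw [h2]
    push_cast
    module

/-- The coefficients of a product of forms `w`. -/
def rawProd (C : Fin n → Fin n → Fin n → 𝕜) {s : ℕ} (μ : Fin s → Fin n) (J : Fin (2 * s) → Fin n) :
    𝕜 :=
  ∏ a : Fin s, C (J ⟨2 * a, by omega⟩) (J ⟨2 * a + 1, by omega⟩) (μ a)

lemma el_rawProd (C : Fin n → Fin n → Fin n → 𝕜) {s : ℕ} (μ : Fin s → Fin n) :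
    el (rawProd C μ) = (List.ofFn fun a => wform C (μ a)).prod := by
  induction s with
  | zero =>
    rw [el_fin_zero]
    simp [rawProd]
  | succ s ih =>
    have h1 : el (fun K : Fin 2 → Fin n => C (K 0) (K 1) (μ 0)) = wform C (μ 0) := by
      rw [el_succ]
      refine Finset.sum_congr rfl fun i _ => ?_
      rw [el_succ, Finset.mul_sum]
      refine Finset.sum_congr rfl fun j _ => ?_
      rw [el_fin_zero, ← Algebra.commutes, ← Algebra.smul_def, mul_smul_comm]
      rfl
    have h2 := el_mul (m := 2 * (s + 1)) (by ring) (fun K : Fin 2 → Fin n => C (K 0) (K 1) (μ 0))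
      (rawProd C fun a => μ a.succ) (fun i => ⟨i, by omega⟩) (fun i => ⟨2 + i, by omega⟩)
      (fun _ => rfl) fun _ => rfl
    rw [List.ofFn_succ, List.prod_cons, ← h1, ← ih fun a => μ a.succ, ← h2]
    congr 1
    ext J
    rw [rawProd, Fin.prod_univ_succ]
    refine congrArg₂ _ rfl (Finset.prod_congr rfl fun a _ => ?_)
    have h3 : (⟨2 * (a.succ : ℕ), by omega⟩ : Fin (2 * (s + 1))) = ⟨2 + 2 * a, by omega⟩ :=
      Fin.ext (by simp only [Fin.val_succ]; omega)
    have h4 : (⟨2 * (a.succ : ℕ) + 1, by omega⟩ : Fin (2 * (s + 1))) = ⟨2 + (2 * a + 1), by omega⟩ :=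
      Fin.ext (by simp only [Fin.val_succ]; omega)
    rw [h3, h4]
    rfl

lemma el_sum_rawProd (C : Fin n → Fin n → Fin n → 𝕜) {s : ℕ} (κ : (Fin s → Fin n) → 𝕜) :
    el (fun J : Fin (2 * s) → Fin n => ∑ μ, rawProd C μ J * κ μ) =
      plug (wform C) s fun μ => algebraMap 𝕜 _ (κ μ) := by
  have h : (fun J : Fin (2 * s) → Fin n => ∑ μ, rawProd C μ J * κ μ) =
      ∑ μ, κ μ • rawProd C μ := by
    ext J
    simp [mul_comm]
  rw [h, el_sum, plug]
  refine Finset.sum_congr rfl fun μ _ => ?_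
  rw [el_smul, el_rawProd, ← Algebra.commutes, ← Algebra.smul_def]

lemma el_sum_rawProd_snoc (C : Fin n → Fin n → Fin n → 𝕜) {s : ℕ}
    (k : (Fin (s + 1) → Fin n) → 𝕜) :
    el (fun J : Fin (2 * s + 1) → Fin n => ∑ μ, rawProd C μ (fun i => J ⟨i, by omega⟩) *
        k (Fin.snoc μ (J (Fin.last (2 * s))))) =
      plug (wform C) s fun μ => ∑ j, k (Fin.snoc μ j) • th j := by
  have h : (fun J : Fin (2 * s + 1) → Fin n => ∑ μ, rawProd C μ (fun i => J ⟨i, by omega⟩) *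
        k (Fin.snoc μ (J (Fin.last (2 * s))))) =
      ∑ μ, fun J => rawProd C μ (J ∘ fun i => ⟨i, by omega⟩) *
        (fun I : Fin 1 → Fin n => k (Fin.snoc μ (I 0))) (J ∘ fun i => ⟨2 * s + i, by omega⟩) := by
    ext J
    rw [Finset.sum_apply]
    rfl
  rw [h, el_sum, plug]
  refine Finset.sum_congr rfl fun μ _ => ?_
  rw [← el_rawProd]
  refine (el_mul rfl (rawProd C μ) (fun I : Fin 1 → Fin n => k (Fin.snoc μ (I 0)))
    (fun i => ⟨i, by omega⟩) (fun i => ⟨2 * s + i, by omega⟩) (fun _ => rfl) fun _ => rfl).trans ?_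
  congr 1
  rw [el_succ]
  refine Finset.sum_congr rfl fun j _ => ?_
  rw [el_fin_zero, ← Algebra.commutes, ← Algebra.smul_def]
  rfl

end Plug

/-! ### The exterior form of an invariant polynomial and its contractions. -/

section PolyCochain

variable {n : ℕ} {C : Fin n → Fin n → Fin n → ℝ}

lemma IsInvariant.cons {s : ℕ} {k : Tensor n (s + 1)} (h : IsInvariant C k) (c i : Fin n)
    (μ : Fin s → Fin n) :
    ∑ ν, C c i ν * k (Fin.cons ν μ) +
      ∑ a, ∑ κ, C c (μ a) κ * k (Fin.cons i (Function.update μ a κ)) = 0 := by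
  have := h c (Fin.cons i μ)
  rw [Fin.sum_univ_succ] at this
  simpa [Fin.cons_update] using this

/-- For the converse, the sum of the actions over all slots is itself skew, so it is determined by
its exterior element. -/
lemma lieInv_iff_isInvariant {q : ℕ} {T : Tensor n (q + 1)} (hs : Skew T) :
    LieInv C (nel T) ↔ IsInvariant C T := by
  refine ⟨fun h => ?_, fun h => h.lieInv hs⟩
  intro c
  let V : Fin (q + 1) → Tensor n (q + 1) := fun s I => ∑ k, C c (I s) k * T (Function.update I s k)
  have hperm : ∀ (σ : Equiv.Perm (Fin (q + 1))) s I, V s (I ∘ σ) =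
      ((Equiv.Perm.sign σ : ℤ) : ℝ) * V (σ s) I := by
    intro σ s I
    simp only [V, Finset.mul_sum, Function.comp_apply]
    refine Finset.sum_congr rfl fun k _ => ?_
    have h1 : Function.update (I ∘ σ) s k = Function.update I (σ s) k ∘ σ := by
      rw [Function.update_comp_equiv]; simp
    rw [h1, hs, mul_left_comm]
  have hskew : Skew (∑ s, V s) := by
    intro σ I
    simp only [Finset.sum_apply, hperm, ← Finset.mul_sum]
    rw [Equiv.sum_comp σ fun s => V s I]
  have hel : ∀ s, el (V s) = el (V 0) := by
    intro s
    have h1 : V s = ((Equiv.Perm.sign (Equiv.swap 0 s) : ℤ) : ℝ) •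
        fun I => V 0 (I ∘ Equiv.swap 0 s) := by
      ext I
      rw [Pi.smul_apply, hperm, smul_eq_mul, ← mul_assoc, sign_mul_self, one_mul,
        Equiv.swap_apply_left]
    rw [h1, el_smul, el_comp_perm, smul_smul, sign_mul_self, one_smul]
  have h0 : el (V 0) = 0 := by
    have h4 : ∀ j, el (fun I => V 0 (Fin.cons j I)) =
        ∑ k, C c j k • el fun I : Fin q → Fin n => T (Fin.cons k I) := by
      intro j
      simp only [← el_smul]
      rw [← el_sum]
      congr 1
      ext I
      simp [V, Finset.sum_apply]
    have h5 := h c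
    rw [lieDer_apply] at h5
    simp only [con_nel hs] at h5
    simp only [nel, mul_smul_comm, smul_comm _ (1 / (q.factorial : ℝ)), ← Finset.smul_sum] at h5
    have h6 := (smul_eq_zero.1 h5).resolve_left
      (one_div_ne_zero (by exact_mod_cast Nat.factorial_ne_zero _))
    rw [el_succ]
    simpa only [h4, Finset.mul_sum, mul_smul_comm] using h6
  have h1 : ∑ s, V s = 0 := by
    refine hskew.eq_zero ?_
    rw [el_sum]
    simp [hel, h0]
  intro I
  have := congrFun h1 I
  rwa [Finset.sum_apply] at this

lemma con_wform (hC : ∀ i j k, C i j k = -C j i k) (b μ : Fin n) :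
    con b (wform C μ) = (2 : ℝ) • ∑ j, C b j μ • th j := by
  have h1 : ∀ i j, con b (th i * th j : Ext ℝ n) =
      (if b = i then th j else 0) - if b = j then th i else 0 := by
    intro i j
    rw [con_th_mul, con_th]
    split_ifs <;> simp
  simp only [wform, map_sum, map_smul, h1, smul_sub, Finset.sum_sub_distrib, smul_ite, smul_zero]
  rw [Finset.sum_comm]
  simp only [Finset.sum_ite_eq, Finset.mem_univ, if_true]
  rw [two_smul, sub_eq_add_neg, ← Finset.sum_neg_distrib]
  congr 1
  exact Finset.sum_congr rfl fun j _ => by rw [hC j b, neg_smul, neg_neg]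

lemma lieDer_th (c j : Fin n) : lieDer C c (th j) = ∑ i, C c i j • th i := by
  simp [lieDer_apply]

/-- The curvature forms transform in the coadjoint representation; this is the Jacobi identity. -/
lemma lieDer_wform (hJ : ∀ f c a e, ∑ m, C c a m * C f m e =
    ∑ m, C f c m * C m a e + ∑ m, C f a m * C c m e) (c μ : Fin n) :
    lieDer C c (wform C μ) = ∑ ν, C c ν μ • wform C ν := by
  have h1 : ∑ i, ∑ j, C i j μ • ((∑ a, C c a i • th a) * th j : Ext ℝ n) =
      ∑ a, ∑ j, (∑ i, C c a i * C i j μ) • (th a * th j) := by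
    simp only [Finset.sum_mul, Finset.smul_sum, smul_mul_assoc, smul_smul, Finset.sum_smul]
    rw [sum_reverse₃, Finset.sum_congr rfl fun a _ => Finset.sum_congr rfl fun j _ =>
      Finset.sum_congr rfl fun i _ => by rw [mul_comm]]
  have h2 : ∑ i, ∑ j, C i j μ • (th i * (∑ a, C c a j • th a) : Ext ℝ n) =
      ∑ a, ∑ j, (∑ i, C c j i * C a i μ) • (th a * th j) := by
    simp only [Finset.mul_sum, Finset.smul_sum, mul_smul_comm, smul_smul, Finset.sum_smul]
    refine Finset.sum_congr rfl fun a _ => ?_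
    rw [Finset.sum_comm, Finset.sum_congr rfl fun j _ =>
      Finset.sum_congr rfl fun i _ => by rw [mul_comm]]
  have h3 : ∑ ν, C c ν μ • wform C ν =
      ∑ a, ∑ j, (∑ ν, C a j ν * C c ν μ) • (th a * th j : Ext ℝ n) := by
    simp only [wform, Finset.smul_sum, smul_smul, Finset.sum_smul]
    rw [← sum_cycle₃ (fun a j ν => (C c ν μ * C a j ν) • (th a * th j : Ext ℝ n)),
      Finset.sum_congr rfl fun a _ => Finset.sum_congr rfl fun j _ =>
      Finset.sum_congr rfl fun i _ => by rw [mul_comm]]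
  have h4 : ∀ a j, ∑ ν, C a j ν * C c ν μ = ∑ i, C c a i * C i j μ + ∑ i, C c j i * C a i μ :=
    fun a j => hJ c a j μ
  rw [h3]
  simp only [h4, add_smul, Finset.sum_add_distrib, ← h1, ← h2]
  simp only [wform, map_sum, map_smul, lieDer_mul, lieDer_th, smul_add, Finset.sum_add_distrib]

/-- The sum `S` is `ceD` of a curvature form, so its vanishing expresses `d² = 0`. Regrouping `S` as
`∑ w_k i_k w_κ` gives `S = -2 S`, hence `3 S = 0`. -/
lemma sum_th_mul_wform (hC : ∀ i j k, C i j k = -C j i k) (hJ : ∀ f c a e,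
    ∑ m, C c a m * C f m e = ∑ m, C f c m * C m a e + ∑ m, C f a m * C c m e) (κ : Fin n) :
    ∑ i, ∑ ν, C i ν κ • (th i * wform C ν) = 0 := by
  set S : Ext ℝ n := ∑ i, ∑ ν, C i ν κ • (th i * wform C ν) with hS
  have h1 : S = ∑ i, th i * lieDer C i (wform C κ) := by
    simp only [lieDer_wform hJ, Finset.mul_sum, mul_smul_comm, hS]
  have h2 : S = -(2 : ℝ) • S := by
    conv_lhs => rw [h1]
    have h3 : ∑ i, th i * lieDer C i (wform C κ) = ∑ k, wform C k * con k (wform C κ) := by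
      simp only [lieDer_apply, wform, Finset.mul_sum, Finset.sum_mul, mul_smul_comm,
        smul_mul_assoc, ← mul_assoc]
      rw [sum_cycle₃]
    rw [h3]
    simp only [con_wform hC, mul_smul_comm, ← Finset.smul_sum]
    rw [neg_smul, ← smul_neg, hS]
    congr 1
    simp only [Finset.mul_sum, mul_smul_comm]
    rw [Finset.sum_comm, ← Finset.sum_neg_distrib]
    refine Finset.sum_congr rfl fun i _ => ?_
    rw [← Finset.sum_neg_distrib]
    refine Finset.sum_congr rfl fun ν _ => ?_
    rw [hC i ν, (ev_wform C ν).comm, neg_smul, neg_neg]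
  have h4 : (3 : ℝ) • S = 0 := by
    have : (3 : ℝ) • S = S + (2 : ℝ) • S := by module
    rw [this]
    nth_rewrite 1 [h2]
    module
  exact (smul_eq_zero.1 h4).resolve_left (by norm_num)

lemma lieDer_plug (hJ : ∀ f c a e, ∑ m, C c a m * C f m e =
    ∑ m, C f c m * C m a e + ∑ m, C f a m * C c m e) (c : Fin n) {s : ℕ}
    (T : (Fin s → Fin n) → Ext ℝ n) :
    lieDer C c (plug (wform C) s T) =
      plug (wform C) s (fun μ => lieDer C c (T μ) + idxAct (C c) T μ) := by
  induction s with
  | zero => simp [plug_zero, idxAct_zero]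
  | succ s ih =>
    rw [plug_add, plug_idxAct_succ, plug_succ, plug_succ (T := fun μ => lieDer C c (T μ))]
    simp only [map_sum, lieDer_mul, ih, plug_add, mul_add, Finset.sum_add_distrib,
      lieDer_wform hJ]
    abel

/-- The cochain of a polynomial as an element of the exterior algebra. -/
def polyForm (C : Fin n → Fin n → Fin n → ℝ) {s : ℕ} (k : Tensor n (s + 1)) : Ext ℝ n :=
  plug (wform C) s fun μ => ∑ j, k (Fin.cons j μ) • th j

/-- The polynomial `k` with all but one index contracted with the curvature forms. -/
def polyRest (C : Fin n → Fin n → Fin n → ℝ) {s : ℕ} (k : Tensor n (s + 1)) (σ : Fin n) :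
    Ext ℝ n :=
  plug (wform C) s fun μ => algebraMap ℝ _ (k (Fin.cons σ μ))

variable {s : ℕ} {k : Tensor n (s + 1)}

lemma nel_polyCochain (hk : IsSymm k) : nel (polyCochain C k) = polyForm C k := by
  have hk' : PermInv k := hk
  rw [polyCochain, antisym_eq_alt, nel_alt]
  refine (el_sum_rawProd_snoc C k).trans ?_
  simp only [hk'.snoc]
  rfl

lemma lieInv_polyForm (hJ : ∀ f c a e, ∑ m, C c a m * C f m e =
    ∑ m, C f c m * C m a e + ∑ m, C f a m * C c m e) (hi : IsInvariant C k) :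
    LieInv C (polyForm C k) := by
  intro c
  rw [polyForm, lieDer_plug hJ]
  have h : ∀ μ : Fin s → Fin n, lieDer C c (∑ j, k (Fin.cons j μ) • th j) +
      idxAct (C c) (fun μ => ∑ j, k (Fin.cons j μ) • th j) μ = 0 := by
    intro μ
    have h1 : lieDer C c (∑ j, k (Fin.cons j μ) • th j) =
        ∑ i, (∑ ν, C c i ν * k (Fin.cons ν μ)) • th i := by
      simp only [map_sum, map_smul, lieDer_th, Finset.smul_sum, Finset.sum_smul, smul_smul]
      rw [Finset.sum_comm]
      exact Finset.sum_congr rfl fun i _ => Finset.sum_congr rfl fun ν _ => by rw [mul_comm]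
    have h2 : idxAct (C c) (fun μ => ∑ j, k (Fin.cons j μ) • th j) μ =
        ∑ i, (∑ a, ∑ κ, C c (μ a) κ * k (Fin.cons i (Function.update μ a κ))) • th i := by
      simp only [idxAct, Finset.smul_sum, Finset.sum_smul, smul_smul]
      rw [Finset.sum_comm (s := (Finset.univ : Finset (Fin n)))
        (t := (Finset.univ : Finset (Fin s)))]
      exact Finset.sum_congr rfl fun a _ => Finset.sum_comm
    rw [h1, h2, ← Finset.sum_add_distrib]
    simp only [← add_smul, hi.cons, zero_smul, Finset.sum_const_zero]
  simp only [h, plug_zero_fun]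

lemma isInvariant_polyCochain (hJ : ∀ f c a e, ∑ m, C c a m * C f m e =
    ∑ m, C f c m * C m a e + ∑ m, C f a m * C c m e) (hk : IsSymm k) (hi : IsInvariant C k) :
    IsInvariant C (polyCochain C k) := by
  have hs : Skew (polyCochain C k) := skew_antisym _
  rw [← lieInv_iff_isInvariant hs, nel_polyCochain hk]
  exact lieInv_polyForm hJ hi

/-- Multiply the invariance equation of `k` by a generator and the forms `wform`, then sum. The
action on the free slot `j` completes a further curvature form, the action on the slot `b` gives the
right-hand side up to sign, and the action on the contracted slots vanishes by
`sum_mul_plug_idxAct`. -/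
lemma polyRest_succ {s : ℕ} {k : Tensor n (s + 2)} (hC : ∀ i j k, C i j k = -C j i k)
    (hJ : ∀ f c a e, ∑ m, C c a m * C f m e =
      ∑ m, C f c m * C m a e + ∑ m, C f a m * C c m e)
    (hk : PermInv k) (hi : IsInvariant C k) (b : Fin n) :
    polyRest C k b = ∑ ν, (∑ i, C b i ν • th i) *
      plug (wform C) s fun μ => ∑ j, k (Fin.cons j (Fin.cons ν μ : Fin (s + 1) → Fin n)) • th j := by
  set X : Fin n → (Fin s → Fin n) → Ext ℝ n := fun ν μ =>
    ∑ j, k (Fin.cons j (Fin.cons ν μ : Fin (s + 1) → Fin n)) • th j with hX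
  have hinv : ∀ i μ, ∑ j, (∑ ν, C i j ν * k (Fin.cons ν (Fin.cons b μ : Fin (s + 1) → Fin n))) •
      (th j : Ext ℝ n) + ∑ ν, C i b ν • X ν μ + idxAct (C i) (X b) μ = 0 := by
    intro i μ
    have h1 : ∑ ν, C i b ν • X ν μ = ∑ j, (∑ ν, C i b ν *
        k (Fin.cons j (Fin.cons ν μ : Fin (s + 1) → Fin n))) • (th j : Ext ℝ n) := by
      simp only [hX, Finset.smul_sum, Finset.sum_smul, smul_smul]
      exact Finset.sum_comm
    have h2 : idxAct (C i) (X b) μ = ∑ j, (∑ a, ∑ κ, C i (μ a) κ *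
        k (Fin.cons j (Fin.cons b (Function.update μ a κ) : Fin (s + 1) → Fin n))) • th j := by
      simp only [hX, idxAct, Finset.smul_sum, Finset.sum_smul, smul_smul]
      rw [Finset.sum_comm (s := (Finset.univ : Finset (Fin n)))
        (t := (Finset.univ : Finset (Fin s)))]
      exact Finset.sum_congr rfl fun a _ => Finset.sum_comm
    rw [h1, h2, ← Finset.sum_add_distrib, ← Finset.sum_add_distrib]
    refine Finset.sum_eq_zero fun j _ => ?_
    rw [← add_smul, ← add_smul]
    have := hi.cons i j (Fin.cons b μ)
    rw [Fin.sum_univ_succ] at this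
    simp only [Fin.cons_zero, Fin.cons_succ, Fin.update_cons_zero, ← Fin.cons_update] at this
    rw [add_assoc, this, zero_smul]
  have h0 : ∑ i, th i * plug (wform C) s (fun μ =>
      ∑ j, (∑ ν, C i j ν * k (Fin.cons ν (Fin.cons b μ : Fin (s + 1) → Fin n))) •
      (th j : Ext ℝ n) + ∑ ν, C i b ν • X ν μ + idxAct (C i) (X b) μ) = 0 := by
    simp only [hinv, plug_zero_fun, mul_zero, Finset.sum_const_zero]
  simp only [plug_add, mul_add, Finset.sum_add_distrib] at h0
  rw [sum_mul_plug_idxAct (ev_wform C) C (sum_th_mul_wform hC hJ), add_zero] at h0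
  have e1 : ∑ i, th i * plug (wform C) s (fun μ =>
      ∑ j, (∑ ν, C i j ν * k (Fin.cons ν (Fin.cons b μ : Fin (s + 1) → Fin n))) •
      (th j : Ext ℝ n)) = polyRest C k b := by
    rw [polyRest, plug_succ]
    simp only [wform, Finset.sum_mul]
    rw [← sum_cycle₃]
    refine Finset.sum_congr rfl fun i _ => ?_
    rw [plug_sum, Finset.mul_sum]
    refine Finset.sum_congr rfl fun j _ => ?_
    simp only [Finset.sum_smul]
    rw [plug_sum, Finset.mul_sum]
    refine Finset.sum_congr rfl fun ν _ => ?_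
    rw [smul_mul_assoc, mul_assoc, mul_plug (ev_wform C) (th j), ← mul_smul_comm, ← plug_smul]
    congr 2
    funext μ
    rw [← Algebra.commutes, ← Algebra.smul_def, smul_smul, hk.cons_cons]
  have e2 : ∑ i, th i * plug (wform C) s (fun μ => ∑ ν, C i b ν • X ν μ) =
      -∑ ν, (∑ i, C b i ν • th i) * plug (wform C) s (X ν) := by
    simp only [plug_sum, plug_smul, Finset.mul_sum, Finset.sum_mul]
    rw [Finset.sum_comm, ← Finset.sum_neg_distrib]
    refine Finset.sum_congr rfl fun ν _ => ?_
    rw [← Finset.sum_neg_distrib]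
    refine Finset.sum_congr rfl fun i _ => ?_
    rw [mul_smul_comm, smul_mul_assoc, hC i b, neg_smul]
  rw [e1, e2] at h0
  rw [← sub_eq_zero, sub_eq_add_neg]
  exact h0

/-- The contractions of the cocycle of an invariant polynomial. -/
theorem con_polyForm (hC : ∀ i j k, C i j k = -C j i k)
    (hJ : ∀ f c a e, ∑ m, C c a m * C f m e =
      ∑ m, C f c m * C m a e + ∑ m, C f a m * C c m e)
    (hk : IsSymm k) (hi : IsInvariant C k) (b : Fin n) :
    con b (polyForm C k) = ((2 * s + 1 : ℕ) : ℝ) • polyRest C k b := by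
  have hcon : ∀ {m : ℕ} (k : Tensor n (m + 1)) (μ : Fin m → Fin n),
      con b (∑ j, k (Fin.cons j μ) • th j) = algebraMap ℝ (Ext ℝ n) (k (Fin.cons b μ)) := by
    intro m k μ
    simp [Algebra.algebraMap_eq_smul_one]
  cases s with
  | zero => simp [polyForm, polyRest, plug_zero, Algebra.algebraMap_eq_smul_one]
  | succ s =>
    have hk' : PermInv k := hk
    have hT : PermInv fun μ : Fin (s + 1) → Fin n => ∑ j, k (Fin.cons j μ) • (th j : Ext ℝ n) :=
      fun σ μ => Finset.sum_congr rfl fun j _ => congrArg (· • (th j : Ext ℝ n)) (hk'.cons j σ μ)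
    -- Contracting the free generator gives `polyRest` once. Each of the `s + 1` curvature forms
    -- gives it twice, since `con_wform` carries a factor `2`; the total is `2 (s + 1) + 1`.
    rw [polyForm, con_plug (ev_wform C) b hT]
    simp only [hcon, con_wform hC]
    have h1 := polyRest_succ hC hJ hk' hi b
    simp only [smul_mul_assoc, ← Finset.smul_sum]
    rw [← h1, polyRest, smul_smul]
    push_cast
    module

end PolyCochain

/-! ### Structure constants of a Lie algebra with nondegenerate Killing form -/

/-- For each fixed first argument, the inner sum of `ceDiff` is literally the invariance condition.
-/
lemma IsInvariant.isCocycle {n q : ℕ} {C : Fin n → Fin n → Fin n → ℝ} {α : Tensor n q}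
    (hs : IsSkew α) (hi : IsInvariant C α) : IsCocycle C α := by
  refine ⟨hs, funext fun K => ?_⟩
  have h : ∀ i : Fin (q + 1), ∑ j : Fin q, ∑ ν : Fin n, C (K i) (K (i.succAbove j)) ν *
      α (Function.update (fun l : Fin q => K (i.succAbove l)) j ν) = 0 := fun i =>
    hi (K i) fun l => K (i.succAbove l)
  simp [ceDiff, h]

section Killing

variable {n : ℕ} {C : Fin n → Fin n → Fin n → ℝ} {K G : Fin n → Fin n → ℝ}

/-- The inverse of an invariant symmetric form is invariant. -/
lemma inverse_invariant (inv : ∀ a i j, ∑ ν, C a i ν * K ν j + ∑ ν, C a j ν * K i ν = 0)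
    (hGK : Matrix.of G * Matrix.of K = 1) (a i j : Fin n) :
    ∑ ν, C a ν i * G ν j + ∑ ν, G i ν * C a ν j = 0 := by
  have hKG : Matrix.of K * Matrix.of G = 1 := mul_eq_one_comm.1 hGK
  have hinv : Matrix.of (C a) * Matrix.of K = -(Matrix.of K * (Matrix.of (C a))ᵀ) := by
    rw [eq_neg_iff_add_eq_zero]
    ext i j
    simp only [Matrix.add_apply, Matrix.mul_apply, Matrix.of_apply, Matrix.transpose_apply,
      Matrix.zero_apply, mul_comm (K i _)]
    exact inv a i j
  have h : (Matrix.of (C a))ᵀ * Matrix.of G + Matrix.of G * Matrix.of (C a) = 0 := by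
    have h1 : Matrix.of G * (Matrix.of (C a) * Matrix.of K) * Matrix.of G =
        Matrix.of G * -(Matrix.of K * (Matrix.of (C a))ᵀ) * Matrix.of G := by rw [hinv]
    rw [mul_assoc, mul_assoc _ (Matrix.of K), hKG, mul_one, mul_neg, ← mul_assoc, hGK, one_mul,
      neg_mul] at h1
    rw [h1, add_neg_cancel]
  have := congrFun (congrFun h i) j
  simpa [Matrix.mul_apply] using this

/-- With its last index lowered by `K`, the structure tensor is cyclic. This turns the Casimir
matrix times `K` into the trace formula for `K`; cancelling `K` gives eigenvalue `1`. -/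
lemma CasimirData.of_killing (anti : ∀ i j k, C i j k = -C j i k)
    (jacobi : ∀ f c a e, ∑ m, C c a m * C f m e = ∑ m, C f c m * C m a e + ∑ m, C f a m * C c m e)
    (hK : ∀ i j, K i j = ∑ p, ∑ q, C j p q * C i q p)
    (inv : ∀ a i j, ∑ ν, C a i ν * K ν j + ∑ ν, C a j ν * K i ν = 0)
    (symm : ∀ i j, K i j = K j i)
    (hGK : Matrix.of G * Matrix.of K = 1) : CasimirData C G 1 := by
  have hKG : Matrix.of K * Matrix.of G = 1 := mul_eq_one_comm.1 hGK
  have hGs : (Matrix.of G)ᵀ = Matrix.of G := by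
    have hKs : (Matrix.of K)ᵀ = Matrix.of K := by ext i j; exact symm j i
    have h := congrArg Matrix.transpose hKG
    rw [Matrix.transpose_mul, hKs, Matrix.transpose_one] at h
    calc (Matrix.of G)ᵀ = (Matrix.of G)ᵀ * (Matrix.of K * Matrix.of G) := by rw [hKG, mul_one]
      _ = Matrix.of G := by rw [← mul_assoc, h, one_mul]
  have hcyc : ∀ i j k, ∑ f, C i j f * K f k = ∑ f, C k i f * K f j := by
    intro i j k
    have h1 := inv i j k
    simp only [symm j] at h1
    simp only [anti k i, neg_mul, Finset.sum_neg_distrib]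
    exact eq_neg_of_add_eq_zero_left h1
  refine ⟨anti, jacobi, fun i j => congrFun (congrFun hGs j) i, inverse_invariant inv hGK,
    one_ne_zero, ?_⟩
  · set Z : Matrix (Fin n) (Fin n) ℝ :=
      Matrix.of fun a f => ∑ b, ∑ c, ∑ e, G b c * (C c a e * C b e f) with hZ
    have hZK : Z * Matrix.of K = Matrix.of K := by
      ext a x
      have hCK : ∀ b e, ∑ f, C b e f * K f x = ∑ f, C x b f * K f e := fun b e => hcyc b e x
      have hCK' : ∀ c f, ∑ e, C c a e * K e f = ∑ e, C a f e * K e c := fun c f => by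
        rw [hcyc a f c]
      have hG1 : ∀ e b, ∑ c, G b c * K e c = if b = e then 1 else 0 := fun e b => by
        have := congrFun (congrFun hGK b) e
        rw [Matrix.mul_apply, Matrix.one_apply] at this
        simpa [symm e] using this
      calc (Z * Matrix.of K) a x
          = ∑ b, ∑ c, ∑ e, G b c * C c a e * ∑ f, C b e f * K f x := by
            simp only [hZ, Matrix.mul_apply, Matrix.of_apply, Finset.sum_mul, Finset.mul_sum]
            rw [← sum_cycle₄ fun b c e f => G b c * (C c a e * C b e f) * K f x]
            exact Finset.sum_congr rfl fun b _ => Finset.sum_congr rfl fun c _ =>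
              Finset.sum_congr rfl fun e _ => Finset.sum_congr rfl fun f _ => by ring
        _ = ∑ b, ∑ c, ∑ f, G b c * C x b f * ∑ e, C c a e * K e f := by
            simp only [hCK, Finset.mul_sum]
            refine Finset.sum_congr rfl fun b _ => Finset.sum_congr rfl fun c _ => ?_
            rw [Finset.sum_comm]
            exact Finset.sum_congr rfl fun f _ => Finset.sum_congr rfl fun e _ => by
              rw [symm e]; ring
        _ = ∑ b, ∑ f, ∑ e, C x b f * C a f e * ∑ c, G b c * K e c := by
            simp only [hCK', Finset.mul_sum]
            refine Finset.sum_congr rfl fun b _ => ?_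
            rw [← sum_cycle₃ fun f e c => G b c * C x b f * (C a f e * K e c)]
            exact Finset.sum_congr rfl fun f _ => Finset.sum_congr rfl fun e _ =>
              Finset.sum_congr rfl fun c _ => by ring
        _ = ∑ b, ∑ f, C x b f * C a f b := by simp [hG1]
        _ = K a x := (hK a x).symm
    have hZ1 : Z = 1 := by
      have := congrArg (· * Matrix.of G) hZK
      simpa only [mul_assoc, hKG, mul_one] using this
    intro a f
    have := congrFun (congrFun hZ1 a) f
    rwa [Matrix.one_apply] at this

end Killing

/-! ### Structure constants, the Killing form and perfectness of simple Lie algebras. -/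

section LieAlgebra

variable {𝒢 : Type*} [LieRing 𝒢] [LieAlgebra ℝ 𝒢] {n : ℕ} (b : Module.Basis (Fin n) ℝ 𝒢)

lemma lie_basis (i j : Fin n) : ⁅b i, b j⁆ = ∑ k, structConst b i j k • b k :=
  (b.sum_repr _).symm

lemma structConst_anti (i j k : Fin n) : structConst b i j k = -structConst b j i k := by
  rw [structConst, ← lie_skew, map_neg, Finsupp.neg_apply]; rfl

lemma repr_lie_right (x : 𝒢) (i e : Fin n) :
    b.repr ⁅b i, x⁆ e = ∑ m, b.repr x m * structConst b i m e := by
  conv_lhs => rw [← b.sum_repr x]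
  simp only [lie_sum, lie_smul, map_sum, map_smul, Finsupp.coe_finsetSum, Finset.sum_apply,
    Finsupp.coe_smul, Pi.smul_apply, smul_eq_mul]
  rfl

lemma structConst_jacobi (f c a e : Fin n) :
    ∑ m, structConst b c a m * structConst b f m e =
      ∑ m, structConst b f c m * structConst b m a e +
        ∑ m, structConst b f a m * structConst b c m e := by
  have h := congrArg (fun x => b.repr x e) (leibniz_lie (b f) (b c) (b a))
  simp only [map_add, Finsupp.add_apply] at h
  rw [repr_lie_right b ⁅b c, b a⁆, repr_lie_right b ⁅b f, b a⁆] at h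
  refine h.trans (congrArg (· + _) ?_)
  rw [← lie_skew, map_neg, Finsupp.neg_apply, repr_lie_right, ← Finset.sum_neg_distrib]
  exact Finset.sum_congr rfl fun m _ => by rw [structConst_anti b a m]; simp [structConst]

lemma killingMatrix_eq (i j : Fin n) :
    killingMatrix b i j = ∑ p, ∑ q, structConst b j p q * structConst b i q p := by
  classical
  rw [killingMatrix, Matrix.of_apply, killingForm_apply_apply, LinearMap.trace_eq_matrix_trace ℝ b,
    Matrix.trace]
  refine Finset.sum_congr rfl fun p _ => ?_
  rw [Matrix.diag_apply, LinearMap.toMatrix_apply]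
  simp only [LinearMap.comp_apply, LieAlgebra.ad_apply]
  exact repr_lie_right b _ i p

lemma killingMatrix_symm (i j : Fin n) : killingMatrix b i j = killingMatrix b j i :=
  LieModule.traceForm_comm ℝ 𝒢 𝒢 _ _

lemma killingMatrix_invariant (a i j : Fin n) :
    ∑ ν, structConst b a i ν * killingMatrix b ν j +
      ∑ ν, structConst b a j ν * killingMatrix b i ν = 0 := by
  have h1 : ∑ ν, structConst b a i ν * killingMatrix b ν j = killingForm ℝ 𝒢 ⁅b a, b i⁆ (b j) := by
    rw [lie_basis, map_sum, LinearMap.sum_apply]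
    simp [killingMatrix]
  have h2 : ∑ ν, structConst b a j ν * killingMatrix b i ν = killingForm ℝ 𝒢 (b i) ⁅b a, b j⁆ := by
    rw [lie_basis, map_sum]
    simp [killingMatrix]
  have h3 : killingForm ℝ 𝒢 ⁅b i, b a⁆ (b j) = killingForm ℝ 𝒢 (b i) ⁅b a, b j⁆ :=
    LieModule.traceForm_apply_lie_apply ℝ 𝒢 𝒢 _ _ _
  rw [h1, h2, ← h3, ← lie_skew, map_neg, LinearMap.neg_apply, neg_add_cancel]

lemma casimirData_killing (h : (killingMatrix b).det ≠ 0) :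
    CasimirData (structConst b) (fun i j => (killingMatrix b)⁻¹ i j) 1 :=
  CasimirData.of_killing (structConst_anti b) (structConst_jacobi b) (killingMatrix_eq b)
    (killingMatrix_invariant b) (killingMatrix_symm b) 
    (show (killingMatrix b)⁻¹ * killingMatrix b = 1 from Matrix.nonsing_inv_mul _ h.isUnit)

/-- A simple algebra has trivial radical, so in characteristic zero Cartan's criterion applies. -/
lemma det_killingMatrix_ne_zero [LieAlgebra.IsSimple ℝ 𝒢] : (killingMatrix b).det ≠ 0 := by
  have : Module.Finite ℝ 𝒢 := Module.Finite.of_basis b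
  have : LieAlgebra.HasTrivialRadical ℝ 𝒢 := inferInstance
  have h := LieAlgebra.IsKilling.killingForm_nondegenerate ℝ 𝒢
  have h2 := (LinearMap.BilinForm.nondegenerate_toMatrix_iff b).2 h
  rw [Matrix.nondegenerate_iff_det_ne_zero] at h2
  convert h2 using 2
  ext i j
  simp [killingMatrix]

/-- A linear form that vanishes on brackets vanishes if the Lie algebra is simple. -/
lemma eq_zero_of_forall_lie [LieAlgebra.IsSimple ℝ 𝒢] {φ : 𝒢 →ₗ[ℝ] ℝ}
    (h : ∀ x y : 𝒢, φ ⁅x, y⁆ = 0) : φ = 0 := by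
  -- The kernel is an ideal because it contains all brackets. If it were zero, the algebra would be
  -- abelian.
  let I : LieIdeal ℝ 𝒢 := { LinearMap.ker φ with lie_mem := fun {x m} _ => h x m }
  have hI : ∀ x, x ∈ I ↔ φ x = 0 := fun x => Iff.rfl
  rcases LieAlgebra.IsSimple.eq_bot_or_eq_top (R := ℝ) I with h0 | h0
  · refine absurd (⟨fun x y => ?_⟩ : IsLieAbelian 𝒢) (LieAlgebra.IsSimple.non_abelian ℝ)
    have := (hI ⁅x, y⁆).2 (h x y)
    rwa [h0, LieSubmodule.mem_bot] at this
  · ext x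
    exact (hI x).1 (h0 ▸ LieSubmodule.mem_top x)

lemma eq_zero_of_sum_structConst [LieAlgebra.IsSimple ℝ 𝒢] {v : Fin n → ℝ}
    (h : ∀ i j, ∑ k, structConst b i j k * v k = 0) : v = 0 := by
  have hφ : ∀ x, Fintype.linearCombination ℝ v (b.equivFun x) = ∑ k, b.repr x k * v k := fun x => by
    simp [Fintype.linearCombination_apply]
  let φ : 𝒢 →ₗ[ℝ] ℝ := (Fintype.linearCombination ℝ v).comp b.equivFun.toLinearMap
  have h2 : φ = 0 := eq_zero_of_forall_lie fun x y => by
    have : ∀ i, φ ∘ₗ (LieAlgebra.ad ℝ 𝒢 (b i) : 𝒢 →ₗ[ℝ] 𝒢) = 0 := fun i =>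
      b.ext fun j => (hφ _).trans (h i j)
    have h3 : ∀ i, φ ⁅b i, y⁆ = 0 := fun i => LinearMap.congr_fun (this i) y
    rw [← b.sum_repr x, sum_lie, map_sum]
    exact Finset.sum_eq_zero fun i _ => by rw [smul_lie, map_smul, h3, smul_zero]
  ext i
  have := LinearMap.congr_fun h2 (b i)
  simpa [φ, Fintype.linearCombination_apply, Finsupp.single_apply] using this

end LieAlgebra

/-! ### The singular case of bivector fields -/

section Bivector

variable {n : ℕ}

/-- The bracket of two functions defined by a bivector field and a vector field. -/
def bracket₂ (Λ : (Fin n → ℝ) → Fin n → Fin n → ℝ) (ξ : Fin n → ℝ) (g h : (Fin n → ℝ) → ℝ)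
    (x : Fin n → ℝ) : ℝ :=
  ∑ a, ∑ b, Λ x a b * (pderiv a g x * pderiv b h x) + g x * ∑ a, ξ a * pderiv a h x -
    h x * ∑ a, ξ a * pderiv a g x

lemma jacobiBracket_bivector (Λ : TensorField n (2 * 0 + 2)) (ξ : Tensor n (2 * 0 + 1))
    (f : Fin (2 * 0 + 2) → (Fin n → ℝ) → ℝ) :
    jacobiBracket Λ (constField ξ) f =
      bracket₂ (fun x a b => Λ x ![a, b]) (fun a => ξ ![a]) (f 0) (f 1) := by
  ext x
  have h1 : ∀ (T : Tensor n (2 * 0 + 1)) (g : Fin (2 * 0 + 1) → (Fin n → ℝ) → ℝ),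
      evalD (constField T) g x = ∑ a, T ![a] * pderiv a (g 0) x := by
    intro T g
    rw [evalD, ← (Equiv.funUnique (Fin 1) (Fin n)).symm.sum_comp]
    refine Finset.sum_congr rfl fun a _ => ?_
    have : (Equiv.funUnique (Fin 1) (Fin n)).symm a = ![a] := by ext i; simp
    rw [this]
    simp [constField]
  have h2 : evalD Λ f x = ∑ a, ∑ b, Λ x ![a, b] * (pderiv a (f 0) x * pderiv b (f 1) x) := by
    rw [evalD, ← (finTwoArrowEquiv (Fin n)).symm.sum_comp, Fintype.sum_prod_type]
    refine Finset.sum_congr rfl fun a _ => Finset.sum_congr rfl fun b _ => ?_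
    congr 1
    exact Fin.prod_univ_two fun j => pderiv ((![a, b] : Fin 2 → Fin n) j) (f j) x
  have h3 : ∀ F : Fin (2 * 0 + 2) → ℝ, ∑ j, F j = F 0 + F 1 := fun F => Fin.sum_univ_two F
  rw [jacobiBracket, h2, h3, h1, h1, bracket₂]
  simp only [Fin.val_zero, pow_zero, one_mul]
  have e0 : (0 : Fin (2 * 0 + 2)).succAbove (0 : Fin (2 * 0 + 1)) = 1 := rfl
  have e1 : (1 : Fin (2 * 0 + 2)).succAbove (0 : Fin (2 * 0 + 1)) = 0 := rfl
  have e2 : ((1 : Fin (2 * 0 + 2)) : ℕ) = 1 := rfl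
  rw [e0, e1, e2]
  ring

lemma sum_perm_three {M : Type*} [AddCommMonoid M] (F : Equiv.Perm (Fin 3) → M) :
    ∑ σ, F σ = F 1 + F (Equiv.swap 0 1 * Equiv.swap 1 2) + F (Equiv.swap 1 2 * Equiv.swap 0 1) +
      F (Equiv.swap 0 1) + F (Equiv.swap 1 2) + F (Equiv.swap 0 2) := by
  have : (Finset.univ : Finset (Equiv.Perm (Fin 3))) = {1, Equiv.swap 0 1 * Equiv.swap 1 2,
      Equiv.swap 1 2 * Equiv.swap 0 1, Equiv.swap 0 1, Equiv.swap 1 2, Equiv.swap 0 2} := by decide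
  rw [this]
  repeat rw [Finset.sum_insert (by decide)]
  rw [Finset.sum_singleton]
  simp only [add_assoc]

lemma sum_perm_three_apply {M : Type*} [AddCommMonoid M] (F : ℤˣ → Fin 3 → Fin 3 → Fin 3 → M) :
    ∑ σ : Equiv.Perm (Fin 3), F (Equiv.Perm.sign σ) (σ 0) (σ 1) (σ 2) =
      F 1 0 1 2 + F 1 1 2 0 + F 1 2 0 1 + F (-1) 1 0 2 + F (-1) 0 2 1 + F (-1) 2 1 0 := by
  rw [sum_perm_three]
  congr 1

lemma sum_perm_two {M : Type*} [AddCommMonoid M] (F : Equiv.Perm (Fin 2) → M) :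
    ∑ σ, F σ = F 1 + F (Equiv.swap 0 1) := by
  have : (Finset.univ : Finset (Equiv.Perm (Fin 2))) = {1, Equiv.swap 0 1} := by decide
  rw [this, Finset.sum_insert (by decide), Finset.sum_singleton]

lemma IsGenJacobi.bracket₂ {Λ : TensorField n (2 * 0 + 2)} {ξ : Tensor n (2 * 0 + 1)}
    (h : IsGenJacobi (r := 0) Λ (constField ξ)) (f : Fin 3 → (Fin n → ℝ) → ℝ)
    (hf : ∀ i, ContDiff ℝ ((⊤ : ℕ∞) : WithTop ℕ∞) (f i)) (x : Fin n → ℝ) :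
    let B := GenJacobi.bracket₂ (fun x a b => Λ x ![a, b]) (fun a => ξ ![a])
    B (f 0) (B (f 1) (f 2)) x + B (f 1) (B (f 2) (f 0)) x + B (f 2) (B (f 0) (f 1)) x =
      B (f 1) (B (f 0) (f 2)) x + B (f 0) (B (f 2) (f 1)) x + B (f 2) (B (f 1) (f 0)) x := by
  intro B
  have h1 := h.jacobi f hf x
  simp only [jacobiBracket_bivector] at h1
  have h2 := sum_perm_three_apply fun ε i j k => ((ε : ℤ) : ℝ) * B (f i) (B (f j) (f k)) x
  have h3 := h2.symm.trans h1
  push_cast at h3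
  linarith

/-- The Jacobi structures with a linear bivector field and a constant vector field. -/
lemma IsGenJacobi.sum_mul_eq_zero {C : Fin n → Fin n → Fin n → ℝ}
    (hC : ∀ i j k, C i j k = -C j i k) {ξ : Tensor n (2 * 0 + 1)}
    (h : IsGenJacobi (r := 0) (linearField (fun I k => C (I 0) (I 1) k) +
      wedge (constField ξ) (dilatation n)) (constField ξ)) (i j : Fin n) :
    ∑ k, C i j k * ξ ![k] = 0 := by
  set Λ : TensorField n (2 * 0 + 2) :=
    linearField (fun I k => C (I 0) (I 1) k) + wedge (constField ξ) (dilatation n) with hΛ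
  have hΛ' : ∀ x a b, Λ x ![a, b] = ∑ k, C a b k * x k + (ξ ![a] * x b - ξ ![b] * x a) := by
    intro x a b
    have h1 : wedge (constField ξ) (dilatation n) x ![a, b] = ξ ![a] * x b - ξ ![b] * x a := by
      rw [wedge, Pi.smul_apply, antisym]
      have h2 := sum_perm_two fun σ => ((Equiv.Perm.sign σ : ℤ) : ℝ) *
        (ξ ![(![a, b] : Fin 2 → Fin n) (σ 0)] * x ((![a, b] : Fin 2 → Fin n) (σ 1)))
      have h3 : ∀ σ : Equiv.Perm (Fin 2), ξ (fun i => ((![a, b] : Fin 2 → Fin n) ∘ σ)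
          (Fin.castAdd 1 i)) = ξ ![(![a, b] : Fin 2 → Fin n) (σ 0)] := fun σ => by
        congr 1
        ext i
        have : i = 0 := Subsingleton.elim (α := Fin 1) _ _
        rw [this]
        rfl
      have h4 : ∑ σ : Equiv.Perm (Fin 2), ((Equiv.Perm.sign σ : ℤ) : ℝ) *
          (ξ (fun i => ((![a, b] : Fin 2 → Fin n) ∘ σ) (Fin.castAdd 1 i)) *
            x ((![a, b] : Fin 2 → Fin n) (σ 1))) = ξ ![a] * x b - ξ ![b] * x a := by
        simp only [h3]
        rw [h2]
        simp
        ring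
      refine Eq.trans ?_ h4
      simp only [Nat.factorial, smul_eq_mul]
      norm_num
      rfl
    rw [hΛ, Pi.add_apply, Pi.add_apply, h1]
    rfl
  set B := GenJacobi.bracket₂ (fun x a b => Λ x ![a, b]) (fun a => ξ ![a]) with hB
  have b1 : ∀ g, B (fun _ => 1) g = fun x => ∑ a, ξ ![a] * pderiv a g x := by
    intro g
    ext x
    simp [hB, GenJacobi.bracket₂]
  have b2 : ∀ g, B g (fun _ => 1) = fun x => -∑ a, ξ ![a] * pderiv a g x := by
    intro g
    ext x
    simp [hB, GenJacobi.bracket₂]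
  have b3 : ∀ i (c : ℝ) x, B (fun x => x i) (fun _ => c) x = -(c * ξ ![i]) := by
    intro i c x
    simp [hB, GenJacobi.bracket₂, pderiv_coord]
  -- On two coordinate functions the contribution of `E ∧ A` cancels the terms `x_i E(dx_j) - x_j
  -- E(dx_i)`, so only the Lie bracket remains.
  have b4 : ∀ i j, B (fun x => x i) (fun x => x j) = fun x => ∑ k, C i j k * x k := by
    intro i j
    ext x
    simp [hB, GenJacobi.bracket₂, pderiv_coord, hΛ']
    ring
  have b5 : ∀ (x : Fin n → ℝ) i j, ∑ a, ξ ![a] * pderiv a (fun x => ∑ k, C i j k * x k) x =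
      ∑ a, C i j a * ξ ![a] := by
    intro x i j
    refine Finset.sum_congr rfl fun a _ => ?_
    rw [pderiv_sum fun k _ => (by fun_prop)]
    simp only [pderiv_const_mul _ (differentiableAt_apply _ _), pderiv_coord]
    simp [mul_comm]
  have b6 : ∀ (x : Fin n → ℝ) j, ∑ a, ξ ![a] * pderiv a (fun x => x j) x = ξ ![j] := by
    intro x j
    simp [pderiv_coord]
  have hf : ∀ m : Fin 3, ContDiff ℝ ((⊤ : ℕ∞) : WithTop ℕ∞)
      ((![fun _ => 1, fun x => x i, fun x => x j] : Fin 3 → (Fin n → ℝ) → ℝ) m) := by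
    intro m
    fin_cases m
    · exact contDiff_const
    · exact contDiff_apply _ _ _
    · exact contDiff_apply _ _ _
  -- For the functions `1, x_i, x_j` the identity says that `∑ C_ij^k ξ_k` equals its own negative,
  -- as the products `ξ_i ξ_j` cancel within each cyclic sum.
  have key := h.bracket₂ _ hf 0
  simp only [← hB] at key
  simp only [Matrix.cons_val_zero, Matrix.cons_val_one, Matrix.cons_val, b1, b2, b4, b5, b6, b3] at key
  have e : ∑ k, C j i k * ξ ![k] = -∑ k, C i j k * ξ ![k] := by
    rw [← Finset.sum_neg_distrib]
    exact Finset.sum_congr rfl fun k _ => by rw [hC]; ring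
  linarith

end Bivector

/-! ### Conclusions for simple Lie algebras. -/

section Simple

variable {𝒢 : Type*} [LieRing 𝒢] [LieAlgebra ℝ 𝒢] {n : ℕ} (b : Module.Basis (Fin n) ℝ 𝒢)

theorem eq_zero_of_isGenJacobi_structConst [LieAlgebra.IsSimple ℝ 𝒢] {ξ : Tensor n (2 * 0 + 1)}
    (h : IsGenJacobi (r := 0) (linearField (fun I k => structConst b (I 0) (I 1) k) +
      wedge (constField ξ) (dilatation n)) (constField ξ)) : ξ = 0 := by
  have h1 := eq_zero_of_sum_structConst b (h.sum_mul_eq_zero (structConst_anti b))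
  ext I
  have h2 : I = ![I 0] := by
    ext i
    have : i = 0 := Subsingleton.elim (α := Fin 1) _ _
    rw [this]
    rfl
  rw [h2]
  exact congrFun h1 (I 0)

theorem structures_raiseLast (h : (killingMatrix b).det ≠ 0) {r : ℕ} {α : Tensor n (2 * r + 3)}
    (hα : IsSkew α) (hi : IsInvariant (structConst b) α) :
    IsGenPoisson (r := r) (linearField (raiseLast b α)) ∧
      (∀ (q : ℕ) (β : Tensor n (q + 1)), IsSkew β → IsInvariant (structConst b) β →
        poissonCoboundary (r := r) (linearField (raiseLast b α)) (constField β) = 0) ∧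
      ∀ β : Tensor n (2 * r + 1), IsSkew β → IsInvariant (structConst b) β →
        IsGenJacobi (r := r) (linearField (raiseLast b α) +
          wedge (constField β) (dilatation n)) (constField β) :=
  (casimirData_killing b h).structures hα hi

end Simple

/-! ### The symmetrized trace polynomials -/

section SymTrace

variable (R : Type*) [CommRing R] (N m : ℕ)

/-- The symmetrized trace `∑_σ tr (h_{σ 1} ⋯ h_{σ m})`. -/
def symTrace : MultilinearMap R (fun _ : Fin m => Matrix (Fin N) (Fin N) R) R :=
  ∑ σ : Equiv.Perm (Fin m), ((Matrix.traceLinearMap (Fin N) R R).compMultilinearMap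
    (MultilinearMap.mkPiAlgebraFin R m (Matrix (Fin N) (Fin N) R))).domDomCongr σ

variable {R N m}

lemma symTrace_apply (h : Fin m → Matrix (Fin N) (Fin N) R) :
    symTrace R N m h = ∑ σ : Equiv.Perm (Fin m), (List.ofFn fun j => h (σ j)).prod.trace := by
  simp [symTrace]

lemma symTrace_comp_perm (h : Fin m → Matrix (Fin N) (Fin N) R) (τ : Equiv.Perm (Fin m)) :
    symTrace R N m (h ∘ τ) = symTrace R N m h := by
  rw [symTrace_apply, symTrace_apply, ← Equiv.sum_comp (Equiv.mulLeft τ⁻¹)]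
  simp

/-- The commutator with `x` is a derivation of the product. -/
lemma sum_prod_update_commutator {A : Type*} [Ring A] (x : A) (h : Fin m → A) :
    ∑ s, (List.ofFn (Function.update h s (x * h s - h s * x))).prod =
      x * (List.ofFn h).prod - (List.ofFn h).prod * x := by
  induction m with
  | zero => simp
  | succ m ih =>
    rw [Fin.sum_univ_succ]
    have h1 : ∀ s : Fin m, (List.ofFn (Function.update h s.succ
        (x * h s.succ - h s.succ * x))).prod = h 0 * (List.ofFn (Function.update (fun j => h j.succ) s
          (x * h s.succ - h s.succ * x))).prod := by
      intro s
      rw [List.ofFn_succ, List.prod_cons, Function.update_of_ne (Fin.succ_ne_zero s).symm]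
      congr 3
      funext j
      exact congrFun (Function.update_comp_eq_of_injective h (Fin.succ_injective m) s _) j
    have h2 : (List.ofFn (Function.update h 0 (x * h 0 - h 0 * x))).prod =
        (x * h 0 - h 0 * x) * (List.ofFn fun j : Fin m => h j.succ).prod := by
      rw [List.ofFn_succ, List.prod_cons, Function.update_self]
      congr 3
    simp only [h1, h2, ← Finset.mul_sum, ih fun j => h j.succ]
    rw [List.ofFn_succ, List.prod_cons]
    noncomm_ring

lemma sum_symTrace_update_commutator (x : Matrix (Fin N) (Fin N) R)
    (h : Fin m → Matrix (Fin N) (Fin N) R) :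
    ∑ s, symTrace R N m (Function.update h s (x * h s - h s * x)) = 0 := by
  simp only [symTrace_apply]
  rw [Finset.sum_comm]
  refine Finset.sum_eq_zero fun σ _ => ?_
  rw [← Equiv.sum_comp σ]
  have h1 : ∀ s, (fun j => Function.update h (σ s) (x * h (σ s) - h (σ s) * x) (σ j)) =
      Function.update (h ∘ σ) s (x * (h ∘ σ) s - (h ∘ σ) s * x) := by
    intro s
    rw [← Function.update_comp_eq_of_injective _ σ.injective]
    rfl
  simp only [h1, ← Matrix.trace_sum, sum_prod_update_commutator x (h ∘ σ)]
  rw [Matrix.trace_sub, Matrix.trace_mul_comm, sub_self]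

/-- The adjoint reverses a product of Hermitian matrices; precomposing the sum over permutations
with the reversal absorbs this, so the symmetrized trace is real. -/
lemma star_symTrace {h : Fin m → Matrix (Fin N) (Fin N) ℂ} (hh : ∀ j, (h j)ᴴ = h j) :
    star (symTrace ℂ N m h) = symTrace ℂ N m h := by
  rw [symTrace_apply, star_sum, ← Equiv.sum_comp (Equiv.mulRight (Fin.revPerm : Equiv.Perm (Fin m)))]
  refine Finset.sum_congr rfl fun σ _ => ?_
  rw [← Matrix.trace_conjTranspose, Matrix.conjTranspose_list_prod, List.map_ofFn]
  congr 2
  refine List.ext_getElem (by simp) fun i hi hi' => ?_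
  simp only [List.length_reverse, List.length_ofFn] at hi
  simp only [List.getElem_reverse, List.getElem_ofFn, Function.comp_apply, hh, List.length_ofFn,
    Equiv.coe_mulRight, Equiv.Perm.mul_apply, Fin.revPerm_apply]
  congr 2
  rw [← Fin.rev_rev (⟨i, _⟩ : Fin m)]
  congr 1
  ext
  simp [Fin.rev]
  omega

end SymTrace

/-! ### Reality, symmetry and invariance of the trace polynomials. -/

section TracePoly

variable {N n : ℕ} (b : Module.Basis (Fin n) ℝ (su N))

/-- The Hermitian matrices `H` with `b = i H`. -/
def herm (μ : Fin n) : Matrix (Fin N) (Fin N) ℂ :=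
  (-Complex.I) • (b μ : Matrix (Fin N) (Fin N) ℂ)

lemma conjTranspose_herm (μ : Fin n) : (herm b μ)ᴴ = herm b μ := by
  have h : (b μ : Matrix (Fin N) (Fin N) ℂ)ᴴ = -(b μ : Matrix (Fin N) (Fin N) ℂ) := (b μ).2.1
  rw [herm, Matrix.conjTranspose_smul, h]
  simp

lemma tracePoly_eq (m : ℕ) (K : Fin m → Fin n) :
    ((tracePoly b m K : ℝ) : ℂ) = (1 / (m.factorial : ℂ)) * symTrace ℂ N m fun j => herm b (K j) := by
  have h : tracePoly b m K = ((1 / (m.factorial : ℂ)) * symTrace ℂ N m fun j => herm b (K j)).re := by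
    rw [symTrace_apply]
    rfl
  rw [h]
  refine Complex.conj_eq_iff_re.1 ?_
  rw [map_mul]
  congr 1
  · simp
  · exact star_symTrace fun j => conjTranspose_herm b (K j)

lemma isSymm_tracePoly (m : ℕ) : IsSymm (tracePoly b m) := by
  intro σ K
  have h := symTrace_comp_perm (fun j => herm b (K j)) σ
  have h1 := tracePoly_eq b m (K ∘ σ)
  have h2 := tracePoly_eq b m K
  rw [← h] at h2
  exact Complex.ofReal_injective (h1.trans h2.symm)

lemma commutator_basis (i j : Fin n) :
    (b i : Matrix (Fin N) (Fin N) ℂ) * b j - b j * b i =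
      ∑ k, (structConst b i j k : ℂ) • (b k : Matrix (Fin N) (Fin N) ℂ) := by
  have h := congrArg (Subtype.val : su N → Matrix (Fin N) (Fin N) ℂ) (lie_basis b i j)
  rw [LieSubalgebra.coe_bracket, Ring.lie_def] at h
  refine (h.trans (map_sum (su N).toSubmodule.subtype _ _)).trans ?_
  exact Finset.sum_congr rfl fun k _ => (Complex.coe_smul _ _).symm

lemma sum_structConst_smul_herm (a i : Fin n) :
    ∑ ν, (structConst b a i ν : ℂ) • herm b ν =
      (b a : Matrix (Fin N) (Fin N) ℂ) * herm b i - herm b i * b a := by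
  simp only [herm, mul_smul_comm, smul_mul_assoc, ← smul_sub, commutator_basis, Finset.smul_sum]
  exact Finset.sum_congr rfl fun ν _ => smul_comm _ _ _

/-- By multilinearity, the invariance sum is the symmetrized trace of the derivation `[b_a, ·]`,
which is a trace of commutators. -/
lemma isInvariant_tracePoly (m : ℕ) : IsInvariant (structConst b) (tracePoly b m) := by
  intro a I
  have h := sum_symTrace_update_commutator (b a : Matrix (Fin N) (Fin N) ℂ) fun j => herm b (I j)
  have h1 : ∀ s, ∑ ν, (structConst b a (I s) ν : ℂ) * tracePoly b m (Function.update I s ν) =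
      (1 / (m.factorial : ℂ)) * symTrace ℂ N m (Function.update (fun j => herm b (I j)) s
        ((b a : Matrix (Fin N) (Fin N) ℂ) * herm b (I s) - herm b (I s) * b a)) := by
    intro s
    rw [← sum_structConst_smul_herm, MultilinearMap.map_update_sum, Finset.mul_sum]
    refine Finset.sum_congr rfl fun ν _ => ?_
    rw [MultilinearMap.map_update_smul, tracePoly_eq, smul_eq_mul, mul_left_comm]
    congr 4
    funext j
    exact Function.apply_update (fun _ => herm b) I s ν j
  apply Complex.ofReal_injective
  push_cast
  simp only [h1, ← Finset.mul_sum, h, mul_zero]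

end TracePoly

/-! ### Symmetrized traces with one distinguished argument. -/

section SymTraceExpansion

variable {R : Type*} [CommRing R] {N : ℕ}

lemma prod_ofFn_update_const {A : Type*} [Monoid A] {s : ℕ} (p : Fin (s + 1)) (Y Z : A) :
    (List.ofFn (Function.update (fun _ => Y) p Z)).prod = Y ^ (p : ℕ) * Z * Y ^ (s - p) := by
  induction s with
  | zero =>
    obtain rfl : p = 0 := Subsingleton.elim (α := Fin 1) _ _
    simp
  | succ s ih =>
    refine Fin.cases ?_ (fun p => ?_) p
    · rw [List.ofFn_succ, List.prod_cons, Function.update_self]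
      have : (fun i : Fin (s + 1) => Function.update (fun _ : Fin (s + 2) => Y) 0 Z i.succ) =
          fun _ => Y := by
        funext i
        rw [Function.update_of_ne (Fin.succ_ne_zero i)]
      rw [this]
      simp [pow_succ']
    · rw [List.ofFn_succ, List.prod_cons, Function.update_of_ne (Fin.succ_ne_zero p).symm]
      have : (fun i : Fin (s + 1) => Function.update (fun _ : Fin (s + 2) => Y) p.succ Z i.succ) =
          Function.update (fun _ => Y) p Z :=
        Function.update_comp_eq_of_injective (fun _ : Fin (s + 2) => Y) (Fin.succ_injective _) p Z
      rw [this, ih p]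
      simp [pow_succ', mul_assoc]

/-- By cyclicity of the trace, every permutation contributes the same value. -/
lemma symTrace_cons_const {s : ℕ} (Y Z : Matrix (Fin N) (Fin N) R) :
    symTrace R N (s + 1) (Fin.cons Z fun _ => Y) =
      ((s + 1).factorial : R) * (Z * Y ^ s).trace := by
  rw [symTrace_apply]
  have h : ∀ σ : Equiv.Perm (Fin (s + 1)), (List.ofFn fun j =>
      (Fin.cons Z fun _ => Y : Fin (s + 1) → Matrix (Fin N) (Fin N) R) (σ j)).prod.trace =
        (Z * Y ^ s).trace := by
    intro σ
    have h1 : (fun j => (Fin.cons Z fun _ => Y : Fin (s + 1) → Matrix (Fin N) (Fin N) R) (σ j)) =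
        Function.update (fun _ => Y) (σ.symm 0) Z := by
      funext j
      by_cases hj : j = σ.symm 0
      · subst hj; simp
      · rw [Function.update_of_ne hj]
        have : σ j ≠ 0 := fun h0 => hj (by rw [← h0, Equiv.symm_apply_apply])
        obtain ⟨i, hi⟩ := Fin.exists_succ_eq_of_ne_zero this
        rw [← hi, Fin.cons_succ]
    rw [h1, prod_ofFn_update_const, mul_assoc, Matrix.trace_mul_comm, mul_assoc, ← pow_add,
      Nat.sub_add_cancel (by omega)]
  simp only [h]
  simp [Fintype.card_perm]

lemma symTrace_cons_sum {n s : ℕ} (w : Fin n → R) (h : Fin n → Matrix (Fin N) (Fin N) R)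
    (Z : Matrix (Fin N) (Fin N) R) :
    symTrace R N (s + 1) (Fin.cons Z fun _ => ∑ μ, w μ • h μ) =
      ∑ μ : Fin s → Fin n, (∏ a, w (μ a)) * symTrace R N (s + 1) (Fin.cons Z fun a => h (μ a)) := by
  have h1 := (((symTrace R N (s + 1)).curryLeft Z).map_sum fun (_ : Fin s) (μ : Fin n) => w μ • h μ)
  refine h1.trans (Finset.sum_congr rfl fun μ _ => ?_)
  exact ((symTrace R N (s + 1)).curryLeft Z).map_smul_univ (fun a => w (μ a)) fun a => h (μ a)

lemma symTrace_map {S : Type*} [CommRing S] (f : R →+* S) {m : ℕ}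
    (h : Fin m → Matrix (Fin N) (Fin N) R) :
    symTrace S N m (fun j => f.mapMatrix (h j)) = f (symTrace R N m h) := by
  rw [symTrace_apply, symTrace_apply, map_sum]
  refine Finset.sum_congr rfl fun σ _ => ?_
  have h1 : (List.ofFn fun j => f.mapMatrix (h (σ j))).prod =
      f.mapMatrix (List.ofFn fun j => h (σ j)).prod := by
    rw [map_list_prod, List.map_ofFn]
    rfl
  rw [h1]
  exact (AddMonoidHom.map_trace f.toAddMonoidHom _).symm

end SymTraceExpansion

/-! ### Passage to complex coefficients. -/

section Complexification

variable {n : ℕ}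

lemma alt_ofReal {k : ℕ} (T : (Fin k → Fin n) → ℝ) (K : Fin k → Fin n) :
    alt (fun J => (T J : ℂ)) K = ((alt T K : ℝ) : ℂ) := by
  simp [alt]

/-- Vanishing is equivalent to vanishing of the skew-symmetrized components, and those commute with
the inclusion of the reals. -/
lemma plug_ofReal_eq_zero {C : Fin n → Fin n → Fin n → ℝ} {s : ℕ} {κ : (Fin s → Fin n) → ℝ}
    (h : plug (wform C) s (fun μ => algebraMap ℝ _ (κ μ)) = 0) :
    plug (wform fun i j k => (C i j k : ℂ)) s (fun μ => algebraMap ℂ _ (κ μ : ℂ)) = 0 := by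
  rw [← el_sum_rawProd, ← alt_eq_zero_iff] at h ⊢
  ext K
  have h1 := alt_ofReal (fun J : Fin (2 * s) → Fin n => ∑ μ, rawProd C μ J * κ μ) K
  rw [h] at h1
  rw [Pi.zero_apply, ← Complex.ofReal_zero]
  refine Eq.trans ?_ h1
  congr 1
  ext J
  simp [rawProd]

lemma od_ι {𝕜 : Type*} [Field 𝕜] (v : Fin n → 𝕜) : Od (ExteriorAlgebra.ι 𝕜 v : Ext 𝕜 n) :=
  CliffordAlgebra.involute_ι v

end Complexification

/-! ### Contracted trace polynomials as traces of powers of an odd matrix. -/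

section Vanishing

variable {N n m s : ℕ} (b : Module.Basis (Fin n) ℝ (su N)) (a : Fin n → Fin m → ℂ)

/-- The matrix of odd elements `∑ b_i ⊗ t_i`. -/
def oddMatrix : Matrix (Fin N) (Fin N) (Ext ℂ m) :=
  Matrix.of fun p q => ∑ i, (b i : Matrix (Fin N) (Fin N) ℂ) p q • ExteriorAlgebra.ι ℂ (a i)

/-- The homomorphism of exterior algebras that sends `e_i` to `a_i`. -/
def substHom : Ext ℂ n →ₐ[ℂ] Ext ℂ m := ExteriorAlgebra.map (Fintype.linearCombination ℂ a)

lemma substHom_th (i : Fin n) : substHom a (th i) = ExteriorAlgebra.ι ℂ (a i) := by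
  rw [substHom, th, ExteriorAlgebra.map_apply_ι, Fintype.linearCombination_apply_single, one_smul]

lemma substHom_wform (C : Fin n → Fin n → Fin n → ℂ) (μ : Fin n) : substHom a (wform C μ) =
    ∑ i, ∑ j, C i j μ • (ExteriorAlgebra.ι ℂ (a i) * ExteriorAlgebra.ι ℂ (a j)) := by
  simp [wform, substHom_th]

/-- Since the entries `t_i` anticommute, the square of `∑ b_i ⊗ t_i` involves only the commutators
of the `b_i`. These produce the curvature forms. -/
lemma two_smul_oddMatrix_mul_self (p q : Fin N) :
    (2 : ℂ) • (oddMatrix b a * oddMatrix b a) p q =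
      ∑ μ, (b μ : Matrix (Fin N) (Fin N) ℂ) p q •
        substHom a (wform (fun i j k => (structConst b i j k : ℂ)) μ) := by
  set t : Fin n → Ext ℂ m := fun i => ExteriorAlgebra.ι ℂ (a i) with ht
  have h1 : (oddMatrix b a * oddMatrix b a) p q =
      ∑ i, ∑ j, ((b i : Matrix (Fin N) (Fin N) ℂ) * b j) p q • (t i * t j) := by
    simp only [Matrix.mul_apply, oddMatrix, Matrix.of_apply, Finset.sum_mul_sum, Finset.sum_smul,
      smul_mul_smul_comm]
    rw [Finset.sum_comm]
    exact Finset.sum_congr rfl fun i _ => Finset.sum_comm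
  have h2 : (oddMatrix b a * oddMatrix b a) p q =
      -∑ i, ∑ j, ((b j : Matrix (Fin N) (Fin N) ℂ) * b i) p q • (t i * t j) := by
    rw [h1, Finset.sum_comm, ← Finset.sum_neg_distrib]
    refine Finset.sum_congr rfl fun i _ => ?_
    rw [← Finset.sum_neg_distrib]
    refine Finset.sum_congr rfl fun j _ => ?_
    rw [(od_ι (a j)).anticomm (od_ι (a i)), smul_neg]
  rw [two_smul]
  conv_lhs => enter [1]; rw [h1]
  rw [h2, ← sub_eq_add_neg, ← Finset.sum_sub_distrib]
  simp only [← Finset.sum_sub_distrib, ← sub_smul, ← Matrix.sub_apply, commutator_basis,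
    substHom_wform, Finset.smul_sum, smul_smul]
  rw [← sum_cycle₃ (fun i j μ => ((b μ : Matrix (Fin N) (Fin N) ℂ) p q *
    (structConst b i j μ : ℂ)) • (t i * t j))]
  refine Finset.sum_congr rfl fun i _ => Finset.sum_congr rfl fun j _ => ?_
  rw [Matrix.sum_apply, Finset.sum_smul]
  exact Finset.sum_congr rfl fun μ _ => by rw [Matrix.smul_apply, smul_eq_mul, mul_comm]

/-- If the contracted trace polynomial vanishes, then so does the trace of the power of an odd
matrix with every basis matrix. -/
theorem sum_smul_oddMatrix_pow_eq_zero {σ : Fin n}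
    (h : polyRest (structConst b) (tracePoly b (s + 1)) σ = 0) :
    ∑ p, ∑ q, (b σ : Matrix (Fin N) (Fin N) ℂ) p q •
      ((oddMatrix b a * oddMatrix b a) ^ s) q p = 0 := by
  -- The substituted curvature forms are even, hence central, so the symmetrized trace may be
  -- evaluated over the commutative ring `R`.
  let R := Subalgebra.center ℂ (Ext ℂ m)
  let C : Fin n → Fin n → Fin n → ℂ := fun i j k => structConst b i j k
  have hev : ∀ μ, Ev (substHom a (wform C μ)) := fun μ => by
    rw [substHom_wform]
    exact Ev.sum fun i => Ev.sum fun j => ((od_ι _).mul (od_ι _)).smul _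
  let W : Fin n → R := fun μ => ⟨substHom a (wform C μ), Subalgebra.mem_center_iff.2 fun y =>
    ((hev μ).comm y).symm⟩
  let H : Fin n → Matrix (Fin N) (Fin N) R := fun μ => (algebraMap ℂ R).mapMatrix (herm b μ)
  let Y : Matrix (Fin N) (Fin N) R := ∑ μ, W μ • H μ
  have h1 : ∑ μ : Fin s → Fin n, (∏ i, W (μ i)) * algebraMap ℂ R
      (tracePoly b (s + 1) (Fin.cons σ μ) : ℂ) = 0 := by
    have h2 := congrArg (substHom a) (plug_ofReal_eq_zero h)
    rw [plug, map_sum, map_zero] at h2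
    apply Subtype.val_injective
    refine Eq.trans ?_ h2
    refine (map_sum R.val _ _).trans (Finset.sum_congr rfl fun μ _ => ?_)
    rw [map_mul, map_mul, ← List.prod_ofFn, map_list_prod, map_list_prod, List.map_ofFn,
      List.map_ofFn, AlgHom.commutes, AlgHom.commutes]
    rfl
  have h2 : symTrace R N (s + 1) (Fin.cons (H σ) fun _ => Y) = 0 := by
    have h3 : ((s + 1).factorial : R) * ∑ μ : Fin s → Fin n, (∏ i, W (μ i)) * algebraMap ℂ R
      (tracePoly b (s + 1) (Fin.cons σ μ) : ℂ) = 0 := by rw [h1, mul_zero]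
    rw [symTrace_cons_sum, ← h3, Finset.mul_sum]
    refine Finset.sum_congr rfl fun μ _ => ?_
    have h4 : (Fin.cons (H σ) fun i => H (μ i) : Fin (s + 1) → Matrix (Fin N) (Fin N) R) =
        fun j => (algebraMap ℂ R).mapMatrix
          (herm b ((Fin.cons σ μ : Fin (s + 1) → Fin n) j)) := by
      funext j
      refine Fin.cases ?_ (fun i => ?_) j <;> simp [H]
    have h5 : ((s + 1).factorial : ℂ) ≠ 0 := by exact_mod_cast Nat.factorial_ne_zero _
    rw [h4, symTrace_map, mul_left_comm, tracePoly_eq, ← map_natCast (algebraMap ℂ R), ← map_mul,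
      ← mul_assoc, mul_one_div_cancel h5, one_mul]
  rw [symTrace_cons_const] at h2
  have h3 : (H σ * Y ^ s).trace = 0 := by
    have h5 : ((s + 1).factorial : ℂ) ≠ 0 := by exact_mod_cast Nat.factorial_ne_zero _
    rw [← map_natCast (algebraMap ℂ R), ← Algebra.smul_def] at h2
    exact (smul_eq_zero.1 h2).resolve_left h5
  let f : R →+* Ext ℂ m := R.val.toRingHom
  -- With `H = -i b`, the matrix `∑ w_μ H_μ` is `-i` times `∑ w_μ b_μ`, and the latter is twice the
  -- square of the odd matrix.
  have hY : f.mapMatrix Y = (-2 * Complex.I) • (oddMatrix b a * oddMatrix b a) := by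
    ext p q
    have h5 : Y p q = ∑ μ, W μ * H μ p q := by
      simp only [Y]
      rw [Matrix.sum_apply]
      rfl
    have h6 : (f.mapMatrix Y) p q = ∑ μ, (herm b μ p q : ℂ) • substHom a (wform C μ) := by
      rw [RingHom.mapMatrix_apply, Matrix.map_apply, h5, map_sum]
      refine Finset.sum_congr rfl fun μ _ => ?_
      rw [map_mul, Algebra.smul_def, Algebra.commutes]
      rfl
    have h7 : (-2 * Complex.I) • (oddMatrix b a * oddMatrix b a) p q =
        (-Complex.I) • (2 : ℂ) • (oddMatrix b a * oddMatrix b a) p q := by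
      rw [smul_smul]
      congr 1
      ring
    rw [h6, Matrix.smul_apply, h7, two_smul_oddMatrix_mul_self, Finset.smul_sum]
    refine Finset.sum_congr rfl fun μ _ => ?_
    rw [smul_smul]
    rfl
  have h8 : ∀ q p, f ((Y ^ s) q p) =
      (-2 * Complex.I) ^ s • ((oddMatrix b a * oddMatrix b a) ^ s) q p := by
    intro q p
    have h9 : f.mapMatrix (Y ^ s) = (-2 * Complex.I) ^ s • (oddMatrix b a * oddMatrix b a) ^ s := by
      rw [map_pow, hY, smul_pow]
    exact congrFun (congrFun h9 q) p
  have h10 := congrArg f h3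
  have h11 : (H σ * Y ^ s).trace = ∑ p, ∑ q, H σ p q * (Y ^ s) q p := by
    simp only [Matrix.trace, Matrix.diag_apply, Matrix.mul_apply]
  have h12 : ∀ p q, f (H σ p q) = algebraMap ℂ _ (-Complex.I * (b σ : Matrix (Fin N) (Fin N) ℂ) p q) :=
    fun p q => rfl
  rw [h11, map_sum, map_zero] at h10
  have h13 : ∀ p, f (∑ q, H σ p q * (Y ^ s) q p) = ∑ q, (-Complex.I * (-2 * Complex.I) ^ s) •
      ((b σ : Matrix (Fin N) (Fin N) ℂ) p q • ((oddMatrix b a * oddMatrix b a) ^ s) q p) := by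
    intro p
    rw [map_sum]
    refine Finset.sum_congr rfl fun q _ => ?_
    rw [map_mul, h8, h12, ← Algebra.smul_def, smul_smul, smul_smul]
    congr 1
    ring
  simp only [h13, ← Finset.smul_sum] at h10
  exact (smul_eq_zero.1 h10).resolve_left (by simp)

end Vanishing

/-! ### The complex span of a basis of `su(N)`. -/

section Span

variable {N n : ℕ} (b : Module.Basis (Fin n) ℝ (su N))

/-- A basis of `su(N)` spans the traceless complex matrices. -/
lemma exists_eq_sum_smul_basis {D : Matrix (Fin N) (Fin N) ℂ} (hD : D.trace = 0) :
    ∃ c : Fin n → ℂ, D = ∑ i, c i • (b i : Matrix (Fin N) (Fin N) ℂ) := by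
  have hX : ∀ X : su N, ∃ c : Fin n → ℂ, (X : Matrix (Fin N) (Fin N) ℂ) =
      ∑ i, c i • (b i : Matrix (Fin N) (Fin N) ℂ) := by
    intro X
    refine ⟨fun i => (b.repr X i : ℂ), ?_⟩
    have h := congrArg (Subtype.val : su N → Matrix (Fin N) (Fin N) ℂ) (b.sum_repr X)
    refine (h.symm.trans (map_sum (su N).toSubmodule.subtype _ _)).trans ?_
    exact Finset.sum_congr rfl fun k _ => (Complex.coe_smul _ _).symm
  -- Both the anti-Hermitian part and `i` times the Hermitian part of a traceless matrix lie in `su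
  -- N`.
  have h1 : (D - Dᴴ) ∈ su N := by
    refine ⟨?_, ?_⟩
    · rw [Matrix.conjTranspose_sub, Matrix.conjTranspose_conjTranspose, neg_sub]
    · rw [Matrix.trace_sub, Matrix.trace_conjTranspose, hD, star_zero, sub_zero]
  have h2 : (Complex.I • (D + Dᴴ)) ∈ su N := by
    refine ⟨?_, ?_⟩
    · rw [Matrix.conjTranspose_smul, Matrix.conjTranspose_add, Matrix.conjTranspose_conjTranspose,
        Complex.star_def, Complex.conj_I, neg_smul, add_comm]
    · rw [Matrix.trace_smul, Matrix.trace_add, Matrix.trace_conjTranspose, hD, star_zero, add_zero,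
        smul_zero]
  obtain ⟨c, hc⟩ := hX ⟨_, h1⟩
  obtain ⟨d, hd⟩ := hX ⟨_, h2⟩
  refine ⟨fun i => (1 / 2 : ℂ) * (c i - Complex.I * d i), ?_⟩
  simp only [mul_smul, ← Finset.smul_sum, sub_smul, Finset.sum_sub_distrib]
  rw [← hc, ← hd]
  simp only [smul_smul, Complex.I_mul_I]
  module

lemma oddMatrix_eq {m : ℕ} {a : Fin n → Fin m → ℂ} {Y : Fin m → Matrix (Fin N) (Fin N) ℂ}
    (hY : ∀ x, Y x = ∑ i, a i x • (b i : Matrix (Fin N) (Fin N) ℂ)) (p q : Fin N) :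
    oddMatrix b a p q = ∑ x, Y x p q • th x := by
  simp only [oddMatrix, Matrix.of_apply, ι_eq_sum, hY, Matrix.sum_apply, Matrix.smul_apply,
    Finset.smul_sum, Finset.sum_smul, smul_smul, smul_eq_mul]
  rw [Finset.sum_comm]
  exact Finset.sum_congr rfl fun x _ => Finset.sum_congr rfl fun i _ => by rw [mul_comm]

end Span

/-! ### Powers of strictly upper triangular matrices. -/

section Triangular

variable {A : Type*} [Ring A] {N : ℕ} {M : Matrix (Fin N) (Fin N) A}

lemma pow_apply_eq_zero_of_strictUpper (hM : ∀ p q, ¬ p < q → M p q = 0) (k : ℕ) (p q : Fin N)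
    (h : (q : ℕ) < p + k) : (M ^ k) p q = 0 := by
  induction k generalizing q with
  | zero => rw [pow_zero, Matrix.one_apply_ne (by rintro rfl; omega)]
  | succ k ih =>
    rw [pow_succ, Matrix.mul_apply]
    refine Finset.sum_eq_zero fun r _ => ?_
    by_cases h1 : (r : ℕ) < p + k
    · rw [ih r h1, zero_mul]
    · rw [hM r q (by rw [Fin.lt_def]; omega), mul_zero]

/-- Each factor raises the index by at least one, so `k` factors leading from `0` to `k` must all be
unit steps. -/
lemma pow_apply_of_strictUpper (hM : ∀ p q, ¬ p < q → M p q = 0) (k : ℕ) (hk : k < N) :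
    (M ^ k) ⟨0, by omega⟩ ⟨k, hk⟩ =
      (List.ofFn fun i : Fin k => M ⟨i, by omega⟩ ⟨i + 1, by omega⟩).prod := by
  induction k with
  | zero => simp
  | succ k ih =>
    rw [pow_succ, Matrix.mul_apply, Finset.sum_eq_single ⟨k, by omega⟩, ih (by omega),
      List.ofFn_succ', List.prod_concat]
    · rfl
    · intro r _ hr
      by_cases h1 : (r : ℕ) < k
      · rw [pow_apply_eq_zero_of_strictUpper hM k _ _ (by simpa using h1), zero_mul]
      · rw [hM r _ ?_, mul_zero]
        intro h2
        rw [Fin.lt_def] at h2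
        exact hr (Fin.ext (by simp at h2 ⊢; omega))
    · simp

end Triangular

/-! ### A staircase matrix that detects the trace cocycles. -/

section Staircase

lemma prod_ofFn_th_ne_zero (s : ℕ) : (List.ofFn fun i : Fin s =>
    (th ⟨2 * i, by omega⟩ * th ⟨2 * i + 1, by omega⟩ : Ext ℂ (2 * s))).prod ≠ 0 := by
  let C : Fin (2 * s) → Fin (2 * s) → Fin (2 * s) → ℂ := fun i j μ =>
    if (i : ℕ) = 2 * μ ∧ (j : ℕ) = 2 * μ + 1 then 1 else 0
  let μ : Fin s → Fin (2 * s) := fun a => ⟨a, by omega⟩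
  have h1 : ∀ a : Fin s, wform C (μ a) =
      (th ⟨2 * a, by omega⟩ * th ⟨2 * a + 1, by omega⟩ : Ext ℂ (2 * s)) := by
    intro a
    rw [wform, Finset.sum_eq_single ⟨2 * a, by omega⟩, Finset.sum_eq_single ⟨2 * a + 1, by omega⟩]
    · simp [C, μ]
    · intro j _ hj
      have : ¬ (j : ℕ) = 2 * a + 1 := fun h => hj (Fin.ext h)
      simp [C, μ, this]
    · simp
    · intro i _ hi
      have : ¬ (i : ℕ) = 2 * a := fun h => hi (Fin.ext h)
      simp [C, μ, this]
    · simp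
  simp only [← h1]
  rw [← el_rawProd]
  intro h
  have h2 := congrFun (alt_eq_zero_of_el h) id
  -- The product is the element of a raw tensor supported on the identity ordering, so only the
  -- identity permutation contributes.
  rw [alt, Finset.sum_eq_single 1] at h2
  · simp [rawProd, C, μ] at h2
  · intro π _ hπ
    rw [mul_eq_zero]
    right
    by_contra h3
    refine hπ (Equiv.ext fun x => ?_)
    rw [rawProd, ← ne_eq, Finset.prod_ne_zero_iff] at h3
    have h4 := h3 ⟨x / 2, by omega⟩ (Finset.mem_univ _)
    simp only [C, μ, Function.comp_apply, id_eq, ne_eq, ite_eq_right_iff, one_ne_zero, imp_false,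
      not_not] at h4
    rcases Nat.mod_two_eq_zero_or_one x with h5 | h5
    · have h6 : x = ⟨2 * (x / 2), by omega⟩ := Fin.ext (by simp; omega)
      rw [Equiv.Perm.one_apply]
      conv_lhs => rw [h6]
      exact Fin.ext (by rw [h4.1]; omega)
    · have h6 : x = ⟨2 * (x / 2) + 1, by omega⟩ := Fin.ext (by simp; omega)
      rw [Equiv.Perm.one_apply]
      conv_lhs => rw [h6]
      exact Fin.ext (by rw [h4.2]; omega)
  · simp

variable {l s : ℕ}

/-- Diagonal matrices and elementary matrices above the diagonal, in alternation, made traceless. -/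
def staircase (l s : ℕ) (hs : s ≤ l) (x : Fin (2 * s)) : Matrix (Fin (l + 1)) (Fin (l + 1)) ℂ :=
  if (x : ℕ) % 2 = 0 then
    Matrix.diagonal (fun k : Fin (l + 1) => if (k : ℕ) ≤ x / 2 then 1 else 0) -
      ((Matrix.diagonal (fun k : Fin (l + 1) => if (k : ℕ) ≤ x / 2 then (1 : ℂ) else 0)).trace /
        ((l + 1 : ℕ) : ℂ)) • (1 : Matrix (Fin (l + 1)) (Fin (l + 1)) ℂ)
  else Matrix.single ⟨x / 2, by omega⟩ ⟨x / 2 + 1, by omega⟩ 1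

lemma trace_staircase (hs : s ≤ l) (x : Fin (2 * s)) : (staircase l s hs x).trace = 0 := by
  rw [staircase]
  split_ifs with h
  · have : ((l + 1 : ℕ) : ℂ) ≠ 0 := by exact_mod_cast Nat.succ_ne_zero l
    rw [Matrix.trace_sub, Matrix.trace_smul, Matrix.trace_one, Fintype.card_fin, smul_eq_mul,
      div_mul_cancel₀ _ this, sub_self]
  · refine Matrix.trace_single_eq_of_ne _ _ _ ?_
    simp [Fin.ext_iff]

/-- The matrix of the generic element of the staircase. -/
def stairMatrix (l s : ℕ) (hs : s ≤ l) : Matrix (Fin (l + 1)) (Fin (l + 1)) (Ext ℂ (2 * s)) :=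
  Matrix.of fun p q => ∑ x, staircase l s hs x p q • th x

lemma od_stairMatrix (hs : s ≤ l) (p q : Fin (l + 1)) : Od (stairMatrix l s hs p q) := by
  rw [stairMatrix, Matrix.of_apply]
  exact Od.sum fun x => (od_th x).smul _

lemma staircase_apply_of_ne (hs : s ≤ l) {p q : Fin (l + 1)} (hpq : p ≠ q) (x : Fin (2 * s)) :
    staircase l s hs x p q = if (x : ℕ) = 2 * p + 1 ∧ (q : ℕ) = p + 1 then 1 else 0 := by
  rw [staircase]
  split_ifs with h1 h2 h2
  · omega
  · simp [hpq]
  · rw [Matrix.single_apply, if_pos]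
    constructor <;> apply Fin.ext <;> simp <;> omega
  · rw [Matrix.single_apply, if_neg]
    rintro ⟨h3, h4⟩
    rw [Fin.ext_iff] at h3 h4
    simp only at h3 h4
    omega

lemma stairMatrix_lower (hs : s ≤ l) {p q : Fin (l + 1)} (hpq : q < p) :
    stairMatrix l s hs p q = 0 := by
  rw [stairMatrix, Matrix.of_apply]
  refine Finset.sum_eq_zero fun x _ => ?_
  rw [staircase_apply_of_ne hs hpq.ne', if_neg, zero_smul]
  rw [Fin.lt_def] at hpq
  omega

/-- The matrix is upper triangular with odd diagonal entries, and those square to zero. -/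
lemma stairMatrix_mul_self_of_not_lt (hs : s ≤ l) {p q : Fin (l + 1)} (hpq : ¬ p < q) :
    (stairMatrix l s hs * stairMatrix l s hs) p q = 0 := by
  rw [Matrix.mul_apply]
  refine Finset.sum_eq_zero fun r _ => ?_
  rcases lt_trichotomy r p with h | h | h
  · rw [stairMatrix_lower hs h, zero_mul]
  · subst h
    rcases (not_lt.1 hpq).lt_or_eq with h | h
    · rw [stairMatrix_lower hs h, mul_zero]
    · subst h
      exact (od_stairMatrix hs _ _).mul_self
  · rw [stairMatrix_lower hs ((not_lt.1 hpq).trans_lt h), mul_zero]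

/-- The entry is `X_pp X_pq + X_pq X_qq = (X_pp - X_qq) X_pq` by oddness. Truncated diagonal
matrices are chosen so that the difference of consecutive diagonal entries is a single generator;
the trace corrections cancel in it. -/
lemma stairMatrix_mul_self_succ (hs : s ≤ l) (i : Fin s) :
    (stairMatrix l s hs * stairMatrix l s hs) ⟨i, by omega⟩ ⟨i + 1, by omega⟩ =
      th ⟨2 * i, by omega⟩ * th ⟨2 * i + 1, by omega⟩ := by
  set p : Fin (l + 1) := ⟨i, by omega⟩ with hp
  set q : Fin (l + 1) := ⟨i + 1, by omega⟩ with hq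
  have hpq : p < q := by rw [Fin.lt_def]; simp [hp, hq]
  have hu : stairMatrix l s hs p q = th ⟨2 * i + 1, by omega⟩ := by
    rw [stairMatrix, Matrix.of_apply, Finset.sum_eq_single ⟨2 * i + 1, by omega⟩]
    · rw [staircase_apply_of_ne hs hpq.ne, if_pos ⟨rfl, rfl⟩, one_smul]
    · intro x _ hx
      rw [staircase_apply_of_ne hs hpq.ne, if_neg, zero_smul]
      exact fun h => hx (Fin.ext h.1)
    · simp
  have hd : stairMatrix l s hs p p - stairMatrix l s hs q q = th ⟨2 * i, by omega⟩ := by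
    rw [stairMatrix, Matrix.of_apply, Matrix.of_apply, ← Finset.sum_sub_distrib,
      Finset.sum_eq_single ⟨2 * i, by omega⟩]
    · simp [staircase, hp, hq]
      module
    · intro x _ hx
      have hx' : ¬ (x : ℕ) = 2 * i := fun h => hx (Fin.ext h)
      rw [← sub_smul, staircase]
      split_ifs with h1
      · have h2 : ((i : ℕ) ≤ x / 2) ↔ (i : ℕ) + 1 ≤ x / 2 := by omega
        simp [hp, hq, h2]
      · have e1 : ¬ ((⟨x / 2, by omega⟩ : Fin (l + 1)) = p ∧
            (⟨x / 2 + 1, by omega⟩ : Fin (l + 1)) = p) := by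
          rintro ⟨h3, h4⟩
          rw [Fin.ext_iff] at h3 h4
          simp only at h3 h4
          omega
        have e2 : ¬ ((⟨x / 2, by omega⟩ : Fin (l + 1)) = q ∧
            (⟨x / 2 + 1, by omega⟩ : Fin (l + 1)) = q) := by
          rintro ⟨h3, h4⟩
          rw [Fin.ext_iff] at h3 h4
          simp only at h3 h4
          omega
        rw [Matrix.single_apply, Matrix.single_apply, if_neg e1, if_neg e2, sub_zero, zero_smul]
    · simp
  have hsum : (stairMatrix l s hs * stairMatrix l s hs) p q =
      stairMatrix l s hs p p * stairMatrix l s hs p q +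
        stairMatrix l s hs p q * stairMatrix l s hs q q := by
    rw [Matrix.mul_apply, ← Finset.sum_pair (f := fun r => stairMatrix l s hs p r *
      stairMatrix l s hs r q) hpq.ne]
    refine (Finset.sum_subset (Finset.subset_univ _) fun r _ hr => ?_).symm
    simp only [Finset.mem_insert, Finset.mem_singleton, not_or] at hr
    rcases lt_or_gt_of_ne hr.1 with h | h
    · rw [stairMatrix_lower hs h, zero_mul]
    · have : q < r := by
        rcases lt_or_gt_of_ne hr.2 with h' | h'
        · rw [Fin.lt_def] at h h'
          simp only [hp, hq] at h h'
          omega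
        · exact h'
      rw [stairMatrix_lower hs this, mul_zero]
  rw [hsum, (od_stairMatrix hs p q).anticomm (od_stairMatrix hs q q), ← sub_eq_add_neg, ← sub_mul,
    hd, hu]

variable {n : ℕ} (b : Module.Basis (Fin n) ℝ (su (l + 1)))

theorem exists_polyRest_ne_zero (h1 : 1 ≤ s) (hs : s ≤ l) :
    ∃ σ, polyRest (structConst b) (tracePoly b (s + 1)) σ ≠ 0 := by
  by_contra! h
  choose a ha using fun x => exists_eq_sum_smul_basis b (trace_staircase hs x)
  have hX : oddMatrix b (fun i x => a x i) = stairMatrix l s hs := by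
    ext p q
    rw [oddMatrix_eq b ha]
    rfl
  have h2 : ∀ σ, ∑ p, ∑ q, (b σ : Matrix (Fin (l + 1)) (Fin (l + 1)) ℂ) p q •
      ((stairMatrix l s hs * stairMatrix l s hs) ^ s) q p = 0 := fun σ => by
    rw [← hX]
    exact sum_smul_oddMatrix_pow_eq_zero b _ (h σ)
  -- The elementary matrix at `(s, 0)` is traceless because `s ≥ 1`. Pairing with it extracts the
  -- corner entry `(0, s)` of the power, which is the product of all `2s` generators.
  obtain ⟨c, hc⟩ := exists_eq_sum_smul_basis b
    (Matrix.trace_single_eq_of_ne (⟨s, by omega⟩ : Fin (l + 1)) ⟨0, by omega⟩ (1 : ℂ)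
      (by simp [Fin.ext_iff]; omega))
  have h3 : ∑ p, ∑ q, (Matrix.single (⟨s, by omega⟩ : Fin (l + 1)) ⟨0, by omega⟩ (1 : ℂ)) p q •
      ((stairMatrix l s hs * stairMatrix l s hs) ^ s) q p = 0 := by
    rw [hc]
    simp only [Matrix.sum_apply, Matrix.smul_apply, Finset.sum_smul, smul_assoc]
    refine (Finset.sum_congr rfl fun p _ => Finset.sum_comm).trans (Finset.sum_comm.trans ?_)
    simp only [← Finset.smul_sum, h2, smul_zero, Finset.sum_const_zero]
  rw [Finset.sum_eq_single ⟨s, by omega⟩, Finset.sum_eq_single ⟨0, by omega⟩] at h3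
  · rw [Matrix.single_apply_same, one_smul, pow_apply_of_strictUpper
      (fun p q => stairMatrix_mul_self_of_not_lt hs)] at h3
    simp only [stairMatrix_mul_self_succ] at h3
    exact prod_ofFn_th_ne_zero s h3
  · intro q _ hq
    rw [Matrix.single_apply_of_col_ne _ _ hq.symm, zero_smul]
  · simp
  · intro p _ hp
    exact Finset.sum_eq_zero fun q _ => by rw [Matrix.single_apply_of_row_ne hp.symm, zero_smul]
  · simp

theorem polyCochain_tracePoly_ne_zero (h1 : 1 ≤ s) (hs : s ≤ l) :
    polyCochain (structConst b) (tracePoly b (s + 1)) ≠ 0 := by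
  intro h
  obtain ⟨σ, hσ⟩ := exists_polyRest_ne_zero b h1 hs
  have h2 := con_polyForm (structConst_anti b) (structConst_jacobi b) (isSymm_tracePoly b (s + 1))
    (isInvariant_tracePoly b (s + 1)) σ
  rw [← nel_polyCochain (isSymm_tracePoly b (s + 1)), h, nel_zero, map_zero] at h2
  exact hσ ((smul_eq_zero.1 h2.symm).resolve_left (by positivity))

end Staircase

/-! ### Lie algebras with a positive definite invariant form -/

lemma sum_swap_pairs {ι M : Type*} [Fintype ι] [AddCommMonoid M] (f : ι → ι → ι → ι → M) :
    ∑ i, ∑ j, ∑ x, ∑ y, f i j x y = ∑ x, ∑ y, ∑ i, ∑ j, f i j x y := by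
  calc ∑ i, ∑ j, ∑ x, ∑ y, f i j x y = ∑ i, ∑ x, ∑ j, ∑ y, f i j x y :=
        Finset.sum_congr rfl fun i _ => Finset.sum_comm
    _ = ∑ x, ∑ i, ∑ j, ∑ y, f i j x y := Finset.sum_comm
    _ = ∑ x, ∑ i, ∑ y, ∑ j, f i j x y :=
        Finset.sum_congr rfl fun x _ => Finset.sum_congr rfl fun i _ => Finset.sum_comm
    _ = ∑ x, ∑ y, ∑ i, ∑ j, f i j x y := Finset.sum_congr rfl fun x _ => Finset.sum_comm

/-! ### Tensors transformed in every index. -/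

section Transform

variable {n k : ℕ} {ι κ : Type*} [Fintype ι] [Fintype κ]

/-- The tensor obtained by applying the matrix `W` to every index of `α`. -/
def transform (W : ι → κ → ℝ) (α : (Fin k → κ) → ℝ) (K : Fin k → ι) : ℝ :=
  ∑ J : Fin k → κ, (∏ s, W (K s) (J s)) * α J

lemma transform_transform {ι' : Type*} (V : ι' → ι → ℝ) (W : ι → κ → ℝ)
    (α : (Fin k → κ) → ℝ) :
    transform V (transform W α) = transform (fun i j => ∑ l, V i l * W l j) α := by
  classical
  ext K
  simp only [transform, Finset.mul_sum]
  rw [Finset.sum_comm]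
  refine Finset.sum_congr rfl fun J _ => ?_
  rw [Finset.prod_univ_sum, Fintype.piFinset_univ, Finset.sum_mul]
  refine Finset.sum_congr rfl fun L _ => ?_
  rw [Finset.prod_mul_distrib, mul_assoc]

lemma transform_one [DecidableEq κ] (α : (Fin k → κ) → ℝ) :
    transform (fun i j => if i = j then 1 else 0) α = α := by
  ext K
  rw [transform, Finset.sum_eq_single K]
  · simp
  · intro J _ hJ
    obtain ⟨s, hs⟩ := Function.ne_iff.1 hJ
    rw [Finset.prod_eq_zero (Finset.mem_univ s) (if_neg hs.symm), zero_mul]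
  · simp

lemma sum_transform_mul (U : ι → κ → ℝ) (α : (Fin k → ι) → ℝ) (β : (Fin k → κ) → ℝ) :
    ∑ K, transform U β K * α K = ∑ J, transform (fun j i => U i j) α J * β J := by
  simp only [transform, Finset.sum_mul]
  rw [Finset.sum_comm]
  exact Finset.sum_congr rfl fun J _ => Finset.sum_congr rfl fun K _ => by ring

/-- The form induced on tensors by a positive definite form is definite. -/
lemma eq_zero_of_sum_transform_mul [DecidableEq ι] {U : ι → κ → ℝ} {W B : Matrix ι ι ℝ}
    (hU : ∀ i j, W i j = ∑ l, U i l * U j l) (hBW : B * W = 1) {α : (Fin k → ι) → ℝ}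
    (h : ∑ K, transform (fun i j => W i j) α K * α K = 0) : α = 0 := by
  have h1 : transform (fun i j => W i j) α = transform U (transform (fun j i => U i j) α) := by
    rw [transform_transform]
    congr 1
    ext i j
    exact hU i j
  rw [h1, sum_transform_mul] at h
  -- With `W = U Uᵀ`, the quadratic form is the sum of squares of the components of `α` transformed
  -- by `Uᵀ`.
  have h2 : transform (fun j i => U i j) α = 0 := by
    ext L
    have h3 := (Finset.sum_eq_zero_iff_of_nonneg fun J _ => mul_self_nonneg
      (transform (fun j i => U i j) α J)).1 h L (Finset.mem_univ _)
    exact mul_self_eq_zero.1 h3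
  rw [← transform_one α]
  have h4 : (fun i j : ι => if i = j then (1 : ℝ) else 0) = fun i j => ∑ l, B i l * W l j := by
    ext i j
    rw [← Matrix.one_apply, ← hBW, Matrix.mul_apply]
  rw [h4, ← transform_transform (fun i j => B i j) (fun i j => W i j), h1, h2]
  ext K
  simp [transform]

end Transform

/-! ### Invariants against coboundaries, and nondegeneracy of the Killing form. -/

section Pairing

variable {n k : ℕ} {C : Fin n → Fin n → Fin n → ℝ}

/-- Exchanging the new value with the old value at position `s` is an involution; it serves as
summation by parts for the action on that slot. -/
lemma sum_sum_update_swap (s : Fin k) (H : (Fin k → Fin n) → (Fin k → Fin n) → ℝ) :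
    ∑ J, ∑ ν, H J (Function.update J s ν) = ∑ J, ∑ ν, H (Function.update J s ν) J := by
  rw [← Fintype.sum_prod_type', ← Fintype.sum_prod_type']
  let e : (Fin k → Fin n) × Fin n → (Fin k → Fin n) × Fin n :=
    fun p => (Function.update p.1 s p.2, p.1 s)
  have he : Function.Involutive e := fun p => by simp [e]
  refine Fintype.sum_equiv he.toPerm _ _ fun p => ?_
  simp [e, Function.Involutive.toPerm]

lemma prod_update_mul (W : Fin n → Fin n → ℝ) (K J : Fin k → Fin n) (s : Fin k) (a b : Fin n) :
    ∏ t, W (Function.update K s a t) (Function.update J s b t) =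
      W a b * ∏ t ∈ Finset.univ.erase s, W (K t) (J t) := by
  rw [← Finset.mul_prod_erase _ _ (Finset.mem_univ s)]
  simp only [Function.update_self]
  congr 1
  refine Finset.prod_congr rfl fun t ht => ?_
  rw [Function.update_of_ne (Finset.ne_of_mem_erase ht), Function.update_of_ne
    (Finset.ne_of_mem_erase ht)]

/-- Raising all the indices of an invariant tensor gives an invariant contravariant tensor. -/
lemma IsInvariant.transform {W : Fin n → Fin n → ℝ}
    (hW : ∀ a i j, ∑ ν, C a ν i * W ν j + ∑ ν, W i ν * C a ν j = 0) {α : Tensor n k}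
    (h : IsInvariant C α) (a : Fin n) (K : Fin k → Fin n) :
    ∑ s, ∑ ν, C a ν (K s) * GenJacobi.transform W α (Function.update K s ν) = 0 := by
  have h1 : ∀ s, ∑ ν, C a ν (K s) * GenJacobi.transform W α (Function.update K s ν) =
      -∑ J, (∏ t, W (K t) (J t)) * ∑ ν, C a (J s) ν * α (Function.update J s ν) := by
    intro s
    calc ∑ ν, C a ν (K s) * GenJacobi.transform W α (Function.update K s ν)
        = ∑ J, (∑ ν, C a ν (K s) * W ν (J s)) *
            (∏ t ∈ Finset.univ.erase s, W (K t) (J t)) * α J := by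
          simp only [GenJacobi.transform, Finset.mul_sum, Finset.sum_mul]
          rw [Finset.sum_comm]
          refine Finset.sum_congr rfl fun J _ => Finset.sum_congr rfl fun ν _ => ?_
          have := prod_update_mul W K J s ν (J s)
          rw [Function.update_eq_self] at this
          rw [this]
          ring
      _ = -∑ J, ∑ ν, (∏ t, W (K t) (Function.update J s ν t)) * C a ν (J s) * α J := by
          rw [← Finset.sum_neg_distrib]
          refine Finset.sum_congr rfl fun J _ => ?_
          rw [eq_neg_of_add_eq_zero_left (hW a (K s) (J s)), neg_mul, neg_mul, Finset.sum_mul,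
            Finset.sum_mul]
          congr 1
          refine Finset.sum_congr rfl fun ν _ => ?_
          have := prod_update_mul W K J s (K s) ν
          rw [Function.update_eq_self] at this
          rw [this]
          ring
      _ = _ := by
          have h2 := sum_sum_update_swap s fun J J' : Fin k → Fin n =>
            (∏ t, W (K t) (J' t)) * C a (J' s) (J s) * α J
          simp only [Function.update_self] at h2
          rw [h2]
          congr 1
          refine Finset.sum_congr rfl fun J _ => ?_
          rw [Finset.mul_sum]
          exact Finset.sum_congr rfl fun ν _ => by ring
  simp only [h1, Finset.sum_neg_distrib]
  rw [Finset.sum_comm]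
  simp only [← Finset.mul_sum, h a, mul_zero, Finset.sum_const_zero, neg_zero]

lemma Skew.transform {W : Fin n → Fin n → ℝ} {α : Tensor n k} (h : Skew α) :
    Skew (GenJacobi.transform W α) := by
  intro σ K
  rw [GenJacobi.transform, GenJacobi.transform, Finset.mul_sum,
    ← Equiv.sum_comp (Equiv.arrowCongr σ.symm (Equiv.refl (Fin n)))]
  refine Finset.sum_congr rfl fun J _ => ?_
  have h1 : Equiv.arrowCongr σ.symm (Equiv.refl (Fin n)) J = J ∘ σ := by ext; simp
  have h2 := Equiv.prod_comp σ fun s => W (K s) (J s)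
  rw [h1, h]
  simp only [Function.comp_apply]
  rw [h2]
  ring

/-- Invariant contravariant tensors are orthogonal to coboundaries. -/
lemma sum_mul_ceDiff {q : ℕ} (hC : ∀ ν, ∑ c, C c ν c = 0) {A : Tensor n (q + 1)} (hA : Skew A)
    (hinv : ∀ a K, ∑ s, ∑ ν, C a ν (K s) * A (Function.update K s ν) = 0) (η : Tensor n q) :
    ∑ K, A K * ceDiff C η K = 0 := by
  have h1 : ∀ c, ∑ I, A (Fin.cons c I) * ∑ j, ∑ ν, C c (I j) ν * η (Function.update I j ν) =
      ∑ I, (∑ j, ∑ ν, C c ν (I j) * A (Fin.cons c (Function.update I j ν))) * η I := by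
    intro c
    simp only [Finset.mul_sum, Finset.sum_mul]
    rw [Finset.sum_comm]
    rw [Finset.sum_comm (f := fun I j => ∑ ν,
      C c ν (I j) * A (Fin.cons c (Function.update I j ν)) * η I)]
    refine Finset.sum_congr rfl fun j _ => ?_
    have h2 := sum_sum_update_swap j fun J J' : Fin q → Fin n =>
      A (Fin.cons c J) * (C c (J j) (J' j) * η J')
    simp only [Function.update_self] at h2
    rw [h2]
    exact Finset.sum_congr rfl fun I _ => Finset.sum_congr rfl fun ν _ => by ring
  -- Invariance of `A`, with the acting vector contracted against the first index, leaves this sum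
  -- and a term with the trace of the adjoint action, which `hC` kills.
  have h2 : ∀ I, ∑ c, ∑ j, ∑ ν, C c ν (I j) * A (Fin.cons c (Function.update I j ν)) = 0 := by
    intro I
    have h3 : ∀ c, ∑ ν, C c ν c * A (Fin.cons ν I) +
        ∑ j, ∑ ν, C c ν (I j) * A (Fin.cons c (Function.update I j ν)) = 0 := by
      intro c
      have := hinv c (Fin.cons c I)
      rw [Fin.sum_univ_succ] at this
      simpa [Fin.cons_update] using this
    have h4 : ∑ c, ∑ ν, C c ν c * A (Fin.cons ν I) = 0 := by
      rw [Finset.sum_comm]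
      simp only [← Finset.sum_mul, hC, zero_mul, Finset.sum_const_zero]
    have h5 : ∑ c, (∑ ν, C c ν c * A (Fin.cons ν I) +
        ∑ j, ∑ ν, C c ν (I j) * A (Fin.cons c (Function.update I j ν))) = 0 :=
      Finset.sum_eq_zero fun c _ => h3 c
    rwa [Finset.sum_add_distrib, h4, zero_add] at h5
  have h3 : ∑ c, ∑ I, A (Fin.cons c I) * ∑ j, ∑ ν, C c (I j) ν * η (Function.update I j ν) = 0 := by
    simp only [h1]
    rw [Finset.sum_comm]
    simp only [← Finset.sum_mul, h2, zero_mul, Finset.sum_const_zero]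
  have h4 : ∀ i : Fin (q + 1), ∑ K, A K * ((-1) ^ (i : ℕ) * ∑ j : Fin q, ∑ ν : Fin n,
      C (K i) (K (i.succAbove j)) ν *
        η (Function.update (fun l : Fin q => K (i.succAbove l)) j ν)) = 0 := by
    intro i
    rw [← (Fin.insertNthEquiv (fun _ => Fin n) i).sum_comp, Fintype.sum_prod_type, ← h3]
    refine Finset.sum_congr rfl fun c _ => Finset.sum_congr rfl fun I _ => ?_
    have h6 : A (Fin.insertNthEquiv (fun _ => Fin n) i (c, I)) =
        (-1) ^ (i : ℕ) * A (Fin.cons c I) := hA.insertNth i c I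
    rw [h6]
    simp only [Fin.insertNthEquiv_apply, Fin.insertNth_apply_same, Fin.insertNth_apply_succAbove]
    rw [mul_comm ((-1) ^ (i : ℕ)) (A _), mul_assoc, ← mul_assoc ((-1 : ℝ) ^ (i : ℕ)), ← pow_add,
      Even.neg_one_pow ⟨_, rfl⟩, one_mul]
  have h5 : ∑ K, A K * ceDiff C η K = -(1 / 2) * ∑ i : Fin (q + 1), ∑ K, A K *
      ((-1) ^ (i : ℕ) * ∑ j : Fin q, ∑ ν : Fin n, C (K i) (K (i.succAbove j)) ν *
        η (Function.update (fun l : Fin q => K (i.succAbove l)) j ν)) := by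
    rw [Finset.sum_comm, Finset.mul_sum]
    refine Finset.sum_congr rfl fun K _ => ?_
    rw [← Finset.mul_sum, ceDiff]
    ring
  rw [h5, Finset.sum_eq_zero fun i _ => h4 i, mul_zero]

variable {ι : Type*} [Fintype ι] {B W : Matrix (Fin n) (Fin n) ℝ} {U : Fin n → ι → ℝ}

/-- The adjoint matrices are skew for the nondegenerate form `B`, hence traceless. -/
lemma sum_structConst_diag_eq_zero (anti : ∀ i j k, C i j k = -C j i k)
    (inv : ∀ a i j, ∑ ν, C a i ν * B ν j + ∑ ν, C a j ν * B i ν = 0) (hWB : W * B = 1)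
    (hW : ∀ i j, W i j = W j i) (ν : Fin n) : ∑ c, C c ν c = 0 := by
  have h1 : ∀ i j, ∑ k, B i k * W j k = if i = j then 1 else 0 := by
    intro i j
    have hBW : B * W = 1 := mul_eq_one_comm.1 hWB
    have := congrFun (congrFun hBW i) j
    rw [Matrix.mul_apply, Matrix.one_apply] at this
    simpa only [hW j] using this
  have h2 : ∀ i j, ∑ k, B k i * W j k = if i = j then 1 else 0 := by
    intro i j
    have := congrFun (congrFun hWB j) i
    rw [Matrix.mul_apply, Matrix.one_apply] at this
    simp only [eq_comm (a := i), ← this, mul_comm]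
  have h3 : ∑ i, ∑ j, (∑ μ, C ν i μ * B μ j + ∑ μ, C ν j μ * B i μ) * W i j = 0 := by simp [inv]
  have h4 : ∑ i, ∑ j, (∑ μ, C ν i μ * B μ j) * W i j = ∑ c, C ν c c := by
    refine Finset.sum_congr rfl fun i _ => ?_
    simp only [Finset.sum_mul, mul_assoc]
    rw [Finset.sum_comm]
    simp [← Finset.mul_sum, h1]
  have h5 : ∑ i, ∑ j, (∑ μ, C ν j μ * B i μ) * W i j = ∑ c, C ν c c := by
    rw [Finset.sum_comm]
    refine Finset.sum_congr rfl fun j _ => ?_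
    simp only [Finset.sum_mul, mul_assoc]
    rw [Finset.sum_comm]
    simp [← Finset.mul_sum, h2, hW _ j]
  simp only [add_mul, Finset.sum_add_distrib, h4, h5] at h3
  simp only [anti _ ν, Finset.sum_neg_distrib]
  linarith

/-- Nonzero invariant cocycles are not coboundaries if there is a positive definite invariant
form. -/
theorem not_isCoboundary (anti : ∀ i j k, C i j k = -C j i k)
    (inv : ∀ a i j, ∑ ν, C a i ν * B ν j + ∑ ν, C a j ν * B i ν = 0) (hWB : W * B = 1)
    (hU : ∀ i j, W i j = ∑ l, U i l * U j l) {q : ℕ} {α : Tensor n (q + 1)} (hα : Skew α)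
    (hi : IsInvariant C α) (h0 : α ≠ 0) : ¬ IsCoboundary C α := by
  rintro ⟨η, -, rfl⟩
  have hW : ∀ i j, W i j = W j i := fun i j => by simp only [hU, mul_comm]
  refine h0 (eq_zero_of_sum_transform_mul hU (mul_eq_one_comm.1 hWB) ?_)
  exact sum_mul_ceDiff (sum_structConst_diag_eq_zero anti inv hWB hW) hα.transform
    (hi.transform (inverse_invariant (K := fun i j => B i j) (G := fun i j => W i j) inv hWB)) η

/-- The Killing form is nondegenerate if there are a positive definite invariant form and no
center. -/
theorem killing_det_ne_zero {K : Matrix (Fin n) (Fin n) ℝ}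
    (hK : ∀ i j, K i j = ∑ p, ∑ q, C j p q * C i q p)
    (inv : ∀ a i j, ∑ ν, C a i ν * B ν j + ∑ ν, C a j ν * B i ν = 0) (hWB : W * B = 1)
    (hB : ∀ i j, B i j = B j i) (hU : ∀ i j, W i j = ∑ l, U i l * U j l)
    (hcenter : ∀ v : Fin n → ℝ, (∀ j k, ∑ i, v i * C i j k = 0) → v = 0) : K.det ≠ 0 := by
  intro hdet
  obtain ⟨v, hv, hKv⟩ := Matrix.exists_mulVec_eq_zero_iff.2 hdet
  refine hv (hcenter v ?_)
  -- `A` is the matrix of the adjoint action of `v`. It is skew for `B`, and `K v = 0` makes the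
  -- trace of its square zero.
  let A : Matrix (Fin n) (Fin n) ℝ := Matrix.of fun j k => ∑ i, v i * C i j k
  let V : Matrix (Fin n) ι ℝ := Matrix.of U
  have hBW : B * W = 1 := mul_eq_one_comm.1 hWB
  have hBt : Bᵀ = B := by ext i j; exact hB j i
  have hWV : W = V * Vᵀ := by
    ext i j
    rw [hU, Matrix.mul_apply]
    rfl
  have hAB : A * B + B * Aᵀ = 0 := by
    ext i j
    have h1 : ∀ a, ∑ ν, C a i ν * B ν j + ∑ ν, B i ν * C a j ν = 0 := fun a => by
      simpa only [mul_comm (B i _)] using inv a i j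
    simp only [Matrix.add_apply, Matrix.mul_apply, Matrix.transpose_apply, A, Matrix.of_apply,
      Finset.sum_mul, Finset.mul_sum, Matrix.zero_apply]
    rw [Finset.sum_comm, Finset.sum_comm (f := fun ν a => B i ν * (v a * C a j ν)),
      ← Finset.sum_add_distrib]
    refine Finset.sum_eq_zero fun a _ => ?_
    have h2 := congrArg (v a * ·) (h1 a)
    simp only [mul_add, Finset.mul_sum, mul_zero] at h2
    rw [← h2]
    congr 1 <;> exact Finset.sum_congr rfl fun ν _ => by ring
  set T := A * B with hT
  have hTt : Tᵀ = -T := by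
    rw [hT, Matrix.transpose_mul, hBt, eq_neg_iff_add_eq_zero, add_comm]
    exact hAB
  have hA : A = T * W := by rw [hT, mul_assoc, hBW, mul_one]
  have htr : (A * A).trace = 0 := by
    have h1 : (A * A).trace = v ⬝ᵥ (K *ᵥ v) := by
      simp only [Matrix.trace, Matrix.diag_apply, Matrix.mul_apply, A, Matrix.of_apply,
        dotProduct, Matrix.mulVec, hK, Finset.mul_sum, Finset.sum_mul]
      rw [sum_swap_pairs fun i j x y => v y * C y i j * (v x * C x j i)]
      refine Finset.sum_congr rfl fun x _ => Finset.sum_congr rfl fun y _ =>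
        Finset.sum_congr rfl fun i _ => Finset.sum_congr rfl fun j _ => ?_
      ring
    rw [h1, hKv, dotProduct_zero]
  -- Factoring the definite form `W = V Vᵀ` transports `A` to an honest skew-symmetric matrix with
  -- the same trace of the square; then `tr (Sᵀ S) = 0` forces `S = 0`.
  set S := Vᵀ * T * V with hS
  have hSt : Sᵀ = -S := by
    rw [hS, Matrix.transpose_mul, Matrix.transpose_mul, Matrix.transpose_transpose, hTt]
    simp [Matrix.mul_assoc]
  have hS0 : S = 0 := by
    have h1 : (Sᵀ * S).trace = 0 := by
      have h2 : (A * A).trace = (S * S).trace := by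
        rw [hA, hWV, hS]
        rw [show T * (V * Vᵀ) * (T * (V * Vᵀ)) = (T * V * (Vᵀ * T * V)) * Vᵀ by
          simp only [Matrix.mul_assoc], Matrix.trace_mul_comm]
        simp only [Matrix.mul_assoc]
      rw [hSt, Matrix.neg_mul, Matrix.trace_neg, ← h2, htr, neg_zero]
    rw [← Matrix.conjTranspose_eq_transpose_of_trivial] at h1
    exact Matrix.trace_conjTranspose_mul_self_eq_zero_iff.1 h1
  have hT0 : T = 0 := by
    have h1 : W * T * W = 0 := by
      rw [hWV, show V * Vᵀ * T * (V * Vᵀ) = V * (Vᵀ * T * V) * Vᵀ by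
        simp only [Matrix.mul_assoc], ← hS, hS0, Matrix.mul_zero, Matrix.zero_mul]
    calc T = B * W * T * (W * B) := by rw [hBW, hWB, one_mul, mul_one]
      _ = B * (W * T * W) * B := by simp only [mul_assoc]
      _ = 0 := by rw [h1, mul_zero, zero_mul]
  intro j k
  have h1 : A = 0 := by rw [hA, hT0, zero_mul]
  exact congrFun (congrFun h1 j) k

end Pairing

/-! ### The invariant form of `su(N)` -/

section TraceForm

variable {N n : ℕ} (b : Module.Basis (Fin n) ℝ (su N))

/-- The real and imaginary parts of the entries of the basis matrices. -/
def realEntries : Matrix (Fin n) ((Fin N × Fin N) ⊕ (Fin N × Fin N)) ℝ :=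
  Matrix.of fun i => Sum.elim (fun p => ((b i : Matrix (Fin N) (Fin N) ℂ) p.1 p.2).re)
    fun p => ((b i : Matrix (Fin N) (Fin N) ℂ) p.1 p.2).im

/-- The matrix of the positive definite form `-Re tr (X Y)` of `su(N)`. -/
def traceForm : Matrix (Fin n) (Fin n) ℝ := realEntries b * (realEntries b)ᵀ

/-- For anti-Hermitian matrices `-Re tr (X Y)` is the real inner product of the entries, hence a
Gram matrix of real and imaginary parts. -/
lemma traceForm_apply (i j : Fin n) : traceForm b i j =
    -((b i : Matrix (Fin N) (Fin N) ℂ) * (b j : Matrix (Fin N) (Fin N) ℂ)).trace.re := by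
  have h : (b i : Matrix (Fin N) (Fin N) ℂ) = -(b i : Matrix (Fin N) (Fin N) ℂ)ᴴ := by
    rw [(b i).2.1, neg_neg]
  rw [h, Matrix.neg_mul, Matrix.trace_neg, Complex.neg_re, neg_neg]
  simp only [traceForm, Matrix.mul_apply, Fintype.sum_sum_type, realEntries, Matrix.of_apply,
    Matrix.transpose_apply, Sum.elim_inl, Sum.elim_inr, ← Finset.sum_add_distrib, Matrix.trace,
    Matrix.diag_apply, Matrix.conjTranspose_apply, Complex.re_sum]
  rw [Fintype.sum_prod_type, Finset.sum_comm]
  refine Finset.sum_congr rfl fun p _ => Finset.sum_congr rfl fun q _ => ?_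
  simp

lemma traceForm_symm (i j : Fin n) : traceForm b i j = traceForm b j i := by
  rw [traceForm_apply, traceForm_apply, Matrix.trace_mul_comm]

lemma traceForm_invariant (a i j : Fin n) :
    ∑ ν, structConst b a i ν * traceForm b ν j + ∑ ν, structConst b a j ν * traceForm b i ν = 0 := by
  have h1 : ∑ ν, structConst b a i ν * traceForm b ν j =
      -(((b a : Matrix (Fin N) (Fin N) ℂ) * b i - b i * b a) * b j).trace.re := by
    rw [commutator_basis, Matrix.sum_mul, Matrix.trace_sum, Complex.re_sum,
      ← Finset.sum_neg_distrib]
    refine Finset.sum_congr rfl fun ν _ => ?_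
    rw [traceForm_apply, Matrix.smul_mul, Matrix.trace_smul, smul_eq_mul, Complex.re_ofReal_mul,
      mul_neg]
  have h2 : ∑ ν, structConst b a j ν * traceForm b i ν =
      -((b i : Matrix (Fin N) (Fin N) ℂ) * ((b a : Matrix (Fin N) (Fin N) ℂ) * b j -
        b j * b a)).trace.re := by
    rw [commutator_basis, Matrix.mul_sum, Matrix.trace_sum, Complex.re_sum,
      ← Finset.sum_neg_distrib]
    refine Finset.sum_congr rfl fun ν _ => ?_
    rw [traceForm_apply, Matrix.mul_smul, Matrix.trace_smul, smul_eq_mul, Complex.re_ofReal_mul,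
      mul_neg]
  rw [h1, h2, ← neg_add, ← Complex.add_re, ← Matrix.trace_add, sub_mul, mul_sub, mul_assoc,
    mul_assoc, sub_add_sub_cancel, Matrix.trace_sub, ← mul_assoc (b i : Matrix (Fin N) (Fin N) ℂ),
    Matrix.trace_mul_comm, sub_self, Complex.zero_re, neg_zero]

lemma eq_zero_of_sum_smul_basis {v : Fin n → ℝ}
    (h : ∑ i, (v i : ℂ) • (b i : Matrix (Fin N) (Fin N) ℂ) = 0) : v = 0 := by
  have h1 : ∑ i, v i • b i = 0 := by
    apply Subtype.ext
    refine (map_sum (su N).toSubmodule.subtype _ _).trans (Eq.trans ?_ h)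
    exact Finset.sum_congr rfl fun k _ => (Complex.coe_smul _ _).symm
  ext i
  exact Fintype.linearIndependent_iff.1 b.linearIndependent v h1 i

lemma det_traceForm_ne_zero : (traceForm b).det ≠ 0 := by
  intro h
  obtain ⟨v, hv, h0⟩ := Matrix.exists_mulVec_eq_zero_iff.2 h
  rw [traceForm, ← Matrix.conjTranspose_eq_transpose_of_trivial,
    Matrix.self_mul_conjTranspose_mulVec_eq_zero] at h0
  refine hv (eq_zero_of_sum_smul_basis b ?_)
  ext p q
  have h1 := congrFun h0 (Sum.inl (p, q))
  have h2 := congrFun h0 (Sum.inr (p, q))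
  simp only [Matrix.mulVec, dotProduct, Matrix.conjTranspose_apply, star_trivial, realEntries,
    Matrix.of_apply, Sum.elim_inl, Sum.elim_inr, Pi.zero_apply] at h1 h2
  rw [Matrix.sum_apply, Matrix.zero_apply]
  apply Complex.ext
  · simpa [Complex.re_sum, mul_comm] using h1
  · simpa [Complex.im_sum, mul_comm] using h2

/-- A central element commutes with every traceless complex matrix, in particular with the
off-diagonal elementary ones. It is therefore scalar, and trace zero makes it vanish. -/
lemma eq_zero_of_central [NeZero N] {v : Fin n → ℝ}
    (h : ∀ j k, ∑ i, v i * structConst b i j k = 0) : v = 0 := by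
  set X := ∑ i, (v i : ℂ) • (b i : Matrix (Fin N) (Fin N) ℂ) with hX
  have h1 : ∀ j, X * b j - b j * X = 0 := by
    intro j
    simp only [hX, Matrix.sum_mul, Matrix.mul_sum, Matrix.smul_mul, Matrix.mul_smul,
      ← Finset.sum_sub_distrib, ← smul_sub, commutator_basis, Finset.smul_sum, smul_smul]
    rw [Finset.sum_comm]
    refine Finset.sum_eq_zero fun k _ => ?_
    rw [← Finset.sum_smul]
    have := h j k
    rw [show ∑ i, (v i : ℂ) * (structConst b i j k : ℂ) = 0 by exact_mod_cast this, zero_smul]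
  have h2 : ∀ D : Matrix (Fin N) (Fin N) ℂ, D.trace = 0 → Commute D X := by
    intro D hD
    obtain ⟨c, rfl⟩ := exists_eq_sum_smul_basis b hD
    refine Commute.sum_left _ _ _ fun j _ => Commute.smul_left ?_ _
    exact (sub_eq_zero.1 (h1 j)).symm
  obtain ⟨c, hc⟩ := Matrix.mem_range_scalar_of_commute_single (M := X) fun i j hij =>
    h2 _ (Matrix.trace_single_eq_of_ne i j 1 hij)
  have h3 : X.trace = 0 := by
    simp only [hX, Matrix.trace_sum, Matrix.trace_smul]
    exact Finset.sum_eq_zero fun i _ => by rw [(b i).2.2, smul_zero]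
  refine eq_zero_of_sum_smul_basis b ?_
  rw [← hX, ← hc]
  rw [← hc] at h3
  simp only [Matrix.trace, Matrix.diag_apply, Matrix.scalar_apply, Matrix.diagonal_apply_eq,
    Finset.sum_const, Finset.card_univ, Fintype.card_fin, nsmul_eq_mul, mul_eq_zero,
    Nat.cast_eq_zero] at h3
  rw [h3.resolve_left (NeZero.ne N), map_zero]

/-- The factor of the inverse of the trace form. -/
def dualEntries : Matrix (Fin n) ((Fin N × Fin N) ⊕ (Fin N × Fin N)) ℝ :=
  (traceForm b)⁻¹ * realEntries b

lemma inv_traceForm_mul : (traceForm b)⁻¹ * traceForm b = 1 :=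
  Matrix.nonsing_inv_mul _ (isUnit_iff_ne_zero.2 (det_traceForm_ne_zero b))

lemma inv_traceForm_apply (i j : Fin n) :
    (traceForm b)⁻¹ i j = ∑ l, dualEntries b i l * dualEntries b j l := by
  have h : (traceForm b)⁻¹ = dualEntries b * (dualEntries b)ᵀ := by
    have h1 : ((traceForm b)⁻¹)ᵀ = (traceForm b)⁻¹ := by
      rw [Matrix.transpose_nonsing_inv]
      congr 1
      ext i j
      exact traceForm_symm b j i
    rw [dualEntries, Matrix.transpose_mul, h1, Matrix.mul_assoc, ← Matrix.mul_assoc (realEntries b),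
      ← traceForm, Matrix.mul_nonsing_inv _ (isUnit_iff_ne_zero.2 (det_traceForm_ne_zero b)),
      Matrix.mul_one]
  rw [h, Matrix.mul_apply]
  rfl

theorem det_killingMatrix_su_ne_zero [NeZero N] : (killingMatrix b).det ≠ 0 :=
  killing_det_ne_zero (killingMatrix_eq b) (traceForm_invariant b) (inv_traceForm_mul b)
    (traceForm_symm b) (inv_traceForm_apply b) fun _ => eq_zero_of_central b

theorem not_isCoboundary_su {q : ℕ} {α : Tensor n (q + 1)} (hα : IsSkew α)
    (hi : IsInvariant (structConst b) α) (h0 : α ≠ 0) : ¬ IsCoboundary (structConst b) α :=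
  not_isCoboundary (structConst_anti b) (traceForm_invariant b) (inv_traceForm_mul b)
    (inv_traceForm_apply b) hα hi h0

end TraceForm

lemma constField_ne_zero {n k : ℕ} {T : Tensor n k} (h : T ≠ 0) : constField T ≠ 0 := fun h0 =>
  h (congrFun h0 0)

lemma linearField_ne_zero {n m : ℕ} {ω : (Fin m → Fin n) → Fin n → ℝ} (h : ω ≠ 0) :
    linearField ω ≠ 0 := by
  intro h0
  refine h ?_
  ext I σ
  have := congrFun (congrFun h0 (Pi.single σ 1)) I
  simpa [linearField, Pi.single_apply] using this

/-- Raising with an invertible matrix loses nothing. -/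
lemma raise_ne_zero {n m : ℕ} {G : Matrix (Fin n) (Fin n) ℝ} (hG : G.det ≠ 0)
    {α : Tensor n (m + 1)} (h : α ≠ 0) : raise (fun i j => G i j) α ≠ 0 := by
  intro h0
  refine h ?_
  have h1 : ∀ I : Fin m → Fin n, (fun τ => α (Fin.snoc I τ)) = 0 := by
    intro I
    refine Matrix.eq_zero_of_vecMul_eq_zero hG ?_
    ext σ
    exact congrFun (congrFun h0 I) σ
  ext K
  rw [← Fin.snoc_init_self K]
  exact congrFun (h1 _) _

/-! ### The structures on the dual of `su(l + 1)` -/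

section SpecialUnitary

variable {l n : ℕ} (b : Module.Basis (Fin n) ℝ (su (l + 1)))

theorem polyCochain_tracePoly_cocycle {s : ℕ} (h1 : 1 ≤ s) (hs : s ≤ l) :
    IsSymm (tracePoly b (s + 1)) ∧ IsInvariant (structConst b) (tracePoly b (s + 1)) ∧
      IsCocycle (structConst b) (polyCochain (structConst b) (tracePoly b (s + 1))) ∧
      IsInvariant (structConst b) (polyCochain (structConst b) (tracePoly b (s + 1))) ∧
      ¬ IsCoboundary (structConst b) (polyCochain (structConst b) (tracePoly b (s + 1))) := by
  have hk := isSymm_tracePoly b (s + 1)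
  have hi := isInvariant_tracePoly b (s + 1)
  have hp := isInvariant_polyCochain (structConst_jacobi b) hk hi
  have hsk : IsSkew (polyCochain (structConst b) (tracePoly b (s + 1))) := skew_antisym _
  exact ⟨hk, hi, hp.isCocycle hsk, hp, not_isCoboundary_su b hsk hp
    (polyCochain_tracePoly_ne_zero b h1 hs)⟩

theorem structures_tracePoly {r : ℕ} (h1 : 1 ≤ r) (hr : r + 1 ≤ l)
    {Ω : TensorField n (2 * r + 2)} {E : TensorField n (2 * r + 1)}
    (hΩ : Ω = linearField (raiseLast b
      (polyCochain (structConst b) (tracePoly b (r + 1 + 1)))))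
    (hE : E = constField (polyCochain (structConst b) (tracePoly b (r + 1)))) :
    Ω ≠ 0 ∧ E ≠ 0 ∧ IsGenPoisson Ω ∧ poissonCoboundary Ω E = 0 ∧
      IsGenJacobi (Ω + wedge E (dilatation n)) E := by
  subst hΩ hE
  have hdet := det_killingMatrix_su_ne_zero b
  obtain ⟨-, -, hα, hαi, -⟩ := polyCochain_tracePoly_cocycle b (Nat.le_add_left 1 r) hr
  obtain ⟨-, -, hβ, hβi, -⟩ := polyCochain_tracePoly_cocycle b h1 (Nat.le_of_succ_le hr)
  obtain ⟨hP, hc, hJ⟩ := structures_raiseLast b hdet hα.1 hαi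
  refine ⟨linearField_ne_zero (raise_ne_zero (G := (killingMatrix b)⁻¹) ?_
    (polyCochain_tracePoly_ne_zero b (Nat.le_add_left 1 r) hr)), constField_ne_zero
    (polyCochain_tracePoly_ne_zero b h1 (Nat.le_of_succ_le hr)), hP, hc _ _ hβ.1 hβi,
    hJ _ hβ.1 hβi⟩
  exact (Matrix.isUnit_nonsing_inv_det _ (isUnit_iff_ne_zero.2 hdet)).ne_zero

end SpecialUnitary

/-! ### The Gell-Mann matrices -/

section GellMann

/-- The coefficient `1 / √3` in the last Gell-Mann matrix. -/
def invSqrtThree : ℂ := ((1 / Real.sqrt 3 : ℝ) : ℂ)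

lemma invSqrtThree_sq : invSqrtThree ^ 2 = 1 / 3 := by
  rw [invSqrtThree, ← Complex.ofReal_pow, div_pow, Real.sq_sqrt (by norm_num)]
  norm_num

lemma star_invSqrtThree : star invSqrtThree = invSqrtThree := Complex.conj_ofReal _

lemma gellMann_last : gellMann 7 = invSqrtThree • !![1, 0, 0; 0, 1, 0; 0, 0, -2] := rfl

lemma gellMann_hermitian (k : Fin 8) : (gellMann k)ᴴ = gellMann k := by
  have h := star_invSqrtThree
  ext i j
  fin_cases k <;> fin_cases i <;> fin_cases j <;>
    simp [gellMann, Matrix.conjTranspose_apply]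

lemma gellMann_trace (k : Fin 8) : (gellMann k).trace = 0 := by
  fin_cases k <;> simp [gellMann, Matrix.trace_fin_three]
  ring

lemma sum_smul_gellMann (c : Fin 8 → ℂ) : ∑ k, c k • gellMann k =
    !![c 2 + c 7 * invSqrtThree, c 0 - c 1 * Complex.I, c 3 - c 4 * Complex.I;
      c 0 + c 1 * Complex.I, -c 2 + c 7 * invSqrtThree, c 5 - c 6 * Complex.I;
      c 3 + c 4 * Complex.I, c 5 + c 6 * Complex.I, -2 * (c 7 * invSqrtThree)] := by
  rw [Fin.sum_univ_eight, gellMann_last]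
  ext i j
  fin_cases i <;> fin_cases j <;> simp [gellMann, sub_eq_add_neg]
  ring

lemma gellMann_independent {c : Fin 8 → ℂ} (h : ∑ k, c k • gellMann k = 0) : c = 0 := by
  rw [sum_smul_gellMann] at h
  have e := fun i j => congrFun (congrFun h i) j
  have hI := Complex.I_ne_zero
  have hs : invSqrtThree ≠ 0 := fun h0 => by simpa [h0] using invSqrtThree_sq
  have key : ∀ x y : ℂ, x - y * Complex.I = 0 → x + y * Complex.I = 0 → x = 0 ∧ y = 0 := by
    intro x y h1 h2
    have hx : x = 0 := by linear_combination (h1 + h2) / 2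
    refine ⟨hx, ?_⟩
    rw [hx, zero_add] at h2
    exact (mul_eq_zero.1 h2).resolve_right hI
  have e1 := key _ _ (e 0 1) (e 1 0)
  have e2 := key _ _ (e 0 2) (e 2 0)
  have e3 := key _ _ (e 1 2) (e 2 1)
  have e4 : c 7 = 0 := by
    have := e 2 2
    simpa [hs] using this
  have e5 : c 2 = 0 := by
    have := e 0 0
    simpa [e4] using this
  ext k
  fin_cases k
  exacts [e1.1, e1.2, e5, e2.1, e2.2, e3.1, e3.2, e4]

lemma trace_mul_gellMann (M : Matrix (Fin 3) (Fin 3) ℂ) (k : Fin 8) : (M * gellMann k).trace =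
    ![M 0 1 + M 1 0, (M 0 1 - M 1 0) * Complex.I, M 0 0 - M 1 1, M 0 2 + M 2 0,
      (M 0 2 - M 2 0) * Complex.I, M 1 2 + M 2 1, (M 1 2 - M 2 1) * Complex.I,
      (M 0 0 + M 1 1 - 2 * M 2 2) * invSqrtThree] k := by
  fin_cases k <;>
    simp [gellMann, Matrix.trace_fin_three, Matrix.mul_apply, Fin.sum_univ_three, invSqrtThree] <;>
    ring

/-- The completeness relation of the Gell-Mann matrices. -/
lemma sum_trace_smul_gellMann (M : Matrix (Fin 3) (Fin 3) ℂ) :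
    ∑ k, (M * gellMann k).trace • gellMann k =
      (2 : ℂ) • M - (2 / 3 * M.trace) • (1 : Matrix (Fin 3) (Fin 3) ℂ) := by
  have hI := Complex.I_sq
  have hs := invSqrtThree_sq
  simp only [trace_mul_gellMann, sum_smul_gellMann]
  ext i j
  fin_cases i <;> fin_cases j <;> simp [Matrix.trace_fin_three]
  · linear_combination (M 0 0 + M 1 1 - 2 * M 2 2) * hs
  · linear_combination -(M 0 1 - M 1 0) * hI
  · linear_combination -(M 0 2 - M 2 0) * hI
  · linear_combination (M 0 1 - M 1 0) * hI
  · linear_combination (M 0 0 + M 1 1 - 2 * M 2 2) * hs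
  · linear_combination -(M 1 2 - M 2 1) * hI
  · linear_combination (M 0 2 - M 2 0) * hI
  · linear_combination (M 1 2 - M 2 1) * hI
  · linear_combination -2 * (M 0 0 + M 1 1 - 2 * M 2 2) * hs

lemma trace_gellMann_mul (j k : Fin 8) :
    (gellMann j * gellMann k).trace = if j = k then 2 else 0 := by
  have h := sum_trace_smul_gellMann (gellMann j)
  rw [gellMann_trace, mul_zero, zero_smul, sub_zero] at h
  have h1 : ∑ k, ((gellMann j * gellMann k).trace - if j = k then 2 else 0) • gellMann k = 0 := by
    simp [sub_smul, h]
  exact sub_eq_zero.1 (congrFun (gellMann_independent h1) k)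

lemma sum_gellMann_mul_mul (M : Matrix (Fin 3) (Fin 3) ℂ) :
    ∑ k, gellMann k * M * gellMann k =
      (2 * M.trace) • (1 : Matrix (Fin 3) (Fin 3) ℂ) - (2 / 3 : ℂ) • M := by
  have hI := Complex.I_sq
  have hs := invSqrtThree_sq
  rw [Fin.sum_univ_eight, gellMann_last]
  rw [Matrix.eta_fin_three M]
  ext i j
  fin_cases i <;> fin_cases j <;> simp [gellMann, Matrix.trace_fin_three] <;> ring_nf <;>
    simp only [hI, hs] <;> ring

end GellMann

/-! ### Structure constants and Casimir eigenvalue in the Gell-Mann basis. -/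

section SuThree

lemma trace_commutator_gellMann (i j k : Fin 8) :
    ((gellMann i * gellMann j - gellMann j * gellMann i) * gellMann k).trace =
      4 * Complex.I * su3C i j k := by
  have h : ((su3C i j k : ℝ) : ℂ) =
      ((gellMann i * gellMann j - gellMann j * gellMann i) * gellMann k).trace /
        (4 * Complex.I) := by
    refine Complex.conj_eq_iff_re.1 ?_
    have h1 : star ((gellMann i * gellMann j - gellMann j * gellMann i) * gellMann k).trace =
        -((gellMann i * gellMann j - gellMann j * gellMann i) * gellMann k).trace := by
      rw [← Matrix.trace_conjTranspose, Matrix.conjTranspose_mul, Matrix.conjTranspose_sub,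
        Matrix.conjTranspose_mul, Matrix.conjTranspose_mul, gellMann_hermitian, gellMann_hermitian,
        gellMann_hermitian, Matrix.trace_mul_comm, ← Matrix.trace_neg, ← neg_mul, neg_sub]
    rw [map_div₀, starRingEnd_apply, h1, map_mul, Complex.conj_I, map_ofNat, mul_neg, neg_div_neg_eq]
  rw [h, mul_div_cancel₀]
  simp

lemma trace_anticommutator_gellMann (i j k : Fin 8) :
    ((gellMann i * gellMann j + gellMann j * gellMann i) * gellMann k).trace =
      4 * su3d i j k := by
  have h : ((su3d i j k : ℝ) : ℂ) =
      ((gellMann i * gellMann j + gellMann j * gellMann i) * gellMann k).trace / 4 := by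
    refine Complex.conj_eq_iff_re.1 ?_
    have h1 : star ((gellMann i * gellMann j + gellMann j * gellMann i) * gellMann k).trace =
        ((gellMann i * gellMann j + gellMann j * gellMann i) * gellMann k).trace := by
      rw [← Matrix.trace_conjTranspose, Matrix.conjTranspose_mul, Matrix.conjTranspose_add,
        Matrix.conjTranspose_mul, Matrix.conjTranspose_mul, gellMann_hermitian, gellMann_hermitian,
        gellMann_hermitian, Matrix.trace_mul_comm, add_comm]
    rw [map_div₀, starRingEnd_apply, h1, map_ofNat]
  rw [h, mul_div_cancel₀]
  simp

lemma commutator_gellMann (i j : Fin 8) :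
    gellMann i * gellMann j - gellMann j * gellMann i =
      ∑ k, (2 * Complex.I * su3C i j k) • gellMann k := by
  have h := sum_trace_smul_gellMann (gellMann i * gellMann j - gellMann j * gellMann i)
  rw [Matrix.trace_sub, Matrix.trace_mul_comm, sub_self, mul_zero, zero_smul, sub_zero] at h
  have h2 : (2 : ℂ) • (gellMann i * gellMann j - gellMann j * gellMann i) =
      (2 : ℂ) • ∑ k, (2 * Complex.I * su3C i j k) • gellMann k := by
    rw [← h, Finset.smul_sum]
    refine Finset.sum_congr rfl fun k _ => ?_
    rw [trace_commutator_gellMann, smul_smul]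
    ring_nf
  exact smul_right_injective _ two_ne_zero h2

lemma anticommutator_gellMann (i j : Fin 8) :
    gellMann i * gellMann j + gellMann j * gellMann i =
      (if i = j then (4 / 3 : ℂ) else 0) • (1 : Matrix (Fin 3) (Fin 3) ℂ) +
        ∑ k, (2 * (su3d i j k : ℂ)) • gellMann k := by
  have h := sum_trace_smul_gellMann (gellMann i * gellMann j + gellMann j * gellMann i)
  rw [Matrix.trace_add, Matrix.trace_mul_comm (gellMann j), trace_gellMann_mul,
    eq_sub_iff_add_eq] at h
  refine smul_right_injective _ (two_ne_zero (α := ℂ)) ?_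
  show (2 : ℂ) • _ = (2 : ℂ) • _
  rw [← h, smul_add, add_comm, Finset.smul_sum, smul_smul]
  congr 1
  · split_ifs <;> norm_num
  · refine Finset.sum_congr rfl fun k _ => ?_
    rw [trace_anticommutator_gellMann, smul_smul]
    ring_nf

lemma su3C_anti (i j k : Fin 8) : su3C i j k = -su3C j i k := by
  have h := trace_commutator_gellMann j i k
  rw [← neg_sub, neg_mul, Matrix.trace_neg, trace_commutator_gellMann] at h
  have h1 : (4 * Complex.I) * (su3C i j k + su3C j i k : ℂ) = 0 := by linear_combination -h
  have h2 := (mul_eq_zero.1 h1).resolve_left (by simp)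
  exact eq_neg_of_add_eq_zero_left (by exact_mod_cast h2)

lemma su3C_cycle (i j k : Fin 8) : su3C i j k = su3C j k i := by
  have h : ((gellMann i * gellMann j - gellMann j * gellMann i) * gellMann k).trace =
      ((gellMann j * gellMann k - gellMann k * gellMann j) * gellMann i).trace := by
    rw [sub_mul, sub_mul, Matrix.trace_sub, Matrix.trace_sub,
      Matrix.trace_mul_cycle (gellMann j) (gellMann k),
      Matrix.trace_mul_cycle (gellMann k) (gellMann j) (gellMann i),
      Matrix.trace_mul_cycle (gellMann i) (gellMann k) (gellMann j)]
  rw [trace_commutator_gellMann, trace_commutator_gellMann] at h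
  exact_mod_cast mul_left_cancel₀ (by simp) h

/-- The matrices `-(i / 2) λ_k` in `su(3)`. -/
def su3Vec (k : Fin 8) : su 3 := ⟨(-(Complex.I / 2)) • gellMann k, by
  refine ⟨?_, ?_⟩
  · rw [Matrix.conjTranspose_smul, gellMann_hermitian, ← neg_smul]
    congr 1
    simp
    ring
  · rw [Matrix.trace_smul, gellMann_trace, smul_zero]⟩

lemma coe_sum_smul_su3Vec (c : Fin 8 → ℝ) : ((∑ k, c k • su3Vec k : su 3) :
    Matrix (Fin 3) (Fin 3) ℂ) = ∑ k, (c k * (-(Complex.I / 2)) : ℂ) • gellMann k := by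
  refine (map_sum (su 3).toSubmodule.subtype (fun k => c k • su3Vec k) Finset.univ).trans ?_
  refine Finset.sum_congr rfl fun k _ => ?_
  rw [mul_smul, Complex.coe_smul]
  rfl

lemma linearIndependent_su3Vec : LinearIndependent ℝ su3Vec := by
  refine Fintype.linearIndependent_iff.2 fun c hc k => ?_
  have h := congrArg (Subtype.val : su 3 → Matrix (Fin 3) (Fin 3) ℂ) hc
  have h1 := congrFun (gellMann_independent ((coe_sum_smul_su3Vec c).symm.trans h)) k
  simpa using h1

lemma eq_sum_su3Vec (X : su 3) : X = ∑ k,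
    (Complex.I * ((X : Matrix (Fin 3) (Fin 3) ℂ) * gellMann k).trace).re • su3Vec k := by
  apply Subtype.ext
  rw [coe_sum_smul_su3Vec]
  have h := sum_trace_smul_gellMann (X : Matrix (Fin 3) (Fin 3) ℂ)
  rw [X.2.2, mul_zero, zero_smul, sub_zero] at h
  refine smul_right_injective _ (two_ne_zero (α := ℂ)) ?_
  show (2 : ℂ) • _ = (2 : ℂ) • _
  rw [← h, Finset.smul_sum]
  refine Finset.sum_congr rfl fun k _ => ?_
  have h1 : (((Complex.I * ((X : Matrix (Fin 3) (Fin 3) ℂ) * gellMann k).trace).re : ℝ) : ℂ) =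
      Complex.I * ((X : Matrix (Fin 3) (Fin 3) ℂ) * gellMann k).trace := by
    refine Complex.conj_eq_iff_re.1 ?_
    rw [map_mul, Complex.conj_I, starRingEnd_apply, ← Matrix.trace_conjTranspose,
      Matrix.conjTranspose_mul, gellMann_hermitian, X.2.1, Matrix.trace_mul_comm, neg_mul,
      Matrix.neg_mul, Matrix.trace_neg, mul_neg, neg_neg]
  rw [h1, smul_smul]
  congr 1
  linear_combination ((X : Matrix (Fin 3) (Fin 3) ℂ) * gellMann k).trace * Complex.I_sq

/-- The basis `-(i / 2) λ_k` of `su(3)`. -/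
def su3Basis : Module.Basis (Fin 8) ℝ (su 3) :=
  Module.Basis.mk linearIndependent_su3Vec fun X _ => by
    rw [eq_sum_su3Vec X]
    exact Submodule.sum_mem _ fun k _ => Submodule.smul_mem _ _ (Submodule.subset_span ⟨k, rfl⟩)

lemma coe_su3Basis (k : Fin 8) :
    (su3Basis k : Matrix (Fin 3) (Fin 3) ℂ) = (-(Complex.I / 2)) • gellMann k := by
  rw [su3Basis, Module.Basis.mk_apply]
  rfl

lemma structConst_su3Basis : structConst su3Basis = su3C := by
  ext i j k
  have h : ⁅su3Basis i, su3Basis j⁆ = ∑ k, su3C i j k • su3Basis k := by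
    apply Subtype.ext
    have h1 : ∑ k, su3C i j k • su3Basis k = ∑ k, su3C i j k • su3Vec k := by
      simp [su3Basis]
    rw [h1, coe_sum_smul_su3Vec, LieSubalgebra.coe_bracket, Ring.lie_def, coe_su3Basis,
      coe_su3Basis, smul_mul_smul_comm, smul_mul_smul_comm, ← smul_sub, commutator_gellMann,
      Finset.smul_sum]
    refine Finset.sum_congr rfl fun k _ => ?_
    rw [smul_smul]
    congr 1
    linear_combination (Complex.I * su3C i j k / 2) * Complex.I_sq
  rw [structConst, h, su3Basis.repr_sum_self]

lemma su3C_jacobi (f c a e : Fin 8) : ∑ m, su3C c a m * su3C f m e =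
    ∑ m, su3C f c m * su3C m a e + ∑ m, su3C f a m * su3C c m e := by
  have h := structConst_jacobi su3Basis f c a e
  rwa [structConst_su3Basis] at h

/-- The double commutators `[λ_c, [λ_c, λ_a]]` sum to `12 λ_a`, since `∑ λ_c λ_c = 16/3` and `∑ λ_c
λ_a λ_c = -(2/3) λ_a`. Each commutator carries a factor `2i`, so `12 / (-4) = -3`. -/
lemma sum_su3C_mul_su3C (a f : Fin 8) :
    ∑ c, ∑ e, su3C c a e * su3C c e f = if a = f then -3 else 0 := by
  have h1 : ∑ c, (gellMann c * (gellMann c * gellMann a - gellMann a * gellMann c) -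
      (gellMann c * gellMann a - gellMann a * gellMann c) * gellMann c) =
      (12 : ℂ) • gellMann a := by
    have h2 := sum_gellMann_mul_mul (gellMann a)
    have h3 := sum_gellMann_mul_mul 1
    rw [gellMann_trace, mul_zero, zero_smul, zero_sub] at h2
    simp only [mul_one, Matrix.trace_one, Fintype.card_fin] at h3
    have h4 : ∀ c, gellMann c * (gellMann c * gellMann a - gellMann a * gellMann c) -
        (gellMann c * gellMann a - gellMann a * gellMann c) * gellMann c =
        gellMann c * gellMann c * gellMann a + gellMann a * (gellMann c * gellMann c) -
          (2 : ℂ) • (gellMann c * gellMann a * gellMann c) := by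
      intro c
      rw [two_smul]
      noncomm_ring
    simp only [h4, Finset.sum_sub_distrib, Finset.sum_add_distrib, ← Finset.sum_mul,
      ← Finset.mul_sum, ← Finset.smul_sum, h2, h3]
    rw [sub_mul, mul_sub, Matrix.smul_mul, Matrix.mul_smul, Matrix.smul_mul, Matrix.mul_smul,
      one_mul, mul_one]
    module
  have h2 : ∀ c, gellMann c * (gellMann c * gellMann a - gellMann a * gellMann c) -
      (gellMann c * gellMann a - gellMann a * gellMann c) * gellMann c =
      ∑ f, ∑ e, (-4 * (su3C c a e * su3C c e f) : ℂ) • gellMann f := by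
    intro c
    rw [commutator_gellMann c a, Finset.mul_sum, Finset.sum_mul, ← Finset.sum_sub_distrib,
      Finset.sum_comm]
    refine Finset.sum_congr rfl fun e _ => ?_
    rw [mul_smul_comm, smul_mul_assoc, ← smul_sub, commutator_gellMann, Finset.smul_sum]
    refine Finset.sum_congr rfl fun f _ => ?_
    rw [smul_smul]
    congr 1
    linear_combination (4 * su3C c a e * su3C c e f) * Complex.I_sq
  have h3 : ∑ f, ((∑ c, ∑ e, (-4 * (su3C c a e * su3C c e f) : ℂ)) -
      if a = f then 12 else 0) • gellMann f = 0 := by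
    simp only [sub_smul, Finset.sum_sub_distrib, ite_smul, zero_smul, Finset.sum_ite_eq,
      Finset.mem_univ, if_true]
    rw [← h1, sub_eq_zero]
    simp only [h2, Finset.sum_smul]
    rw [Finset.sum_comm]
  have h4 := sub_eq_zero.1 (congrFun (gellMann_independent h3) f)
  simp only [← Finset.mul_sum] at h4
  have h5 : -4 * ∑ c, ∑ e, su3C c a e * su3C c e f = if a = f then 12 else 0 := by
    apply Complex.ofReal_injective
    push_cast [apply_ite Complex.ofReal]
    exact h4
  split_ifs at h5 ⊢ <;> linarith

theorem casimirData_su3C : CasimirData su3C (fun i j => if i = j then 1 else 0) (-3) where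
  anti := su3C_anti
  jacobi := su3C_jacobi
  symm i j := by simp only [eq_comm]
  invariant a i j := by
    simp only [mul_ite, ite_mul, mul_one, one_mul, mul_zero, zero_mul, Finset.sum_ite_eq,
      Finset.sum_ite_eq', Finset.mem_univ, if_true]
    rw [su3C_cycle a i j, su3C_anti i j a, su3C_cycle a j i, add_neg_cancel]
  ne_zero := by norm_num
  casimir a f := by
    rw [← sum_su3C_mul_su3C]
    refine Finset.sum_congr rfl fun b _ => ?_
    rw [Finset.sum_eq_single b (fun c _ hc => by simp [hc.symm]) (by simp)]
    simp

end SuThree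

/-! ### Identification of the explicit `Ω` and `E` with the cocycle construction. -/

section SuThreeStructures

/-- The Hermitian matrices of the chosen basis are `-λ_k / 2`, which gives a factor `-1/8`; the six
orderings fall into two cyclic classes. -/
lemma su3d_eq_tracePoly (K : Fin 3 → Fin 8) :
    su3d (K 0) (K 1) (K 2) = -4 * tracePoly su3Basis 3 K := by
  have h1 : ∀ k, herm su3Basis k = (-(1 / 2) : ℂ) • gellMann k := by
    intro k
    rw [herm, coe_su3Basis, smul_smul]
    congr 1
    linear_combination (1 / 2 : ℂ) * Complex.I_sq
  have h2 := tracePoly_eq su3Basis 3 K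
  have h3 := trace_anticommutator_gellMann (K 0) (K 1) (K 2)
  have h4 : symTrace ℂ 3 3 (fun j => herm su3Basis (K j)) =
      ∑ σ : Equiv.Perm (Fin 3), -(1 / 8) *
        (gellMann (K (σ 0)) * gellMann (K (σ 1)) * gellMann (K (σ 2))).trace := by
    rw [symTrace_apply]
    refine Finset.sum_congr rfl fun σ _ => ?_
    have h5 : (List.ofFn fun j => herm su3Basis (K (σ j))).prod =
        herm su3Basis (K (σ 0)) * herm su3Basis (K (σ 1)) * herm su3Basis (K (σ 2)) := by
      simp [List.ofFn_succ, mul_assoc]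
    rw [h5, h1, h1, h1, smul_mul_smul_comm, smul_mul_smul_comm, Matrix.trace_smul, smul_eq_mul]
    norm_num
  rw [h4, sum_perm_three_apply fun _ i j k => -(1 / 8) *
    (gellMann (K i) * gellMann (K j) * gellMann (K k)).trace] at h2
  rw [add_mul, Matrix.trace_add] at h3
  rw [Matrix.trace_mul_cycle (gellMann (K 1)) (gellMann (K 2)),
    Matrix.trace_mul_cycle (gellMann (K 2)) (gellMann (K 0)),
    Matrix.trace_mul_cycle (gellMann (K 1)) (gellMann (K 2)),
    ← Matrix.trace_mul_cycle (gellMann (K 0)) (gellMann (K 2)),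
    Matrix.trace_mul_cycle (gellMann (K 2)) (gellMann (K 1)),
    Matrix.trace_mul_cycle (gellMann (K 0)) (gellMann (K 2))] at h2
  apply Complex.ofReal_injective
  push_cast
  rw [h2]
  norm_num [Nat.factorial]
  linear_combination -h3 / 4

lemma su3C_invariant : IsInvariant su3C fun I : Fin 3 → Fin 8 => su3C (I 0) (I 1) (I 2) := by
  intro a I
  rw [Fin.sum_univ_three]
  have h := su3C_jacobi a (I 0) (I 1) (I 2)
  have h1 : ∀ ν, su3C a (I 2) ν * su3C (I 0) (I 1) ν = -(su3C (I 0) (I 1) ν * su3C a ν (I 2)) := by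
    intro ν
    rw [← su3C_cycle ν a, su3C_anti ν a]
    ring
  simp [h1, h]

/-- The tensor whose contraction gives the coefficients of `su3Omega`. -/
def su3Raw (σ : Fin 8) (I : Fin 4 → Fin 8) : ℝ := ∑ μ : Fin 2 → Fin 8,
  rawProd su3C μ I * su3d σ (μ 0) (μ 1)

/-- The partial antisymmetrization over the last three indices runs over the permutations of four
indices that fix the first. -/
lemma su3Coeff_eq (I : Fin 4 → Fin 8) (σ : Fin 8) : su3Coeff I σ =
    ∑ τ : Equiv.Perm (Fin 3), ((Equiv.Perm.sign τ : ℤ) : ℝ) *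
      su3Raw σ (I ∘ Equiv.Perm.decomposeFin.symm (0, τ)) := by
  rw [su3Coeff, antisym]
  refine Finset.sum_congr rfl fun τ _ => ?_
  congr 1
  rw [su3Raw, ← (finTwoArrowEquiv (Fin 8)).symm.sum_comp, Fintype.sum_prod_type]
  refine Finset.sum_congr rfl fun k₁ _ => Finset.sum_congr rfl fun k₂ _ => ?_
  have h : ∀ i : Fin 3, (![I 1, I 2, I 3] ∘ τ) i =
      (I ∘ Equiv.Perm.decomposeFin.symm (0, τ)) i.succ := by
    intro i
    have h1 : ∀ j : Fin 3, ![I 1, I 2, I 3] j = I j.succ := by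
      intro j
      fin_cases j <;> rfl
    simp [h1, Equiv.Perm.decomposeFin_symm_apply_succ]
  have h0 : I 0 = (I ∘ Equiv.Perm.decomposeFin.symm (0, τ)) 0 := by simp
  rw [h, h, h, h0, rawProd, Fin.prod_univ_two]
  simp [finTwoArrowEquiv]
  ring

/-- The constant is `6 * (-4)`: six permutations fixing the first index, and `d = -4` times the
trace polynomial. -/
lemma el_su3Coeff (σ : Fin 8) :
    el (fun I => su3Coeff I σ) = (-24 : ℝ) • polyRest su3C (s := 2) (tracePoly su3Basis 3) σ := by
  have h1 : el (su3Raw σ) = (-4 : ℝ) • polyRest su3C (s := 2) (tracePoly su3Basis 3) σ := by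
    have h2 : su3Raw σ = (-4 : ℝ) • fun J : Fin (2 * 2) → Fin 8 => ∑ μ, rawProd su3C μ J *
        tracePoly su3Basis 3 (Fin.cons σ μ) := by
      ext J
      rw [su3Raw, Pi.smul_apply, smul_eq_mul, Finset.mul_sum]
      refine Finset.sum_congr rfl fun μ _ => ?_
      have := su3d_eq_tracePoly (Fin.cons σ μ)
      rw [mul_left_comm, ← this]
      rfl
    rw [h2, el_smul, el_sum_rawProd, polyRest]
  have h2 : (fun I => su3Coeff I σ) = ∑ τ : Equiv.Perm (Fin 3), ((Equiv.Perm.sign τ : ℤ) : ℝ) •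
      fun I => su3Raw σ (I ∘ Equiv.Perm.decomposeFin.symm (0, τ)) := by
    ext I
    rw [su3Coeff_eq, Finset.sum_apply]
    rfl
  rw [h2, el_sum]
  simp only [el_smul, el_comp_perm, Equiv.Perm.decomposeFin.symm_sign, if_true, one_mul, smul_smul,
    h1]
  simp only [← mul_assoc, sign_mul_self, one_mul]
  rw [Finset.sum_const, Finset.card_univ, Fintype.card_perm, ← Nat.cast_smul_eq_nsmul ℝ, smul_smul]
  norm_num [Nat.factorial]

/-- The cocycle of order five of `su(3)`, normalized so that it gives `su3Omega`. -/
def su3Cocycle : Tensor 8 (2 * 1 + 3) :=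
  (-(1 / 5) : ℝ) • polyCochain su3C (s := 2) (tracePoly su3Basis 3)

lemma skew_su3Cocycle : IsSkew su3Cocycle :=
  Skew.smul (skew_antisym _) _

lemma invariant_su3Cocycle : IsInvariant su3C su3Cocycle := by
  have hi := isInvariant_tracePoly su3Basis 3
  rw [structConst_su3Basis] at hi
  have h := isInvariant_polyCochain (s := 2) su3C_jacobi (isSymm_tracePoly su3Basis 3) hi
  intro a I
  have := h a I
  simp only [su3Cocycle, Pi.smul_apply, smul_eq_mul, mul_left_comm _ (-(1 / 5) : ℝ),
    ← Finset.mul_sum]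
  rw [this, mul_zero]

lemma su3Cocycle_ne_zero : su3Cocycle ≠ 0 := by
  have h := polyCochain_tracePoly_ne_zero (l := 2) (s := 2) su3Basis (by norm_num) le_rfl
  rw [structConst_su3Basis] at h
  exact smul_ne_zero (by norm_num) h

/-- Both sides are `-polyRest`: on the left `-24 / 4!`, on the right `-1/5` times the factor `2s + 1
= 5` from `con_polyForm`. -/
lemma su3Omega_eq : su3Omega =
    linearField (raise (fun i j => if i = j then 1 else 0) su3Cocycle) := by
  rw [su3Omega]
  congr 1
  ext I σ
  have hi := isInvariant_tracePoly su3Basis 3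
  rw [structConst_su3Basis] at hi
  have hsk : Skew fun I => raise (fun i j => if i = j then 1 else 0) su3Cocycle I σ :=
    skew_raise skew_su3Cocycle σ
  have hL : Skew ((1 / (Nat.factorial 4 : ℝ)) • antisym fun J => su3Coeff J σ) :=
    (skew_antisym _).smul _
  have h1 : nel ((1 / (Nat.factorial 4 : ℝ)) • antisym fun J => su3Coeff J σ) =
      -polyRest su3C (s := 2) (tracePoly su3Basis 3) σ := by
    rw [nel_smul, antisym_eq_alt, nel_alt, el_su3Coeff, smul_smul]
    norm_num [Nat.factorial]
  have h2 : nel (fun I => raise (fun i j => if i = j then 1 else 0) su3Cocycle I σ) =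
      -polyRest su3C (s := 2) (tracePoly su3Basis 3) σ := by
    rw [nel_raise skew_su3Cocycle, su3Cocycle]
    simp only [ite_smul, zero_smul, one_smul, Finset.sum_ite_eq', Finset.mem_univ, if_true,
      nel_smul, map_smul]
    have h3 := con_polyForm (s := 2) su3C_anti su3C_jacobi (isSymm_tracePoly su3Basis 3) hi σ
    rw [← nel_polyCochain (isSymm_tracePoly su3Basis 3)] at h3
    rw [h3, smul_smul]
    norm_num
  exact congrFun (hL.eq_of_nel hsk (h1.trans h2.symm)) I

lemma su3Omega_ne_zero : su3Omega ≠ 0 := by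
  rw [su3Omega_eq]
  refine linearField_ne_zero (raise_ne_zero (G := 1) (by simp) su3Cocycle_ne_zero)

lemma su3E_eq : su3E = constField fun I => su3C (I 0) (I 1) (I 2) := by
  rw [su3E]
  congr 1
  ext I
  rw [Pi.smul_apply, antisym]
  have h := sum_perm_three_apply fun ε i j k => ((ε : ℤ) : ℝ) * su3C (I i) (I j) (I k)
  refine (congrArg ((1 / (Nat.factorial 3 : ℝ)) • ·) h).trans ?_
  rw [su3C_anti (I 1) (I 0) (I 2), su3C_cycle (I 2) (I 0), su3C_cycle (I 1) (I 2) (I 0),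
    su3C_cycle (I 2) (I 0) (I 1), su3C_anti (I 0) (I 2), su3C_cycle (I 2) (I 0) (I 1),
    su3C_anti (I 2) (I 1), su3C_cycle (I 1) (I 2) (I 0), su3C_cycle (I 2) (I 0) (I 1)]
  norm_num [Nat.factorial]
  ring

/-- The generalized Jacobi structure on the dual of `su(3)`. -/
theorem structures_su3 : IsGenPoisson (r := 1) su3Omega ∧
    poissonCoboundary (r := 1) (b := 2) su3Omega su3E = 0 ∧
    IsGenJacobi (r := 1) (su3Omega + wedge su3E (dilatation 8)) su3E := by
  have hsk : IsSkew fun I : Fin 3 → Fin 8 => su3C (I 0) (I 1) (I 2) := by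
    have h := congrFun su3E_eq 0
    rw [su3E, constField, constField] at h
    rw [← h]
    exact (skew_antisym _).smul _
  obtain ⟨h1, h2, h3⟩ := casimirData_su3C.structures (r := 1) skew_su3Cocycle invariant_su3Cocycle
  rw [su3Omega_eq, su3E_eq]
  exact ⟨h1, h2 2 _ hsk su3C_invariant, h3 _ hsk su3C_invariant⟩

lemma su3E_apply (x : Fin 8 → ℝ) (I : Fin 3 → Fin 8) : su3E x I = su3C (I 0) (I 1) (I 2) := by
  rw [su3E_eq]
  rfl

/-- If all structure constants vanished, the Casimir eigenvalue could not be `-3`. -/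
lemma su3E_ne_zero : su3E ≠ 0 := by
  intro h
  have h1 : ∀ i j k, su3C i j k = 0 := by
    intro i j k
    have h2 := su3E_apply 0 ![i, j, k]
    rw [h] at h2
    exact h2.symm
  have h3 := sum_su3C_mul_su3C 0 0
  simp [h1] at h3

end SuThreeStructures

end GenJacobi

end

theorem mainTheorem2 :
    -- linear generalized Jacobi structures from a linear generalized Poisson structure
    (∀ (n r : ℕ) (ω : (Fin (2 * r + 2) → Fin n) → Fin n → ℝ),
      GenJacobi.IsGenPoisson (GenJacobi.linearField ω) →
      (∀ E : GenJacobi.TensorField n (2 * r + 1), GenJacobi.IsMultivectorField E →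
        (GenJacobi.schouten E
              (GenJacobi.linearField ω + GenJacobi.wedge E (GenJacobi.dilatation n)) = 0 ↔
          ∀ x K, GenJacobi.schouten E (GenJacobi.linearField ω) x K =
            -GenJacobi.wedge E (GenJacobi.schouten E (GenJacobi.dilatation n)) x
              (fun i => K (Fin.cast (by omega) i))) ∧
        (GenJacobi.schouten E
              (GenJacobi.linearField ω + GenJacobi.wedge E (GenJacobi.dilatation n)) = 0 →
          GenJacobi.IsGenJacobi
            (GenJacobi.linearField ω + GenJacobi.wedge E (GenJacobi.dilatation n)) E)) ∧
      (∀ ξ : GenJacobi.Tensor n (2 * r + 1), GenJacobi.IsSkew ξ →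
        (GenJacobi.schouten (GenJacobi.constField ξ) (GenJacobi.linearField ω +
              GenJacobi.wedge (GenJacobi.constField ξ) (GenJacobi.dilatation n)) = 0 ↔
          GenJacobi.antisym (fun J : Fin (2 * r + (2 * r + 2)) → Fin n => ∑ ν : Fin n,
            ξ (Fin.cons ν (fun i : Fin (2 * r) => J (Fin.castAdd (2 * r + 2) i))) *
              ω (fun j => J (Fin.natAdd (2 * r) j)) ν) = 0) ∧
        (GenJacobi.schouten (GenJacobi.constField ξ) (GenJacobi.linearField ω +
              GenJacobi.wedge (GenJacobi.constField ξ) (GenJacobi.dilatation n)) = 0 ↔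
          GenJacobi.poissonCoboundary (GenJacobi.linearField ω) (GenJacobi.constField ξ) = 0))) ∧
    -- simple Lie algebras
    (∀ (𝒢 : Type*) [LieRing 𝒢] [LieAlgebra ℝ 𝒢] [LieAlgebra.IsSimple ℝ 𝒢] (n : ℕ)
      (b : Module.Basis (Fin n) ℝ 𝒢),
      -- invariant skew forms are cocycles; invariant polynomials give such forms
      (∀ (q : ℕ) (α : GenJacobi.Tensor n q), GenJacobi.IsSkew α →
        GenJacobi.IsInvariant (GenJacobi.structConst b) α →
        GenJacobi.IsCocycle (GenJacobi.structConst b) α) ∧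
      (∀ (s : ℕ) (k : GenJacobi.Tensor n (s + 1)), GenJacobi.IsSymm k →
        GenJacobi.IsInvariant (GenJacobi.structConst b) k →
        GenJacobi.IsSkew (GenJacobi.polyCochain (GenJacobi.structConst b) k) ∧
        GenJacobi.IsInvariant (GenJacobi.structConst b)
          (GenJacobi.polyCochain (GenJacobi.structConst b) k)) ∧
      -- an invariant cocycle of order `2p + 1` and one of order `2p - 1` give a structure
      (∀ (r : ℕ) (α : GenJacobi.Tensor n (2 * r + 3)), GenJacobi.IsSkew α →
        GenJacobi.IsInvariant (GenJacobi.structConst b) α →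
        GenJacobi.IsGenPoisson (GenJacobi.linearField (GenJacobi.raiseLast b α)) ∧
        (∀ (q : ℕ) (β : GenJacobi.Tensor n (q + 1)), GenJacobi.IsSkew β →
          GenJacobi.IsInvariant (GenJacobi.structConst b) β →
          GenJacobi.poissonCoboundary (GenJacobi.linearField (GenJacobi.raiseLast b α))
            (GenJacobi.constField β) = 0) ∧
        (∀ β : GenJacobi.Tensor n (2 * r + 1), GenJacobi.IsSkew β →
          GenJacobi.IsInvariant (GenJacobi.structConst b) β →
          GenJacobi.IsGenJacobi
            (GenJacobi.linearField (GenJacobi.raiseLast b α) +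
              GenJacobi.wedge (GenJacobi.constField β) (GenJacobi.dilatation n))
            (GenJacobi.constField β))) ∧
      -- the case `p = 1` with the structure constants is singular
      (∀ ξ : GenJacobi.Tensor n (2 * 0 + 1),
        GenJacobi.IsGenJacobi (r := 0)
          (GenJacobi.linearField (fun I k => GenJacobi.structConst b (I 0) (I 1) k) +
            GenJacobi.wedge (GenJacobi.constField ξ) (GenJacobi.dilatation n))
          (GenJacobi.constField ξ) → ξ = 0)) ∧
    -- `su(l + 1)`, `l ≥ 2`
    (∀ (l n : ℕ) (b : Module.Basis (Fin n) ℝ (GenJacobi.su (l + 1))), 2 ≤ l →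
      -- `l` invariant polynomials of orders `2, …, l + 1`, `l` cocycles of orders `3, …, 2l + 1`
      (∀ s : ℕ, 1 ≤ s → s ≤ l →
        GenJacobi.IsSymm (GenJacobi.tracePoly b (s + 1)) ∧
        GenJacobi.IsInvariant (GenJacobi.structConst b) (GenJacobi.tracePoly b (s + 1)) ∧
        GenJacobi.IsCocycle (GenJacobi.structConst b)
          (GenJacobi.polyCochain (GenJacobi.structConst b) (GenJacobi.tracePoly b (s + 1))) ∧
        GenJacobi.IsInvariant (GenJacobi.structConst b)
          (GenJacobi.polyCochain (GenJacobi.structConst b) (GenJacobi.tracePoly b (s + 1))) ∧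
        ¬ GenJacobi.IsCoboundary (GenJacobi.structConst b)
          (GenJacobi.polyCochain (GenJacobi.structConst b) (GenJacobi.tracePoly b (s + 1)))) ∧
      -- for `2 ≤ p ≤ l`, with `p = r + 1`
      (∀ r : ℕ, 1 ≤ r → r + 1 ≤ l →
        ∀ (Ω : GenJacobi.TensorField n (2 * r + 2)) (E : GenJacobi.TensorField n (2 * r + 1)),
        Ω = GenJacobi.linearField (GenJacobi.raiseLast b
          (GenJacobi.polyCochain (GenJacobi.structConst b)
            (GenJacobi.tracePoly b (r + 1 + 1)))) →
        E = GenJacobi.constField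
          (GenJacobi.polyCochain (GenJacobi.structConst b) (GenJacobi.tracePoly b (r + 1))) →
        Ω ≠ 0 ∧ E ≠ 0 ∧ GenJacobi.IsGenPoisson Ω ∧ GenJacobi.poissonCoboundary Ω E = 0 ∧
        GenJacobi.IsGenJacobi (Ω + GenJacobi.wedge E (GenJacobi.dilatation n)) E)) ∧
    -- the explicit structure for `su(3)`
    ((∃ b : Module.Basis (Fin 8) ℝ (GenJacobi.su 3),
        (∀ i, (b i : Matrix (Fin 3) (Fin 3) ℂ) = (-(Complex.I / 2)) • GenJacobi.gellMann i) ∧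
        ∀ i j k, GenJacobi.structConst b i j k = GenJacobi.su3C i j k) ∧
      (∀ i j, GenJacobi.gellMann i * GenJacobi.gellMann j +
          GenJacobi.gellMann j * GenJacobi.gellMann i =
        (if i = j then (4 / 3 : ℂ) else 0) • (1 : Matrix (Fin 3) (Fin 3) ℂ) +
          ∑ k, (2 * (GenJacobi.su3d i j k : ℂ)) • GenJacobi.gellMann k) ∧
      GenJacobi.su3Omega ≠ 0 ∧ GenJacobi.su3E ≠ 0 ∧
      (∀ x I, GenJacobi.su3E x I = GenJacobi.su3C (I 0) (I 1) (I 2)) ∧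
      GenJacobi.IsGenPoisson (r := 1) GenJacobi.su3Omega ∧
      GenJacobi.poissonCoboundary (r := 1) (b := 2) GenJacobi.su3Omega GenJacobi.su3E = 0 ∧
      GenJacobi.IsGenJacobi (r := 1)
        (GenJacobi.su3Omega +
          GenJacobi.wedge GenJacobi.su3E (GenJacobi.dilatation 8)) GenJacobi.su3E) := by
  refine ⟨fun n r ω hΩ => GenJacobi.linear_structures n r (by omega) ω hΩ, ?_, ?_, ?_⟩
  · intro 𝒢 _ _ _ n b
    refine ⟨fun q α hs hi => hi.isCocycle hs, fun s k hk hi => ⟨GenJacobi.skew_antisym _,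
      GenJacobi.isInvariant_polyCochain (GenJacobi.structConst_jacobi b) hk hi⟩, fun r α hs hi =>
      GenJacobi.structures_raiseLast b (GenJacobi.det_killingMatrix_ne_zero b) hs hi,
      fun ξ h => GenJacobi.eq_zero_of_isGenJacobi_structConst b h⟩
  · intro l n b _
    exact ⟨fun s h1 hs => GenJacobi.polyCochain_tracePoly_cocycle b h1 hs,
      fun r h1 hr Ω E hΩ hE => GenJacobi.structures_tracePoly b h1 hr hΩ hE⟩
  · exact ⟨⟨GenJacobi.su3Basis, GenJacobi.coe_su3Basis, fun i j k => by
      rw [GenJacobi.structConst_su3Basis]⟩, GenJacobi.anticommutator_gellMann,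
      GenJacobi.su3Omega_ne_zero, GenJacobi.su3E_ne_zero, GenJacobi.su3E_apply,
      GenJacobi.structures_su3⟩
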